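/- Let $G$ be a finite abelian group of order $n$, written as an internal direct product $G=\langle c_1\rangle\times\cdots\times\langle c_K\rangle$ of cyclic subgroups. Let $\mathbb P=\mathbb P(\mathbb A^1\oplus\mathbb A^n)=\operatorname{Proj}\mathbb Q[Y,X_g : g\in G]$, where $G$ acts trivially on $\mathbb A^1$ and by left translation on $\mathbb A^n$, the affine space of the group algebra with coordinates $(X_g)$ dual to the basis $G$. Let $\mathcal G\subset\mathbb A^n=\{Y\neq 0\}\subset\mathbb P$ be the group scheme of units of the group algebra, that is, the open subscheme where $\det(X_{gh})_{g,h\in G}$ is invertible; it contains $G$ as a constant subgroup. Put $T=\mathcal G/G$ with the induced group structure. Let $G^\vee=\operatorname{Hom}(G,\mathbb C^\times)$, let $E\subset\mathbb C$ be the field generated over $\mathbb Q$ by the values of all $\chi\in G^\vee$, and let $\Gamma=\operatorname{Gal}(E/\mathbb Q)$. For $\chi\in G^\vee$ let $v_\chi=\frac1n\sum_{g\in G}\chi(g^{-1})g$, let $N_E'=\bigoplus_\chi\mathbb Z v_\chi$, let $v_0=-\sum_\chi v_\chi$, and let $\Gamma$ act by $\gamma v_\chi=v_{\gamma\circ\chi}$.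 For a root of unity $\zeta$ let $\ell(\zeta)\in[0,1)\cap\mathbb Q$ be the number with $e^{2\pi i\ell(\zeta)}=\zeta$. Put $$\omega_j=\sum_{\chi\in G^\vee}\ell(\chi(c_j^{-1}))\,v_\chi\in N_E'\otimes\mathbb Q,\qquad N_E=N_E'+\sum_{j=1}^K\mathbb Z\,\omega_j,$$ and let $M\subseteq M'$ be the lattices dual to $N_E\supseteq N_E'$. Let $\Sigma$ be the set of cones in $N_E'\otimes\mathbb R$ spanned by the proper subsets of $\{v_0\}\cup\{v_\chi:\chi\in G^\vee\}$. Then $\Sigma$ is a fan for $N_E$, it and $N_E$ are stable under $\Gamma$, and the toric variety over $\mathbb Q$ associated to $\Sigma$ and to $N_E$ with this $\Gamma$-action is the quotient variety $\mathbb P/G$, with open torus $T$. Explicitly, the quotient $\pi:\mathbb P\to\mathbb P/G$ exists over $\mathbb Q$ (the underlying space of $\mathbb P/G$ is the orbit space and its functions are the $G$-invariant functions on $\mathbb P$), and: 1. $(\mathbb P/G)_E$ is glued from the affine toric varieties $U_\sigma=\operatorname{Spec}E[\sigma^\vee\cap M]$, $\sigma\in\Sigma$, along the open subsets $U_\tau\subseteq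 U_\sigma$ for $\tau\subseteq\sigma$, and the action of $\gamma\in\Gamma$ on $(\mathbb P/G)_E$ is given on functions by $a\,e^u\mapsto\gamma(a)\,e^{\gamma u}$, $E[\sigma^\vee\cap M]\to E[(\gamma\sigma)^\vee\cap M]$. 2. $T$ is an open subscheme of $\mathbb P/G$ compatibly with $\mathcal G\subset\mathbb P$, and there are isomorphisms of group schemes $\mathcal G_E\cong\operatorname{Spec}E[M']$, given by the coefficients along the idempotents $v_\chi$, and $T_E\cong\operatorname{Spec}E[M]$, under which $\mathcal G_E\to T_E$ corresponds to $M\subseteq M'$ and $T_E\subset(\mathbb P/G)_E$ is the chart $U_{\{0\}}=\operatorname{Spec}E[M]$. 3. Consequently the cocharacter lattice $\operatorname{Hom}(\mathbb G_{m,E},T_E)$ is $N_E$, where $v\in N_E$ corresponds to the cocharacter with $e^u\mapsto t^{\langle u,v\rangle}$ for $u\in M$, and its natural $\Gamma$-action is the one on $N_E$. -/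

import Mathlib

open CategoryTheory AlgebraicGeometry TensorProduct

noncomputable section

namespace QuotientToric

section Retract

variable {A B : Type} [CommRing A] [Algebra ℚ A] [CommRing B] [Bialgebra ℚ B]
  (i : A →ₐ[ℚ] B) (r : B →ₗ[ℚ] A)

lemma retract_map (hr : ∀ a, r (i a) = a) (x : A ⊗[ℚ] A) :
    TensorProduct.map r r (Algebra.TensorProduct.map i i x) = x := by
  induction x with
  | zero => simp
  | tmul a b => simp [hr]
  | add x y hx hy => simp only [map_add, hx, hy]

lemma retract_map₃ (hr : ∀ a, r (i a) = a) (x : A ⊗[ℚ] (A ⊗[ℚ] A)) :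
    TensorProduct.map r (TensorProduct.map r r)
      (Algebra.TensorProduct.map i (Algebra.TensorProduct.map i i) x) = x := by
  induction x with
  | zero => simp
  | tmul a b => simp [hr, retract_map i r hr]
  | add x y hx hy => simp only [map_add, hx, hy]

/-- If the comultiplication of `B` maps `A ⊆ B` to `A ⊗ A ⊆ B ⊗ B`, this is its restriction. -/
def restrictComul (hr : ∀ a, r (i a) = a)
    (h : ∀ a, Algebra.TensorProduct.map i i (TensorProduct.map r r
      (Coalgebra.comul (R := ℚ) (i a))) = Coalgebra.comul (R := ℚ) (i a)) :
    A →ₐ[ℚ] A ⊗[ℚ] A :=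
  AlgHom.ofLinearMap (TensorProduct.map r r ∘ₗ Coalgebra.comul ∘ₗ i.toLinearMap)
    (Function.LeftInverse.injective (retract_map i r hr) (by
      have := h 1
      simp only [map_one, Bialgebra.comul_one] at this
      simp [this]))
    (fun x y => Function.LeftInverse.injective (retract_map i r hr) (by
      have := h (x * y)
      simp only [map_mul, Bialgebra.comul_mul] at this
      simp only [LinearMap.comp_apply, AlgHom.toLinearMap_apply, map_mul, Bialgebra.comul_mul,
        this, h]))

lemma restrictComul_spec (hr : ∀ a, r (i a) = a)
    (h : ∀ a, Algebra.TensorProduct.map i i (TensorProduct.map r r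
      (Coalgebra.comul (R := ℚ) (i a))) = Coalgebra.comul (R := ℚ) (i a)) (a : A) :
    Algebra.TensorProduct.map i i (restrictComul i r hr h a) = Coalgebra.comul (R := ℚ) (i a) :=
  h a

/-- The structure of a bialgebra on `A ⊆ B` restricted from `B`. -/
abbrev restrictBialgebra (hr : ∀ a, r (i a) = a)
    (h : ∀ a, Algebra.TensorProduct.map i i (TensorProduct.map r r
      (Coalgebra.comul (R := ℚ) (i a))) = Coalgebra.comul (R := ℚ) (i a)) :
    Bialgebra ℚ A :=
  Bialgebra.ofAlgHom (restrictComul i r hr h) ((Bialgebra.counitAlgHom ℚ B).comp i)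
    (AlgHom.ext fun a => Function.LeftInverse.injective (retract_map₃ i r hr) (by
      have key : ∀ x : A ⊗[ℚ] A,
          Algebra.TensorProduct.map i (Algebra.TensorProduct.map i i)
            (Algebra.TensorProduct.assoc ℚ ℚ ℚ A A A
              (Algebra.TensorProduct.map (restrictComul i r hr h) (AlgHom.id ℚ A) x)) =
          Algebra.TensorProduct.assoc ℚ ℚ ℚ B B B
            (Algebra.TensorProduct.map (Bialgebra.comulAlgHom ℚ B) (AlgHom.id ℚ B)
              (Algebra.TensorProduct.map i i x)) := by
        intro x
        induction x with
        | zero => simp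
        | add x y hx hy => simp only [map_add, hx, hy]
        | tmul a b =>
          simp only [Algebra.TensorProduct.map_tmul, AlgHom.id_apply, Bialgebra.comulAlgHom_apply,
            ← restrictComul_spec i r hr h a]
          generalize restrictComul i r hr h a = y
          induction y with
          | zero => simp
          | add x y hx hy => simp only [map_add, TensorProduct.add_tmul, hx, hy]
          | tmul c d => simp
      have key2 : ∀ x : A ⊗[ℚ] A,
          Algebra.TensorProduct.map i (Algebra.TensorProduct.map i i)
            (Algebra.TensorProduct.map (AlgHom.id ℚ A) (restrictComul i r hr h) x) =
          Algebra.TensorProduct.map (AlgHom.id ℚ B) (Bialgebra.comulAlgHom ℚ B)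
              (Algebra.TensorProduct.map i i x) := by
        intro x
        induction x with
        | zero => simp
        | add x y hx hy => simp only [map_add, hx, hy]
        | tmul a b => simp [restrictComul_spec]
      have e1 := key (restrictComul i r hr h a)
      have e2 := key2 (restrictComul i r hr h a)
      rw [restrictComul_spec] at e1 e2
      refine e1.trans (Eq.trans ?_ e2.symm)
      exact Coalgebra.coassoc_apply (R := ℚ) (i a)))
    (AlgHom.ext fun a => by
      have key : ∀ x : A ⊗[ℚ] A,
          i (Algebra.TensorProduct.lid ℚ A (Algebra.TensorProduct.map
            ((Bialgebra.counitAlgHom ℚ B).comp i) (AlgHom.id ℚ A) x)) =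
          Algebra.TensorProduct.lid ℚ B (Algebra.TensorProduct.map
            (Bialgebra.counitAlgHom ℚ B) (AlgHom.id ℚ B) (Algebra.TensorProduct.map i i x)) := by
        intro x
        induction x with
        | zero => simp
        | add x y hx hy => simp only [map_add, hx, hy]
        | tmul a b => simp
      have e := key (restrictComul i r hr h a)
      rw [restrictComul_spec] at e
      apply (Algebra.TensorProduct.lid ℚ A).injective
      apply Function.LeftInverse.injective hr
      refine e.trans ?_
      have := congrArg (Algebra.TensorProduct.lid ℚ B)
        (Coalgebra.rTensor_counit_comul (R := ℚ) (i a))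
      refine Eq.trans this ?_
      simp)
    (AlgHom.ext fun a => by
      have key : ∀ x : A ⊗[ℚ] A,
          i (Algebra.TensorProduct.rid ℚ ℚ A (Algebra.TensorProduct.map
            (AlgHom.id ℚ A) ((Bialgebra.counitAlgHom ℚ B).comp i) x)) =
          Algebra.TensorProduct.rid ℚ ℚ B (Algebra.TensorProduct.map
            (AlgHom.id ℚ B) (Bialgebra.counitAlgHom ℚ B) (Algebra.TensorProduct.map i i x)) := by
        intro x
        induction x with
        | zero => simp
        | add x y hx hy => simp only [map_add, hx, hy]
        | tmul a b => simp
      have e := key (restrictComul i r hr h a)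
      rw [restrictComul_spec] at e
      apply (Algebra.TensorProduct.rid ℚ ℚ A).injective
      apply Function.LeftInverse.injective hr
      refine e.trans ?_
      have := congrArg (Algebra.TensorProduct.rid ℚ ℚ B)
        (Coalgebra.lTensor_counit_comul (R := ℚ) (i a))
      refine Eq.trans this ?_
      simp)

end Retract

section GroupAlgebra

set_option linter.unusedSectionVars false

variable {G : Type} [CommGroup G] [Fintype G]

/-- The matrix `(a_{gh})_{g,h}` attached to a family `(a_g)_{g ∈ G}`. -/
def groupMatrix {R : Type} (a : G → R) : Matrix G G R := Matrix.of fun g h => a (g * h)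

variable (G) in
open Classical in
/-- The group determinant `Δ_G = det (X_{gh})_{g,h}`. -/
def groupDet : MvPolynomial G ℚ := (groupMatrix (MvPolynomial.X (R := ℚ) (σ := G))).det

variable (G) in
/-- The coordinate ring `ℚ[X_g : g ∈ G][1/Δ_G]` of the torus `𝒢`. -/
abbrev UnitsRing : Type := Localization.Away (groupDet G)

/-- The coordinate `X_g` as a function on `𝒢`. -/
def unitsX (g : G) : UnitsRing G := algebraMap (MvPolynomial G ℚ) _ (MvPolynomial.X g)

/-- The element `∑ a_g g`. -/
def ofFun {R : Type} [CommRing R] (a : G → R) : MonoidAlgebra R G :=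
  ∑ g, MonoidAlgebra.single g (a g)

open Classical in
@[simp] lemma coeff_ofFun {R : Type} [CommRing R] (a : G → R) (g : G) :
    (ofFun a).coeff g = a g := by
  simp [ofFun, Finsupp.single_apply]

lemma ofFun_coeff {R : Type} [CommRing R] (a : MonoidAlgebra R G) :
    ofFun (fun g => a.coeff g) = a := by
  ext g; simp

lemma coeff_mul_fintype {R : Type} [CommRing R] (a b : MonoidAlgebra R G) (g : G) :
    (a * b).coeff g = ∑ h, a.coeff h * b.coeff (h⁻¹ * g) := by
  rw [MonoidAlgebra.coeff_mul_apply_left, Finsupp.sum_fintype _ _ (by simp)]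

open Classical in
/-- An element of `R[G]` is a unit if and only if its group determinant is. -/
lemma isUnit_iff {R : Type} [CommRing R] (a : MonoidAlgebra R G) :
    IsUnit a ↔ IsUnit (groupMatrix fun g => a.coeff g).det := by
  have key : ∀ b : MonoidAlgebra R G,
      (groupMatrix fun g => a.coeff g).mulVec (fun h => b.coeff h⁻¹) =
        fun g => (a * b).coeff g := by
    intro b
    ext g
    rw [mul_comm, coeff_mul_fintype]
    simp only [Matrix.mulVec, dotProduct, groupMatrix, Matrix.of_apply]
    rw [← Equiv.sum_comp (Equiv.inv G)]
    refine Finset.sum_congr rfl fun h _ => ?_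
    simp [mul_comm]
  rw [← Matrix.isUnit_iff_isUnit_det, ← Matrix.mulVec_surjective_iff_isUnit]
  constructor
  · rintro ⟨u, rfl⟩ v
    refine ⟨fun h => (↑u⁻¹ * ofFun v : MonoidAlgebra R G).coeff h⁻¹, ?_⟩
    rw [key]
    ext g; simp
  · intro hs
    obtain ⟨w, hw⟩ := hs fun g => (1 : MonoidAlgebra R G).coeff g
    have := key (ofFun fun h => w h⁻¹)
    simp only [coeff_ofFun, inv_inv] at this
    refine IsUnit.of_mul_eq_one (ofFun fun h => w h⁻¹) ?_
    ext g
    rw [← congrFun this g, ← congrFun hw g]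

open Classical in
lemma aeval_groupDet {R : Type} [CommRing R] [Algebra ℚ R] (a : G → R) :
    MvPolynomial.aeval a (groupDet G) = (groupMatrix a).det := by
  rw [groupDet, AlgHom.map_det]
  congr 1
  refine Matrix.ext fun g h => ?_
  simp [groupMatrix]

/-- The homomorphism `ℚ[𝒢] → R` corresponding to a unit of `R[G]`. -/
def unitsLift {R : Type} [CommRing R] [Algebra ℚ R] (a : (MonoidAlgebra R G)ˣ) :
    UnitsRing G →ₐ[ℚ] R :=
  IsLocalization.liftAlgHom (M := Submonoid.powers (groupDet G))
    (f := MvPolynomial.aeval fun g => (a : MonoidAlgebra R G).coeff g) (by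
      rintro ⟨_, n, rfl⟩
      simp only [map_pow]
      refine IsUnit.pow n ?_
      rw [aeval_groupDet]
      exact (isUnit_iff _).1 a.isUnit)

lemma isUnit_ofFun {R : Type} [CommRing R] [Algebra ℚ R] (f : UnitsRing G →ₐ[ℚ] R) :
    IsUnit (ofFun fun g : G => f (unitsX g)) := by
  classical
  rw [isUnit_iff]
  have h : (groupMatrix fun g : G => f (unitsX g)).det =
      f (algebraMap _ _ (groupDet G)) := by
    have := aeval_groupDet (fun g : G => f (unitsX g))
    rw [← this]
    have h2 : MvPolynomial.aeval (fun g : G => f (unitsX g)) = f.comp (IsScalarTower.toAlgHom ℚ (MvPolynomial G ℚ) _) := by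
      ext g; simp [unitsX]
    rw [h2]; rfl
  simp only [coeff_ofFun]
  rw [h]
  exact (IsLocalization.Away.algebraMap_isUnit (groupDet G)).map f

lemma unitsLift_X {R : Type} [CommRing R] [Algebra ℚ R] (a : (MonoidAlgebra R G)ˣ) (g : G) :
    unitsLift a (unitsX g) = (a : MonoidAlgebra R G).coeff g := by
  simp [unitsLift, unitsX]

lemma algHom_ext {R : Type} [CommRing R] [Algebra ℚ R] {f f' : UnitsRing G →ₐ[ℚ] R}
    (h : ∀ g : G, f (unitsX g) = f' (unitsX g)) :
    f = f' := by
  have : f.comp (IsScalarTower.toAlgHom ℚ (MvPolynomial G ℚ) _) =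
      f'.comp (IsScalarTower.toAlgHom ℚ (MvPolynomial G ℚ) _) := by
    ext g; simpa [unitsX] using h g
  apply AlgHom.coe_ringHom_injective
  apply IsLocalization.ringHom_ext (Submonoid.powers (groupDet G))
  exact RingHom.ext fun x => DFunLike.congr_fun this x

/-- `𝒢` represents the group of units of the group algebra:
`𝒢(R) = (R[G])ˣ` for every `ℚ`-algebra `R`. -/
def pointsEquiv (R : Type) [CommRing R] [Algebra ℚ R] :
    (UnitsRing G →ₐ[ℚ] R) ≃ (MonoidAlgebra R G)ˣ where
  toFun f := (isUnit_ofFun f).unit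
  invFun := unitsLift
  left_inv f := algHom_ext fun g => by simp [unitsLift_X]
  right_inv a := by
    ext g
    simp [unitsLift_X]

variable (G) in
/-- The generic unit `∑ X_g g` of the group algebra. -/
def genUnit : (MonoidAlgebra (UnitsRing G) G)ˣ := pointsEquiv _ (AlgHom.id ℚ _)

@[simp] lemma coeff_genUnit (g : G) :
    (genUnit G : MonoidAlgebra (UnitsRing G) G).coeff g = unitsX g := by
  simp [genUnit, pointsEquiv]

variable (G) in
/-- The group law of `𝒢`, that is, the multiplication of `R[G]` on `R`-points. -/
def unitsComul : UnitsRing G →ₐ[ℚ] UnitsRing G ⊗[ℚ] UnitsRing G :=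
  unitsLift
    (Units.map (MonoidAlgebra.mapRingHom G (Algebra.TensorProduct.includeLeft (R := ℚ) (S := ℚ)
        (A := UnitsRing G) (B := UnitsRing G)).toRingHom).toMonoidHom (genUnit G) *
      Units.map (MonoidAlgebra.mapRingHom G (Algebra.TensorProduct.includeRight (R := ℚ)
        (A := UnitsRing G) (B := UnitsRing G)).toRingHom).toMonoidHom (genUnit G))

lemma unitsComul_X (g : G) :
    unitsComul G (unitsX g) = ∑ h, unitsX h ⊗ₜ[ℚ] unitsX (h⁻¹ * g) := by
  simp [unitsComul, unitsLift_X, coeff_mul_fintype]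

variable (G) in
/-- The neutral element of `𝒢`. -/
def unitsCounit : UnitsRing G →ₐ[ℚ] ℚ := unitsLift 1

open Classical in
lemma unitsCounit_X (g : G) : unitsCounit G (unitsX g) = if g = 1 then 1 else 0 := by
  simp [unitsCounit, unitsLift_X, MonoidAlgebra.one_def, Finsupp.single_apply, eq_comm]

lemma unitsComul_coassoc :
    (Algebra.TensorProduct.assoc ℚ ℚ ℚ (UnitsRing G) (UnitsRing G) (UnitsRing G)).toAlgHom.comp
      ((Algebra.TensorProduct.map (unitsComul G) (AlgHom.id ℚ (UnitsRing G))).comp (unitsComul G)) =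
    (Algebra.TensorProduct.map (AlgHom.id ℚ (UnitsRing G)) (unitsComul G)).comp (unitsComul G) := by
  refine algHom_ext (R := UnitsRing G ⊗[ℚ] (UnitsRing G ⊗[ℚ] UnitsRing G)) fun g => ?_
  simp only [AlgHom.comp_apply, unitsComul_X, map_sum, Algebra.TensorProduct.map_tmul,
    TensorProduct.sum_tmul, TensorProduct.tmul_sum, AlgHom.id_apply]
  rw [Finset.sum_comm]
  refine Finset.sum_congr rfl fun k _ => ?_
  rw [← Equiv.sum_comp (Equiv.mulLeft k)]
  refine Finset.sum_congr rfl fun j _ => ?_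
  simp [mul_assoc]

/-- `𝒢` as a group scheme. -/
instance : Bialgebra ℚ (UnitsRing G) :=
  Bialgebra.ofAlgHom (unitsComul G) (unitsCounit G) unitsComul_coassoc
    (algHom_ext fun g => by
      classical
      simp [unitsComul_X, unitsCounit_X, TensorProduct.ite_tmul])
    (algHom_ext fun g => by
      classical
      simp [unitsComul_X, unitsCounit_X, TensorProduct.tmul_ite, inv_mul_eq_one])

/-- Translation by `h ∈ G ⊂ 𝒢`: the function `x ↦ f (h x)`. -/
def translate (h : G) : UnitsRing G →ₐ[ℚ] UnitsRing G :=
  unitsLift (Units.map (MonoidAlgebra.of (UnitsRing G) G) (toUnits h) * genUnit G)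

lemma translate_X (h g : G) : translate h (unitsX g) = unitsX (h⁻¹ * g) := by
  simp [translate, unitsLift_X, MonoidAlgebra.coeff_single_mul_apply]

variable (G) in
/-- The coordinate ring `ℚ[𝒢]^G` of the quotient torus `T = 𝒢/G`. -/
def torusRing : Subalgebra ℚ (UnitsRing G) :=
  ⨅ h : G, AlgHom.equalizer (translate h) (AlgHom.id ℚ (UnitsRing G))

lemma mem_torusRing {b : UnitsRing G} : b ∈ torusRing G ↔ ∀ h, translate h b = b := by
  simp [torusRing, Algebra.mem_iInf, AlgHom.mem_equalizer]

lemma translate_translate (h k : G) (b : UnitsRing G) :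
    translate h (translate k b) = translate (h * k) b := by
  have : (translate h).comp (translate k) = translate (h * k) :=
    algHom_ext fun g => by simp [translate_X, mul_assoc, mul_comm h⁻¹]
  exact DFunLike.congr_fun this b

variable (G) in
/-- The averaging operator. -/
def average : UnitsRing G →ₗ[ℚ] UnitsRing G :=
  (Fintype.card G : ℚ)⁻¹ • ∑ h : G, (translate h).toLinearMap

lemma average_mem (b : UnitsRing G) : average G b ∈ torusRing G := by
  rw [mem_torusRing]
  intro k
  simp only [average, LinearMap.smul_apply, LinearMap.sum_apply, map_smul, map_sum,
    AlgHom.toLinearMap_apply, translate_translate]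
  congr 1
  exact Equiv.sum_comp (Equiv.mulLeft k) fun h => translate h b

lemma card_ne : (Fintype.card G : ℚ) ≠ 0 := by exact_mod_cast Fintype.card_ne_zero

lemma average_of_mem {b : UnitsRing G} (hb : b ∈ torusRing G) : average G b = b := by
  rw [mem_torusRing] at hb
  simp only [average, LinearMap.smul_apply, LinearMap.sum_apply, AlgHom.toLinearMap_apply, hb,
    Finset.sum_const, Finset.card_univ]
  rw [← Nat.cast_smul_eq_nsmul ℚ, smul_smul, inv_mul_cancel₀ card_ne, one_smul]

variable (G) in
/-- The averaging operator as a retraction `ℚ[𝒢] → ℚ[𝒢]^G`. -/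
def reynolds : UnitsRing G →ₗ[ℚ] torusRing G :=
  (average G).codRestrict (Subalgebra.toSubmodule (torusRing G)) average_mem

lemma reynolds_val (b : torusRing G) : reynolds G b = b :=
  Subtype.ext (average_of_mem b.2)

lemma val_comp_reynolds :
    (torusRing G).val.toLinearMap ∘ₗ reynolds G = average G := rfl

lemma translate_comul_left (h : G) :
    (Algebra.TensorProduct.map (translate h) (AlgHom.id ℚ _)).comp (unitsComul G) =
      (unitsComul G).comp (translate h) :=
  algHom_ext fun g => by
    simp only [AlgHom.comp_apply, unitsComul_X, translate_X, map_sum,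
      Algebra.TensorProduct.map_tmul, AlgHom.id_apply]
    rw [← Equiv.sum_comp (Equiv.mulLeft h)]
    simp [mul_assoc]

lemma translate_comul_right (h : G) :
    (Algebra.TensorProduct.map (AlgHom.id ℚ _) (translate h)).comp (unitsComul G) =
      (unitsComul G).comp (translate h) :=
  algHom_ext fun g => by
    simp only [AlgHom.comp_apply, unitsComul_X, translate_X, map_sum,
      Algebra.TensorProduct.map_tmul, AlgHom.id_apply]
    simp [mul_left_comm]

lemma average_comul {b : UnitsRing G} (hb : b ∈ torusRing G) :
    TensorProduct.map (average G) (average G) (unitsComul G b) = unitsComul G b := by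
  rw [mem_torusRing] at hb
  have h1 : TensorProduct.map (average G) LinearMap.id (unitsComul G b) = unitsComul G b := by
    have (h : G) : TensorProduct.map (translate h).toLinearMap LinearMap.id (unitsComul G b) =
        unitsComul G b := by
      have := DFunLike.congr_fun (translate_comul_left h) b
      rw [AlgHom.comp_apply, AlgHom.comp_apply, hb h] at this
      exact this
    simp only [← TensorProduct.mapBilinear_apply (R := ℚ)] at this ⊢
    simp only [average, map_smul, map_sum,
      LinearMap.smul_apply, LinearMap.sum_apply, this, Finset.sum_const, Finset.card_univ]
    rw [← Nat.cast_smul_eq_nsmul ℚ, smul_smul, inv_mul_cancel₀ card_ne, one_smul]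
  have h2 : TensorProduct.map LinearMap.id (average G) (unitsComul G b) = unitsComul G b := by
    have (h : G) : TensorProduct.map LinearMap.id (translate h).toLinearMap (unitsComul G b) =
        unitsComul G b := by
      have := DFunLike.congr_fun (translate_comul_right h) b
      rw [AlgHom.comp_apply, AlgHom.comp_apply, hb h] at this
      exact this
    simp only [← TensorProduct.mapBilinear_apply (R := ℚ)] at this ⊢
    simp only [average, map_smul, map_sum,
      LinearMap.smul_apply, LinearMap.sum_apply, this, Finset.sum_const, Finset.card_univ]
    rw [← Nat.cast_smul_eq_nsmul ℚ, smul_smul, inv_mul_cancel₀ card_ne, one_smul]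
  have h3 : TensorProduct.map (average G) (average G) =
      TensorProduct.map (average G) LinearMap.id ∘ₗ TensorProduct.map LinearMap.id (average G) := by
    rw [← TensorProduct.map_comp]; rfl
  rw [h3, LinearMap.comp_apply, h2, h1]

lemma average_comul' (b : torusRing G) :
    Algebra.TensorProduct.map (torusRing G).val (torusRing G).val
      (TensorProduct.map (reynolds G) (reynolds G)
        (Coalgebra.comul (R := ℚ) ((torusRing G).val b))) =
      Coalgebra.comul (R := ℚ) ((torusRing G).val b) := by
  have : TensorProduct.map (torusRing G).val.toLinearMap (torusRing G).val.toLinearMap ∘ₗ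
        TensorProduct.map (reynolds G) (reynolds G) =
      TensorProduct.map (average G) (average G) := by
    rw [← TensorProduct.map_comp, val_comp_reynolds]
  exact (DFunLike.congr_fun this _).trans (average_comul b.2)

/-- `T = 𝒢/G` as a group scheme: the group law of `𝒢` restricted to the invariant functions, so
that `𝒢 → T` is a homomorphism. -/
instance : Bialgebra ℚ (torusRing G) :=
  restrictBialgebra (torusRing G).val (reynolds G) reynolds_val average_comul'

end GroupAlgebra
section Projective

set_option linter.unusedSectionVars false

variable (G : Type) [CommGroup G] [Fintype G]

/-- The grading of `ℚ[Y, X_g : g ∈ G]` by degree, where `Y` is the variable with index `none` and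
`X_g` is the variable with index `some g`. -/
abbrev projGrading : ℕ → Submodule ℚ (MvPolynomial (Option G) ℚ) :=
  MvPolynomial.homogeneousSubmodule (Option G) ℚ

instance : GradedAlgebra (projGrading G) := MvPolynomial.gradedAlgebra

/-- The projective space `ℙ = ℙ(𝔸¹ ⊕ 𝔸ⁿ)` over `ℚ`. -/
def projSpace : Scheme.{0} := Proj (projGrading G)

/-- The structure morphism `ℙ → Spec ℚ`. -/
def projSpaceStr : projSpace G ⟶ Spec (.of ℚ) :=
  Proj.toSpecZero (projGrading G) ≫ Spec.map (CommRingCat.ofHom (algebraMap ℚ (projGrading G 0)))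

variable {G}

/-- The homomorphism `Y ↦ Y`, `X_g ↦ X_{h⁻¹ g}`, that is, composition with `x ↦ h x`. -/
def projTranslateRing (h : G) : projGrading G →+*ᵍ projGrading G where
  __ := (MvPolynomial.rename (R := ℚ) (Option.map fun g : G => h⁻¹ * g)).toRingHom
  map_mem hx := MvPolynomial.IsHomogeneous.rename_isHomogeneous hx

lemma projTranslateRing_inv (h : G) (x : MvPolynomial (Option G) ℚ) :
    projTranslateRing h (projTranslateRing h⁻¹ x) = x := by
  change MvPolynomial.rename _ (MvPolynomial.rename _ x) = x
  rw [MvPolynomial.rename_rename, Option.map_comp_map]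
  have : (fun g : G => h⁻¹ * g) ∘ (fun g : G => h⁻¹⁻¹ * g) = id := by
    ext g; simp
  rw [this]; simp

lemma projTranslateRing_irrelevant (h : G) :
    HomogeneousIdeal.irrelevant (projGrading G) ≤
      (HomogeneousIdeal.irrelevant (projGrading G)).map (projTranslateRing h) := by
  refine (HomogeneousIdeal.irrelevant_le _).mpr fun i hi x hx => ?_
  rw [← projTranslateRing_inv h x]
  exact Ideal.mem_map_of_mem _
    (HomogeneousIdeal.mem_irrelevant_of_mem _ hi ((projTranslateRing h⁻¹).map_mem hx))

/-- The automorphism `x ↦ h x` of `ℙ`, for `h ∈ G`. -/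
def projTranslate (h : G) : projSpace G ⟶ projSpace G :=
  Proj.map (projTranslateRing h) (projTranslateRing_irrelevant h)

variable (G) in
/-- The homomorphism `P / Y^d ↦ P(1, (X_g)_g)` from the ring of the affine chart `Y ≠ 0`. -/
def dehomogenize :
    HomogeneousLocalization.Away (projGrading G) (MvPolynomial.X none) →+* UnitsRing G :=
  (IsLocalization.Away.lift (S := Localization.Away (MvPolynomial.X none :
      MvPolynomial (Option G) ℚ)) (MvPolynomial.X none)
    (g := (MvPolynomial.aeval (R := ℚ) (fun o : Option G => o.elim 1 unitsX)).toRingHom)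
    (by simp)).comp
    (algebraMap (HomogeneousLocalization.Away (projGrading G) (MvPolynomial.X none)) _)

variable (G) in
/-- The open immersion `𝒢 ⊂ 𝔸ⁿ = {Y ≠ 0} ⊂ ℙ`. -/
def unitsToProj : Spec (.of (UnitsRing G)) ⟶ projSpace G :=
  Spec.map (CommRingCat.ofHom (dehomogenize G)) ≫
    Proj.awayι (projGrading G) (MvPolynomial.X none) (m := 1)
      (MvPolynomial.isHomogeneous_X ℚ none) one_pos

end Projective

section Quotient

/-- `π : X → Y` is the quotient of the scheme `X` by the automorphisms `ρ g`, `g ∈ G`: as a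
topological space `Y` is the orbit space, and the functions on `Y` are the invariant functions on
`X`. -/
structure IsQuotient {G : Type} {X Y : Scheme.{0}} (ρ : G → (X ⟶ X)) (π : X ⟶ Y) : Prop where
  invariant : ∀ g, ρ g ≫ π = π
  isQuotientMap : Topology.IsQuotientMap π
  orbit : ∀ x y : X, π x = π y → ∃ g, ρ g x = y
  injective : ∀ U : Y.Opens, Function.Injective (π.app U)
  range : ∀ (U : Y.Opens) (s : Γ(X, π ⁻¹ᵁ U)),
    (∀ g, (ρ g).appLE (π ⁻¹ᵁ U) (π ⁻¹ᵁ U)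
      (by rw [← Scheme.Hom.comp_preimage, invariant g]) s = s) → s ∈ Set.range (π.app U)

end Quotient

section Toric

/-- The combinatorial datum of a toric variety over `k` split by the Galois extension `E`: a
lattice `N` in a real vector space `V`, a fan in `V`, and an action of `Gal(E/k)`. -/
structure ToricDatum (k E V : Type) [Field k] [Field E] [Algebra k E] [AddCommGroup V]
    [Module ℝ V] where
  lattice : AddSubgroup V
  cones : Set (PointedCone ℝ V)
  gal : (E ≃ₐ[k] E) →* (V ≃ₗ[ℝ] V)
  gal_lattice : ∀ γ, ∀ v ∈ lattice, gal γ v ∈ lattice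
  gal_cones : ∀ γ, ∀ σ ∈ cones, PointedCone.map (gal γ).toLinearMap σ ∈ cones

/-- The monoid `σ^∨ ∩ M` where `M` is the dual lattice of `N`. For `σ = 0` this is `M` itself. -/
def dualMonoid {V : Type} [AddCommGroup V] [Module ℝ V] (N : AddSubgroup V)
    (σ : PointedCone ℝ V) : AddSubmonoid (Module.Dual ℝ V) where
  carrier := {u | (∀ v ∈ N, ∃ m : ℤ, u v = m) ∧ ∀ v ∈ σ, 0 ≤ u v}
  zero_mem' := ⟨fun _ _ => ⟨0, by simp⟩, fun _ _ => by simp⟩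
  add_mem' := by
    rintro u w ⟨hu, hu'⟩ ⟨hw, hw'⟩
    refine ⟨fun v hv => ?_, fun v hv => add_nonneg (hu' v hv) (hw' v hv)⟩
    obtain ⟨m, hm⟩ := hu v hv
    obtain ⟨n, hn⟩ := hw v hv
    exact ⟨m + n, by simp [hm, hn]⟩

lemma dualMonoid_anti {V : Type} [AddCommGroup V] [Module ℝ V] {N N' : AddSubgroup V}
    {σ τ : PointedCone ℝ V} (hN : N' ≤ N) (h : τ ≤ σ) : dualMonoid N σ ≤ dualMonoid N' τ :=
  fun _ hu => ⟨fun v hv => hu.1 v (hN hv), fun v hv => hu.2 v (h hv)⟩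

namespace ToricDatum

variable {k E V : Type} [Field k] [Field E] [Algebra k E] [AddCommGroup V] [Module ℝ V]
  (D : ToricDatum k E V)

/-- The cones form a fan: finitely many strongly convex rational polyhedral cones, closed under
passing to faces, any two of them meeting in a common face. -/
structure IsFan : Prop where
  finite : D.cones.Finite
  rational : ∀ σ ∈ D.cones, ∃ S : Finset V, (S : Set V) ⊆ D.lattice ∧ σ = PointedCone.hull ℝ S
  salient : ∀ σ ∈ D.cones, ∀ v ∈ σ, -v ∈ σ → v = 0
  face : ∀ σ ∈ D.cones, ∀ τ : PointedCone ℝ V, τ.IsFaceOf σ → τ ∈ D.cones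
  inter : ∀ σ ∈ D.cones, ∀ τ ∈ D.cones, (σ ⊓ τ).IsFaceOf σ

/-- The ring `E[σ^∨ ∩ M]` of the affine toric variety `U_σ`. -/
abbrev chartRing (σ : PointedCone ℝ V) : Type := AddMonoidAlgebra E (dualMonoid D.lattice σ)

/-- The inclusion `E[σ^∨ ∩ M] ⊆ E[τ^∨ ∩ M]` for `τ ⊆ σ`. -/
def restrict {σ τ : PointedCone ℝ V} (h : τ ≤ σ) : D.chartRing σ →+* D.chartRing τ :=
  AddMonoidAlgebra.mapDomainRingHom E (AddSubmonoid.inclusion (dualMonoid_anti le_rfl h))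

/-- The action `u ↦ u ∘ γ⁻¹` of `γ ∈ Gal(E/k)` as a map `σ^∨ ∩ M → (γσ)^∨ ∩ M`. -/
def galDual (γ : E ≃ₐ[k] E) (σ : PointedCone ℝ V) :
    dualMonoid D.lattice σ →+
      dualMonoid D.lattice (PointedCone.map (D.gal γ).toLinearMap σ) where
  toFun u := ⟨u.1 ∘ₗ (D.gal γ⁻¹).toLinearMap, fun v hv => u.2.1 _ (D.gal_lattice γ⁻¹ v hv), by
    rintro _ ⟨v, hv, rfl⟩
    have : D.gal γ⁻¹ (D.gal γ v) = v := by
      rw [← LinearEquiv.mul_apply, ← map_mul, inv_mul_cancel, map_one]; rfl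
    simpa [this] using u.2.2 v hv⟩
  map_zero' := by ext; simp
  map_add' u w := by ext; simp

/-- The semilinear map `a e^u ↦ γ(a) e^{γu}` from `E[σ^∨ ∩ M]` to `E[(γσ)^∨ ∩ M]`. -/
def galChart (γ : E ≃ₐ[k] E) (σ : PointedCone ℝ V) :
    D.chartRing σ →+* D.chartRing (PointedCone.map (D.gal γ).toLinearMap σ) :=
  (AddMonoidAlgebra.mapDomainRingHom E (D.galDual γ σ)).comp
    (AddMonoidAlgebra.mapRingHom _ (γ : E →+* E))

variable (k E) in
/-- The base change `X_E = X ×_k E`. -/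
abbrev baseChange {X : Scheme.{0}} (f : X ⟶ Spec (.of k)) : Scheme.{0} :=
  Limits.pullback f (Spec.map (CommRingCat.ofHom (algebraMap k E)))

/-- The action of `γ ∈ Gal(E/k)` on `X_E = X ×_k E` through the second factor. On functions it is
`γ` on constants and the identity on functions of `X`. -/
def galBaseChange {X : Scheme.{0}} (f : X ⟶ Spec (.of k)) (γ : E ≃ₐ[k] E) :
    baseChange k E f ⟶ baseChange k E f :=
  Limits.pullback.map _ _ _ _ (𝟙 X) (Spec.map (CommRingCat.ofHom (γ : E →+* E)))
    (𝟙 (Spec (.of k))) (by simp) (by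
      rw [Category.comp_id, ← Spec.map_comp, ← CommRingCat.ofHom_comp]
      congr 2
      ext x
      simp)

/-- The `k`-scheme `X` is the toric variety over `k` associated to the lattice, the fan and the
Galois action: `X_E` is glued from the affine toric varieties `U_σ = Spec E[σ^∨ ∩ M]` along the
open subsets `U_τ ⊆ U_σ` for `τ ⊆ σ`, and `γ ∈ Gal(E/k)` acts through `a e^u ↦ γ(a) e^{γu}`. -/
structure ToricStructure {X : Scheme.{0}} (f : X ⟶ Spec (.of k)) where
  /-- the inclusion `U_σ → X_E` -/
  chart : ∀ σ : D.cones, Spec (.of (D.chartRing σ.1)) ⟶ baseChange k E f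
  isOpenImmersion : ∀ σ, IsOpenImmersion (chart σ)
  chart_over : ∀ σ, chart σ ≫ Limits.pullback.snd _ _ =
    Spec.map (CommRingCat.ofHom (algebraMap E (D.chartRing σ.1)))
  chart_face : ∀ (σ τ : D.cones) (h : τ.1 ≤ σ.1),
    Spec.map (CommRingCat.ofHom (D.restrict h)) ≫ chart σ = chart τ
  cover : ⋃ σ, Set.range (chart σ) = Set.univ
  inter : ∀ σ τ : D.cones, Set.range (chart σ) ∩ Set.range (chart τ) ⊆
    ⋃ (ρ : D.cones) (_ : ρ.1 ≤ σ.1 ⊓ τ.1), Set.range (chart ρ)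
  chart_gal : ∀ (γ : E ≃ₐ[k] E) (σ : D.cones),
    Spec.map (CommRingCat.ofHom (D.galChart γ σ.1)) ≫ chart σ =
      chart ⟨_, D.gal_cones γ σ.1 σ.2⟩ ≫ galBaseChange f γ

end ToricDatum

end Toric

section Characters

set_option linter.unusedSectionVars false

variable (G : Type) [CommGroup G] [Fintype G]

/-- The field `E` generated over `ℚ` by the values of the characters `χ : G → ℂˣ`. -/
def charField : IntermediateField ℚ ℂ :=
  IntermediateField.adjoin ℚ {z | ∃ (χ : G →* ℂˣ) (g : G), z = χ g}

variable {G}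

/-- A character, with values in `E`. -/
def charVal (χ : G →* ℂˣ) : G →* charField G where
  toFun g := ⟨χ g, IntermediateField.subset_adjoin _ _ ⟨χ, g, rfl⟩⟩
  map_one' := by ext; simp
  map_mul' g h := by ext; simp

/-- The character `γ ∘ χ` for `γ ∈ Gal(E/ℚ)`. -/
def galChar (γ : charField G ≃ₐ[ℚ] charField G) (χ : G →* ℂˣ) : G →* ℂˣ :=
  MonoidHom.toHomUnits
    (((charField G).val : charField G →* ℂ).comp ((γ : charField G →* charField G).comp
      (charVal χ)))

lemma galChar_apply (γ : charField G ≃ₐ[ℚ] charField G) (χ : G →* ℂˣ) (g : G) :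
    (galChar γ χ g : ℂ) = γ (charVal χ g) := rfl

lemma charVal_galChar (γ : charField G ≃ₐ[ℚ] charField G) (χ : G →* ℂˣ) (g : G) :
    charVal (galChar γ χ) g = γ (charVal χ g) := rfl

lemma galChar_one (χ : G →* ℂˣ) : galChar 1 χ = χ := by
  ext g; rfl

lemma galChar_mul (γ δ : charField G ≃ₐ[ℚ] charField G) (χ : G →* ℂˣ) :
    galChar (γ * δ) χ = galChar γ (galChar δ χ) := by
  ext g; rfl

instance : Fintype (G →* ℂˣ) := Fintype.ofFinite _

variable (G) in
/-- The real vector space `N_E' ⊗ ℝ` with basis `(v_χ)`. -/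
abbrev cocharSpace : Type := (G →* ℂˣ) → ℝ

open Classical in
/-- The basis vector `v_χ`. -/
def charVec (χ : G →* ℂˣ) : cocharSpace G := Pi.single χ 1

variable (G) in
/-- The vector `v_0 = -∑ v_χ`. -/
def zeroVec : cocharSpace G := -∑ χ, charVec χ

variable (G) in
/-- The set `{v_0} ∪ {v_χ}`. -/
def rayVecs : Set (cocharSpace G) := {zeroVec G} ∪ Set.range charVec

/-- For a root of unity `ζ`, the number `ℓ(ζ) ∈ [0, 1)` with `exp(2πi ℓ(ζ)) = ζ`. -/
def angle (z : ℂ) : ℝ := Int.fract (z.arg / (2 * Real.pi))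

lemma angle_nonneg (z : ℂ) : 0 ≤ angle z := Int.fract_nonneg _

lemma angle_lt_one (z : ℂ) : angle z < 1 := Int.fract_lt_one _

lemma exp_angle {z : ℂ} (hz : ‖z‖ = 1) :
    Complex.exp (2 * Real.pi * Complex.I * angle z) = z := by
  have h : (angle z : ℂ) = z.arg / (2 * Real.pi) - (⌊z.arg / (2 * Real.pi)⌋ : ℤ) := by
    rw [angle, Int.fract]; push_cast; rfl
  have hpi : (Real.pi : ℂ) ≠ 0 := by exact_mod_cast Real.pi_ne_zero
  have h2 : 2 * Real.pi * Complex.I * (angle z : ℂ) =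
      z.arg * Complex.I - (⌊z.arg / (2 * Real.pi)⌋ : ℤ) * (2 * Real.pi * Complex.I) := by
    rw [h]; field_simp
  rw [h2, Complex.exp_sub, Complex.exp_int_mul_two_pi_mul_I, div_one]
  have := Complex.norm_mul_exp_arg_mul_I z
  rwa [hz, Complex.ofReal_one, one_mul] at this

/-- The vector `ω = ∑_χ ℓ(χ(c⁻¹)) v_χ`. -/
def omegaVec (c : G) : cocharSpace G := ∑ χ : G →* ℂˣ, angle (χ c⁻¹ : ℂˣ) • charVec χ

variable (G) in
/-- The lattice `N_E'` with basis `(v_χ)`. -/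
def unitsLattice : AddSubgroup (cocharSpace G) := AddSubgroup.closure (Set.range charVec)

/-- The lattice `N_E = N_E' + ∑_j ℤ ω_j`. -/
def torusLattice {K : ℕ} (c : Fin K → G) : AddSubgroup (cocharSpace G) :=
  unitsLattice G ⊔ AddSubgroup.closure (Set.range fun j => omegaVec (c j))

variable (G) in
/-- The cones spanned by the proper subsets of `{v_0} ∪ {v_χ}`. -/
def fanCones : Set (PointedCone ℝ (cocharSpace G)) :=
  {σ | ∃ I : Set (cocharSpace G), I ⊂ rayVecs G ∧ σ = PointedCone.hull ℝ I}

/-- The permutation `χ ↦ γ ∘ χ` of the characters. -/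
def galPerm : (charField G ≃ₐ[ℚ] charField G) →* Equiv.Perm (G →* ℂˣ) where
  toFun γ :=
    { toFun := galChar γ
      invFun := galChar γ⁻¹
      left_inv := fun χ => by rw [← galChar_mul, inv_mul_cancel, galChar_one]
      right_inv := fun χ => by rw [← galChar_mul, mul_inv_cancel, galChar_one] }
  map_one' := Equiv.ext galChar_one
  map_mul' γ δ := Equiv.ext (galChar_mul γ δ)

/-- The action `v_χ ↦ v_{γ ∘ χ}` of `Gal(E/ℚ)`. -/
def galVec : (charField G ≃ₐ[ℚ] charField G) →* (cocharSpace G ≃ₗ[ℝ] cocharSpace G) where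
  toFun γ := LinearEquiv.funCongrLeft ℝ ℝ (galPerm γ).symm
  map_one' := by rw [map_one]; rfl
  map_mul' γ δ := by rw [map_mul]; rfl

lemma galVec_charVec (γ : charField G ≃ₐ[ℚ] charField G) (χ : G →* ℂˣ) :
    galVec γ (charVec χ) = charVec (galChar γ χ) := by
  classical
  ext ψ
  change (charVec χ : cocharSpace G) ((galPerm γ).symm ψ) = charVec (galPerm γ χ) ψ
  simp only [charVec, Pi.single_apply, Equiv.symm_apply_eq]

lemma galVec_sum (γ : charField G ≃ₐ[ℚ] charField G) (a : (G →* ℂˣ) → ℝ) :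
    galVec γ (∑ χ, a χ • charVec χ) = ∑ χ, a (galChar γ⁻¹ χ) • charVec χ := by
  rw [map_sum, ← Equiv.sum_comp (galPerm γ) fun χ => a (galChar γ⁻¹ χ) • charVec χ]
  refine Finset.sum_congr rfl fun χ _ => ?_
  rw [map_smul, galVec_charVec]
  change _ = a (galChar γ⁻¹ (galChar γ χ)) • charVec (galChar γ χ)
  rw [← galChar_mul, inv_mul_cancel, galChar_one]

lemma galVec_zeroVec (γ : charField G ≃ₐ[ℚ] charField G) :
    galVec γ (zeroVec G) = zeroVec G := by
  have := galVec_sum γ (fun _ => 1)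
  simp only [one_smul] at this
  rw [zeroVec, map_neg, this]

lemma galVec_rayVecs (γ : charField G ≃ₐ[ℚ] charField G) :
    galVec γ '' rayVecs G = rayVecs G := by
  rw [rayVecs, Set.image_union, Set.image_singleton, galVec_zeroVec, ← Set.range_comp]
  congr 1
  have : galVec γ ∘ charVec = charVec ∘ galPerm γ := funext fun χ => galVec_charVec γ χ
  rw [this, (galPerm γ).surjective.range_comp]

lemma galVec_fanCones (γ : charField G ≃ₐ[ℚ] charField G) (σ : PointedCone ℝ (cocharSpace G))
    (hσ : σ ∈ fanCones G) : PointedCone.map (galVec γ).toLinearMap σ ∈ fanCones G := by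
  obtain ⟨I, hI, rfl⟩ := hσ
  refine ⟨galVec γ '' I, ?_, ?_⟩
  · rw [← galVec_rayVecs γ]
    exact (galVec γ).injective.image_strictMono hI
  · exact Submodule.map_span _ _

lemma exists_pow_galChar (γ : charField G ≃ₐ[ℚ] charField G) :
    ∃ m : ℤ, ∀ (χ : G →* ℂˣ) (g : G), galChar γ χ g = χ g ^ m := by
  obtain ⟨m, hm⟩ := rootsOfUnity.integer_power_of_ringEquiv' (Fintype.card G)
    (γ : charField G ≃+* charField G)
  refine ⟨m, fun χ g => ?_⟩
  have h : (charVal χ).toHomUnits g ∈ rootsOfUnity (Fintype.card G) (charField G) := by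
    rw [mem_rootsOfUnity, ← map_pow, pow_card_eq_one, map_one]
  have h2 := congrArg ((↑) : charField G → ℂ) (hm _ h)
  ext
  rw [galChar_apply, Units.val_zpow_eq_zpow_val]
  refine h2.trans ?_
  rw [Units.val_zpow_eq_zpow_val]
  rfl

lemma angle_zpow {z : ℂ} (hz : ‖z‖ = 1) (m : ℤ) : ∃ k : ℤ, angle (z ^ m) = m * angle z + k := by
  have h1 := exp_angle (z := z ^ m) (by rw [norm_zpow, hz, one_zpow])
  have h2 := exp_angle hz
  have h3 : Complex.exp (2 * Real.pi * Complex.I * angle (z ^ m) -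
      m * (2 * Real.pi * Complex.I * angle z)) = 1 := by
    rw [Complex.exp_sub, Complex.exp_int_mul, h1, h2, div_self]
    exact zpow_ne_zero _ (fun h => by simp [h] at hz)
  obtain ⟨k, hk⟩ := Complex.exp_eq_one_iff.1 h3
  refine ⟨k, ?_⟩
  have h4 : (2 * Real.pi * Complex.I : ℂ) ≠ 0 := Complex.two_pi_I_ne_zero
  have h5 : (angle (z ^ m) : ℂ) = m * angle z + k := by
    apply mul_left_cancel₀ h4
    linear_combination hk
  exact_mod_cast h5

lemma norm_char (χ : G →* ℂˣ) (g : G) : ‖(χ g : ℂ)‖ = 1 := by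
  refine Complex.norm_eq_one_of_pow_eq_one (n := Fintype.card G) ?_ Fintype.card_ne_zero
  rw [← Units.val_pow_eq_pow_val, ← map_pow, pow_card_eq_one, map_one, Units.val_one]

lemma galVec_omegaVec (γ : charField G ≃ₐ[ℚ] charField G) (c : G) :
    ∃ m : ℤ, galVec γ (omegaVec c) - m • omegaVec c ∈ unitsLattice G := by
  obtain ⟨m, hm⟩ := exists_pow_galChar γ⁻¹
  refine ⟨m, ?_⟩
  rw [omegaVec, galVec_sum, Finset.smul_sum, ← Finset.sum_sub_distrib]
  refine AddSubgroup.sum_mem _ fun χ _ => ?_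
  obtain ⟨k, hk⟩ := angle_zpow (norm_char χ c⁻¹) m
  rw [hm, Units.val_zpow_eq_zpow_val, hk]
  have : ((m : ℝ) * angle (χ c⁻¹ : ℂˣ) + k) • charVec χ - m • angle (χ c⁻¹ : ℂˣ) • charVec χ =
      k • charVec χ := by
    rw [add_smul, mul_smul, ← Int.cast_smul_eq_zsmul ℝ m, ← Int.cast_smul_eq_zsmul ℝ k]
    abel
  rw [this]
  exact AddSubgroup.zsmul_mem _ (AddSubgroup.subset_closure (Set.mem_range_self _)) k

lemma galVec_unitsLattice (γ : charField G ≃ₐ[ℚ] charField G)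
    (v : cocharSpace G) (hv : v ∈ unitsLattice G) : galVec γ v ∈ unitsLattice G := by
  induction hv using AddSubgroup.closure_induction with
  | mem v hv =>
    obtain ⟨χ, rfl⟩ := hv
    rw [galVec_charVec]
    exact AddSubgroup.subset_closure (Set.mem_range_self _)
  | zero => rw [map_zero]; exact AddSubgroup.zero_mem _
  | add v w _ _ hv hw => rw [map_add]; exact AddSubgroup.add_mem _ hv hw
  | neg v _ hv => rw [map_neg]; exact AddSubgroup.neg_mem _ hv

lemma galVec_torusLattice {K : ℕ} (c : Fin K → G) (γ : charField G ≃ₐ[ℚ] charField G)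
    (v : cocharSpace G) (hv : v ∈ torusLattice c) : galVec γ v ∈ torusLattice c := by
  obtain ⟨v₁, hv₁, w, hw, rfl⟩ := AddSubgroup.mem_sup.1 hv
  rw [map_add]
  refine AddSubgroup.add_mem _
    (AddSubgroup.mem_sup_left (galVec_unitsLattice γ v₁ hv₁)) ?_
  clear hv
  induction hw using AddSubgroup.closure_induction with
  | mem w hw =>
    obtain ⟨j, rfl⟩ := hw
    obtain ⟨m, hm⟩ := galVec_omegaVec γ (c j)
    have h1 : omegaVec (c j) ∈ torusLattice c :=
      AddSubgroup.mem_sup_right (AddSubgroup.subset_closure (Set.mem_range_self j))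
    rw [← sub_add_cancel (galVec γ (omegaVec (c j))) (m • omegaVec (c j))]
    exact AddSubgroup.add_mem _ (AddSubgroup.mem_sup_left hm) (AddSubgroup.zsmul_mem _ h1 m)
  | zero => rw [map_zero]; exact AddSubgroup.zero_mem _
  | add v w _ _ hv hw => rw [map_add]; exact AddSubgroup.add_mem _ hv hw
  | neg v _ hv => rw [map_neg]; exact AddSubgroup.neg_mem _ hv

/-- The fan `Σ`, the lattice `N_E` and the action of `Gal(E/ℚ)`. -/
def quotientDatum {K : ℕ} (c : Fin K → G) :
    ToricDatum ℚ (charField G) (cocharSpace G) where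
  lattice := torusLattice c
  cones := fanCones G
  gal := galVec
  gal_lattice := galVec_torusLattice c
  gal_cones := galVec_fanCones

/-- The elementary idempotent `v_χ = (1/n) ∑_g χ(g⁻¹) g` of `R[G]`, for an `E`-algebra `R`. -/
def idempotent (R : Type) [CommRing R] [Algebra (charField G) R] (χ : G →* ℂˣ) :
    MonoidAlgebra R G :=
  ofFun fun g => algebraMap (charField G) R ((Fintype.card G : charField G)⁻¹ * charVal χ g⁻¹)

variable (G) in
/-- The character lattice `M'` dual to `N_E'`. -/
abbrev unitsChars : AddSubmonoid (Module.Dual ℝ (cocharSpace G)) := dualMonoid (unitsLattice G) ⊥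

/-- The basis `(v_χ^∨)` of `M'` dual to `(v_χ)`. -/
def dualVec (χ : G →* ℂˣ) : unitsChars G :=
  ⟨LinearMap.proj χ, fun v hv => by
    classical
    induction hv using AddSubgroup.closure_induction with
    | mem w hw =>
      obtain ⟨ψ, rfl⟩ := hw
      by_cases h : χ = ψ
      · exact ⟨1, by simp [charVec, h]⟩
      · exact ⟨0, by simp [charVec, h]⟩
    | zero => exact ⟨0, by simp⟩
    | add v w _ _ hv hw =>
      obtain ⟨m, hm⟩ := hv
      obtain ⟨k, hk⟩ := hw
      exact ⟨m + k, by rw [map_add, hm, hk]; push_cast; rfl⟩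
    | neg v _ hv =>
      obtain ⟨m, hm⟩ := hv
      exact ⟨-m, by rw [map_neg, hm]; push_cast; rfl⟩, fun v hv => by
    rw [(Submodule.mem_bot _).1 hv, map_zero]⟩

end Characters

section Torus

variable {G : Type} [CommGroup G] [Fintype G]

/-- The action of `γ ∈ Gal(E/ℚ)` on `E ⊗ A` through the first factor. -/
def galTensor (A : Type) [CommRing A] [Algebra ℚ A] (γ : charField G ≃ₐ[ℚ] charField G) :
    charField G ⊗[ℚ] A →ₐ[ℚ] charField G ⊗[ℚ] A :=
  Algebra.TensorProduct.map (γ : charField G →ₐ[ℚ] charField G) (AlgHom.id ℚ A)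

/-- The action of `γ ∈ Gal(E/ℚ)` on the coefficients of Laurent polynomials. -/
def galLaurent (γ : charField G ≃ₐ[ℚ] charField G) :
    LaurentPolynomial (charField G) →+* LaurentPolynomial (charField G) :=
  AddMonoidAlgebra.mapRingHom ℤ (γ : charField G →+* charField G)

/-- The inclusion `E ⊗ ℚ[T] ⊆ E ⊗ ℚ[𝒢]`, that is, the homomorphism `𝒢_E → T_E`. -/
def torusToUnits : charField G ⊗[ℚ] torusRing G →ₐ[charField G] charField G ⊗[ℚ] UnitsRing G :=
  Algebra.TensorProduct.map (AlgHom.id _ _) (torusRing G).val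

/-- The character lattice `M` dual to `N_E`. -/
abbrev torusChars {K : ℕ} (c : Fin K → G) : AddSubmonoid (Module.Dual ℝ (cocharSpace G)) :=
  dualMonoid (quotientDatum c).lattice ⊥

lemma bot_mem_fanCones {K : ℕ} (c : Fin K → G) : ⊥ ∈ (quotientDatum c).cones := by
  refine ⟨∅, ?_, by simp⟩
  rw [Set.empty_ssubset]
  exact ⟨zeroVec G, Or.inl rfl⟩

/-- The inclusion `M ⊆ M'`. -/
def charsIncl {K : ℕ} (c : Fin K → G) : torusChars c →+ unitsChars G :=
  AddSubmonoid.inclusion (dualMonoid_anti le_sup_left le_rfl)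

end Torus

end QuotientToric

end

open QuotientToric

noncomputable section

namespace QuotientToric

/-! ### Evaluating degree-zero fractions, and morphisms from affine schemes to `Proj`. -/

section ProjEval

/-! For a finite group acting on a graded ring `A` by graded automorphisms, the quotient of `Proj A`
is `Proj A^G` (`projQuot_isQuotient`). Every point of `Proj A` lies in some `D₊(f)` with `f`
invariant of positive degree (`invIncl_isRegular`), and there the degree-zero fractions of `A^G` are
exactly the invariant degree-zero fractions of `A` (`awayAct_invariant`). Hence `Proj A → Proj A^G`
is integral and surjective, so closed, and its fibres are orbits because primes with the same
invariants are conjugate. For `A = ℚ[Y, X_g]` this constructs `ℙ/G` over `ℚ`.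

Over `E` the substitution `X_g = (1/n) ∑ χ(g⁻¹) Z_χ` diagonalises the action: `h` fixes `Y` and
multiplies `Z_χ` by `χ(h)` (`charAction_extendCoord`). Taking invariants commutes with the base
change (`IsGradedBaseChange.inv`), so `(ℙ/G)_E = Proj E[Y, Z_χ]^G`, and the invariants are spanned
by the monomials whose weight, the character `∏ χ ^ a_χ` of `G`, is trivial. The vectors `ω_j` are
made so that `exp(2πi⟨u, ω_j⟩)` is the weight of `u` at `c_j⁻¹` (`exp_ofCoord_omegaVec`). As the
`c_j` generate `G`, the lattice `M` is the part of `M'` of trivial weight (`ofCoord_torusLattice`).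

A cone of the fan is given by a proper subset `J` of the rays. Its chart is the locus where all
variables off `J` are nonzero, that is `D₊` of the product of their `n`-th powers, which is
invariant. Setting `Y = 1` and `Z_χ = e^{v_χ^∨}` embeds its ring into `E[M']`. The exponents of a
degree-zero Laurent monomial are its pairings with the rays, so the image is spanned by the `e^u`
with `u ∈ M` nonnegative on the rays in `J`; this is `E[σ^∨ ∩ M]` (`range_faceEval`). Gluing becomes
divisibility between these monomials. The Galois formula holds because the semilinear map `Z_χ ↦
Z_{γχ}` fixes every polynomial coming from `ℚ[Y, X_g]` (`charGal_extendCoord`).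

For the tori, the functions `∑ χ(g) X_g` are group-like units and identify `E[M']` with `E ⊗ ℚ[𝒢]`.
Translation by `h ∈ G` multiplies `e^u` by the weight of `u` at `h`, so `E ⊗ ℚ[T]`, the ring of
invariants, corresponds to `E[M]` (`range_charsToUnits`). Inside `ℙ/G` the torus `T` is `D₊(Y Δ²)`;
the square is needed since `Δ` is invariant only up to sign. It is the chart of the zero cone
because both maps to `ℙ/G` evaluate an invariant polynomial at the generic unit
(`torusIso_torusCharEval`).

A cocharacter sends each `e^u` to a group-like element of `E[t, t⁻¹]`, hence to a power of `t`, so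
the cocharacters are `Hom(M, ℤ)`. That this is `N_E` is Pontryagin duality
(`mem_torusLattice_of_dual`): a vector integral on `M` exponentiates to a character of `G^∨`, which
is evaluation at some `g = ∏ c_j ^ k_j`, and adding `∑ k_j ω_j` moves the vector into `N_E'`. -/

lemma gradedMap_mem {σ τ A B : Type} [CommRing A] [SetLike σ A] [AddSubgroupClass σ A] {𝒜 : ℕ → σ}
    [CommRing B] [SetLike τ B] [AddSubgroupClass τ B] {ℬ : ℕ → τ} [GradedRing 𝒜] [GradedRing ℬ]
    (θ : 𝒜 →+*ᵍ ℬ) {d : ℕ} {a : A} (ha : a ∈ 𝒜 d) : θ a ∈ ℬ d := θ.2 ha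

variable {σ A : Type} [CommRing A] [SetLike σ A] [AddSubgroupClass σ A] (𝒜 : ℕ → σ)
  [GradedRing 𝒜] {R : Type} [CommRing R]

open HomogeneousLocalization

/-- The value of fractions `a / f ^ k` of degree zero under a homomorphism inverting `f`. -/
def evalAway (s : A →+* R) {f : A} (hf : IsUnit (s f)) : Away 𝒜 f →+* R :=
  (IsLocalization.Away.lift (S := Localization.Away f) f hf).comp
    (algebraMap (Away 𝒜 f) (Localization.Away f))

variable {𝒜}

/-- With its denominator cleared, the value is described without any localization. Later
compatibilities are all checked through this formula. -/
lemma evalAway_mk (s : A →+* R) {f : A} (hf : IsUnit (s f)) {d : ℕ} (hd : f ∈ 𝒜 d) (k : ℕ) (a : A)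
    (ha : a ∈ 𝒜 (k • d)) : evalAway 𝒜 s hf (Away.mk 𝒜 hd k a ha) * s f ^ k = s a := by
  rw [evalAway, RingHom.comp_apply, HomogeneousLocalization.algebraMap_apply, Away.val_mk, ← map_pow,
    ← IsLocalization.Away.lift_eq (S := Localization.Away f) f hf (f ^ k),
    ← IsLocalization.Away.lift_eq (S := Localization.Away f) f hf a, ← map_mul,
    Localization.mk_eq_mk']
  congr 1
  exact IsLocalization.mk'_spec (Localization.Away f) a
    (⟨f ^ k, k, rfl⟩ : Submonoid.powers f)

/-- Every element of the source is some `a / f ^ k`, and `s f` is a unit, so the cleared formula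
leaves only one possible value. -/
lemma ringHom_eq_evalAway (s : A →+* R) {f : A} (hf : IsUnit (s f)) {d : ℕ} (hd : f ∈ 𝒜 d)
    (t : Away 𝒜 f →+* R) (h : ∀ k a (ha : a ∈ 𝒜 (k • d)), t (Away.mk 𝒜 hd k a ha) * s f ^ k = s a) :
    t = evalAway 𝒜 s hf := by
  ext x
  obtain ⟨k, a, ha, rfl⟩ := Away.mk_surjective 𝒜 hd x
  apply (hf.pow k).mul_left_injective
  simp only [h, evalAway_mk]

/-- Since `a / f ^ k = a g ^ k / (f g) ^ k`, both values agree after cancelling the unit `s g ^ k`.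
This makes the induced morphism to `Proj` independent of the chosen denominator. -/
lemma evalAway_awayMap (s : A →+* R) {f g x : A} (hf : IsUnit (s f)) (hx' : IsUnit (s x)) {d e : ℕ}
    (hd : f ∈ 𝒜 d) (he : g ∈ 𝒜 e) (hx : x = f * g) :
    (evalAway 𝒜 s hx').comp (awayMap 𝒜 he hx) = evalAway 𝒜 s hf := by
  refine ringHom_eq_evalAway s hf hd _ fun k a ha => ?_
  rw [RingHom.comp_apply, awayMap_mk (hf := hd)]
  subst hx
  have hg : IsUnit (s g) := by
    rw [map_mul] at hx'
    exact isUnit_of_mul_isUnit_right hx'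
  apply (hg.pow k).mul_left_injective
  dsimp only
  have := evalAway_mk (𝒜 := 𝒜) s hx' (SetLike.mul_mem_graded hd he) k (a * g ^ k) (by
    rw [smul_add]; exact SetLike.mul_mem_graded ha (SetLike.pow_mem_graded _ he))
  rw [map_mul, map_mul, mul_pow, map_pow, ← mul_assoc] at this
  rw [this]

lemma evalAway_comp {R' : Type} [CommRing R'] (s : A →+* R) (t : R →+* R') {f : A}
    (hf : IsUnit (s f)) {d : ℕ} (hd : f ∈ 𝒜 d) :
    t.comp (evalAway 𝒜 s hf) = evalAway 𝒜 (t.comp s) (f := f) (hf.map t) := by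
  refine ringHom_eq_evalAway _ _ hd _ fun k a ha => ?_
  rw [RingHom.comp_apply, RingHom.comp_apply, RingHom.comp_apply, ← map_pow, ← map_mul,
    evalAway_mk]

lemma evalAway_map {τ B : Type} [CommRing B] [SetLike τ B] [AddSubgroupClass τ B] {ℬ : ℕ → τ}
    [GradedRing ℬ] (θ : 𝒜 →+*ᵍ ℬ) (s : B →+* R) {f : A} (hf : IsUnit (s (θ f))) {d : ℕ}
    (hd : f ∈ 𝒜 d) :
    (evalAway ℬ s hf).comp (Away.map θ f) =
      evalAway 𝒜 (s.comp (θ : A →+* B)) (f := f) hf := by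
  refine ringHom_eq_evalAway _ _ hd _ fun k a ha => ?_
  rw [RingHom.comp_apply, Away.map_mk (hf := hd)]
  exact evalAway_mk s hf _ _ _ _

/-- Only homogeneous numerators occur, so `s` need not be injective: it suffices that it kills no
nonzero homogeneous element. This is the situation when one sets `Y = 1`. -/
lemma evalAway_injective (s : A →+* R) {f : A} (hf : IsUnit (s f)) {d : ℕ} (hd : f ∈ 𝒜 d)
    (hs : ∀ i, ∀ a ∈ 𝒜 i, s a = 0 → a = 0) : Function.Injective (evalAway 𝒜 s hf) := by
  rw [injective_iff_map_eq_zero]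
  intro x hx
  obtain ⟨k, a, ha, rfl⟩ := Away.mk_surjective 𝒜 hd x
  have := evalAway_mk s hf hd k a ha
  rw [hx, zero_mul] at this
  exact mk_eq_zero_of_num _ (Subtype.ext (hs _ a ha this.symm))

variable (𝒜) in
/-- The morphism `Spec R → Proj 𝒜` attached to a homomorphism `A → R` inverting the homogeneous
element `f`. -/
def projOfUnit (s : A →+* R) {f : A} {d : ℕ} (hd : f ∈ 𝒜 d) (h0 : 0 < d) (hf : IsUnit (s f)) :
    Spec (.of R) ⟶ Proj 𝒜 :=
  Spec.map (CommRingCat.ofHom (evalAway 𝒜 s hf)) ≫ Proj.awayι 𝒜 f hd h0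

lemma projOfUnit_mul (s : A →+* R) {f g x : A} {d e : ℕ} (hd : f ∈ 𝒜 d) (h0 : 0 < d)
    (he : g ∈ 𝒜 e) (hf : IsUnit (s f)) (hx : x = f * g) (hx' : IsUnit (s x)) :
    projOfUnit 𝒜 s hd h0 hf = projOfUnit 𝒜 s (f := x) (hx ▸ SetLike.mul_mem_graded hd he)
      (h0.trans_le (d.le_add_right e)) hx' := by
  rw [projOfUnit, ← evalAway_awayMap (𝒜 := 𝒜) s hf hx' hd he hx, CommRingCat.ofHom_comp,
    Spec.map_comp, Category.assoc, Proj.SpecMap_awayMap_awayι]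
  rfl

/-- Both morphisms factor through `D₊(f g)` and agree there. Hence two morphisms can be compared
using whichever invertible denominator suits each of them. -/
lemma projOfUnit_eq (s : A →+* R) {f g : A} {d e : ℕ} (hd : f ∈ 𝒜 d) (h0 : 0 < d)
    (hf : IsUnit (s f)) (he : g ∈ 𝒜 e) (h0' : 0 < e) (hg : IsUnit (s g)) :
    projOfUnit 𝒜 s hd h0 hf = projOfUnit 𝒜 s he h0' hg := by
  have h : IsUnit (s (f * g)) := by rw [map_mul]; exact hf.mul hg
  rw [projOfUnit_mul s hd h0 he hf rfl h, projOfUnit_mul s he h0' hd hg (mul_comm f g) h]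
  rfl

lemma spec_map_projOfUnit {R' : Type} [CommRing R'] (s : A →+* R) (t : R →+* R') {f : A} {d : ℕ}
    (hd : f ∈ 𝒜 d) (h0 : 0 < d) (hf : IsUnit (s f)) :
    Spec.map (CommRingCat.ofHom t) ≫ projOfUnit 𝒜 s hd h0 hf =
      projOfUnit 𝒜 (t.comp s) hd h0 (hf.map t) := by
  rw [projOfUnit, projOfUnit, ← evalAway_comp s t hf hd, CommRingCat.ofHom_comp, Spec.map_comp,
    Category.assoc]

/-- The morphism `q` is only required to look like `θ` on the one chart that is used, so that both
the quotient map and the projection of the base change qualify. -/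
lemma projOfUnit_comp_of_awayι {τ B : Type} [CommRing B] [SetLike τ B] [AddSubgroupClass τ B]
    {ℬ : ℕ → τ} [GradedRing ℬ] (θ : 𝒜 →+*ᵍ ℬ) (q : Proj ℬ ⟶ Proj 𝒜) (s : B →+* R) {f : A}
    {d : ℕ} (hd : f ∈ 𝒜 d) (h0 : 0 < d)
    (hq : Proj.awayι ℬ (θ f) (gradedMap_mem θ hd) h0 ≫ q =
      Spec.map (CommRingCat.ofHom (Away.map θ f)) ≫ Proj.awayι 𝒜 f hd h0)
    (hf : IsUnit (s (θ f))) :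
    projOfUnit ℬ s (gradedMap_mem θ hd) h0 hf ≫ q =
      projOfUnit 𝒜 (s.comp (θ : A →+* B)) hd h0 hf := by
  simp only [projOfUnit]
  rw [← evalAway_map θ s hf hd, CommRingCat.ofHom_comp, Spec.map_comp,
    Category.assoc, Category.assoc, hq]

end ProjEval

/-! ### The morphism of `Proj` induced by a graded homomorphism. -/

section ProjGlue

variable {σ τ A B : Type} [CommRing A] [SetLike σ A] [AddSubgroupClass σ A] {𝒜 : ℕ → σ}
  [GradedRing 𝒜] [CommRing B] [SetLike τ B] [AddSubgroupClass τ B]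
    {ℬ : ℕ → τ} [GradedRing ℬ] (θ : 𝒜 →+*ᵍ ℬ)

open HomogeneousLocalization

/-- The nonnegatively graded homomorphism `θ : 𝒜 → ℬ` induces an everywhere defined morphism
`Proj ℬ → Proj 𝒜`. -/
abbrev IsRegularOnProj : Prop := ∀ x : Proj ℬ, ∃ (d : ℕ) (a : A), 0 < d ∧ a ∈ 𝒜 d ∧
  x ∈ Proj.basicOpen ℬ (θ a)

variable {θ} (hθ : IsRegularOnProj θ)

/-- The affine cover by the open sets `D₊(θ a)`. -/
def regularCover : (Proj ℬ).AffineOpenCover where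
  I₀ := {i : ℕ × A // 0 < i.1 ∧ i.2 ∈ 𝒜 i.1}
  X i := .of (Away ℬ (θ i.1.2))
  f i := Proj.awayι ℬ (θ i.1.2) (gradedMap_mem θ i.2.2) i.2.1
  idx x := ⟨((hθ x).choose, (hθ x).choose_spec.choose), (hθ x).choose_spec.choose_spec.1,
    (hθ x).choose_spec.choose_spec.2.1⟩
  covers x := by
    have h := (hθ x).choose_spec.choose_spec.2.2
    rw [← Proj.opensRange_awayι ℬ _ (gradedMap_mem θ (hθ x).choose_spec.choose_spec.2.1)
      (hθ x).choose_spec.choose_spec.1] at h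
    exact h

lemma awayMap_comp_map {d e : ℕ} {a b c : A} (ha : a ∈ 𝒜 d) (hb : b ∈ 𝒜 e) (hc : c = a * b)
    (hc' : θ c = θ a * θ b) :
    (awayMap ℬ (gradedMap_mem θ hb) hc').comp (Away.map θ a) =
      (Away.map θ c).comp (awayMap 𝒜 hb hc) := by
  refine RingHom.ext fun x => ?_
  subst hc
  obtain ⟨k, c, hc, rfl⟩ := Away.mk_surjective 𝒜 ha x
  simp only [RingHom.comp_apply]
  rw [awayMap_mk (hf := ha), Away.map_mk (hf := SetLike.mul_mem_graded ha hb),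
    Away.map_mk (hf := ha), awayMap_mk (hf := gradedMap_mem θ ha)]
  simp only [map_mul, map_pow]

/-- The morphism `Proj ℬ → Proj 𝒜` induced by `θ : 𝒜 → ℬ`. -/
def projMap : Proj ℬ ⟶ Proj 𝒜 :=
  (regularCover hθ).openCover.glueMorphisms
    (fun i => Spec.map (CommRingCat.ofHom (Away.map θ i.1.2)) ≫
      Proj.awayι 𝒜 i.1.2 i.2.2 i.2.1) (by
    rintro ⟨⟨d, a⟩, hd, ha⟩ ⟨⟨e, b⟩, he, hb⟩
    change Limits.pullback.fst (Proj.awayι ℬ (θ a) (gradedMap_mem θ ha) hd) (Proj.awayι ℬ (θ b) (gradedMap_mem θ hb) he) ≫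
      Spec.map (CommRingCat.ofHom (Away.map θ a)) ≫ Proj.awayι 𝒜 a ha hd =
      Limits.pullback.snd (Proj.awayι ℬ (θ a) (gradedMap_mem θ ha) hd) (Proj.awayι ℬ (θ b) (gradedMap_mem θ hb) he) ≫
      Spec.map (CommRingCat.ofHom (Away.map θ b)) ≫ Proj.awayι 𝒜 b hb he
    rw [← cancel_epi (Proj.pullbackAwayιIso ℬ (gradedMap_mem θ ha) hd (gradedMap_mem θ hb) he (map_mul θ a b)).inv,
      Proj.pullbackAwayιIso_inv_fst_assoc, Proj.pullbackAwayιIso_inv_snd_assoc,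
      ← Spec.map_comp_assoc, ← Spec.map_comp_assoc, ← CommRingCat.ofHom_comp,
      ← CommRingCat.ofHom_comp, awayMap_comp_map ha hb rfl,
      awayMap_comp_map hb ha (mul_comm a b)]
    simp only [CommRingCat.ofHom_comp, Spec.map_comp, Category.assoc]
    rw [Proj.SpecMap_awayMap_awayι, Proj.SpecMap_awayMap_awayι]
    rfl)

lemma awayι_projMap {d : ℕ} (h0 : 0 < d) {a : A} (ha : a ∈ 𝒜 d) :
    Proj.awayι ℬ (θ a) (gradedMap_mem θ ha) h0 ≫ projMap hθ =
      Spec.map (CommRingCat.ofHom (Away.map θ a)) ≫ Proj.awayι 𝒜 a ha h0 :=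
  (regularCover hθ).openCover.ι_glueMorphisms _ _ ⟨(d, a), h0, ha⟩

/-- On each chart `D₊(θ b)` of the cover, both sides are the nonvanishing locus of the same
fraction, a power of `θ a` over a power of `θ b`. -/
lemma projMap_preimage {d : ℕ} (h0 : 0 < d) {a : A} (ha : a ∈ 𝒜 d) :
    projMap hθ ⁻¹ᵁ Proj.basicOpen 𝒜 a = Proj.basicOpen ℬ (θ a) := by
  ext x
  obtain ⟨e, b, h0', hb, hx⟩ := hθ x
  rw [← Proj.opensRange_awayι ℬ (θ b) (gradedMap_mem θ hb) h0'] at hx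
  obtain ⟨y, rfl⟩ := hx
  have h1 : Proj.awayι ℬ (θ b) (gradedMap_mem θ hb) h0' ⁻¹ᵁ (projMap hθ ⁻¹ᵁ Proj.basicOpen 𝒜 a) =
      Proj.awayι ℬ (θ b) (gradedMap_mem θ hb) h0' ⁻¹ᵁ (Proj.basicOpen ℬ (θ a)) := by
    rw [← Scheme.Hom.comp_preimage, awayι_projMap hθ h0' hb, Scheme.Hom.comp_preimage,
      Proj.awayι_preimage_basicOpen 𝒜 hb h0' ha h0,
      Proj.awayι_preimage_basicOpen ℬ (gradedMap_mem θ hb) h0' (gradedMap_mem θ ha) h0]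
    ext p
    change Away.map θ b (Away.isLocalizationElem hb ha) ∉ p.asIdeal ↔ _ ∉ p.asIdeal
    rw [Away.map_mk]
    simp
  exact iff_of_eq congr(y ∈ $h1)

/-- Since `D₊(θ a)` is the whole preimage of `D₊(a)`, the square is cartesian. Integrality and base
change are thereby reduced to rings of fractions. -/
lemma projMap_isPullback {d : ℕ} (h0 : 0 < d) {a : A} (ha : a ∈ 𝒜 d) :
    IsPullback (Spec.map (CommRingCat.ofHom (Away.map θ a))) (Proj.awayι ℬ (θ a) (gradedMap_mem θ ha) h0)
      (Proj.awayι 𝒜 a ha h0) (projMap hθ) :=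
  IsOpenImmersion.isPullback _ _ _ _ (awayι_projMap hθ h0 ha) (by
    rw [Proj.opensRange_awayι, projMap_preimage hθ h0 ha, Proj.opensRange_awayι])

end ProjGlue

end QuotientToric

namespace QuotientToric

/-! ### Invariants of a group acting on a graded ring, and their homogeneous fractions. -/

section InvariantRing

set_option linter.unusedSectionVars false

variable {σ A G : Type} [CommRing A] [SetLike σ A] [AddSubgroupClass σ A] {𝒜 : ℕ → σ}
  [GradedRing 𝒜] [Group G] (ρ : G →* (𝒜 →+*ᵍ 𝒜))

open HomogeneousLocalization

/-- The ring of invariants of a group acting on a graded ring. -/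
def invSubring : Subring A where
  carrier := {a | ∀ g, ρ g a = a}
  mul_mem' ha hb g := by rw [map_mul, ha g, hb g]
  one_mem' g := map_one _
  add_mem' ha hb g := by rw [map_add, ha g, hb g]
  zero_mem' g := map_zero _
  neg_mem' ha g := by rw [map_neg, ha g]

/-- The grading of the ring of invariants. -/
def invGrading (d : ℕ) : AddSubgroup (invSubring ρ) where
  carrier := {a | (a : A) ∈ 𝒜 d}
  add_mem' ha hb := add_mem (S := σ) ha hb
  zero_mem' := zero_mem (𝒜 d)
  neg_mem' ha := neg_mem (S := σ) ha

lemma mem_invGrading {d : ℕ} {a : invSubring ρ} : a ∈ invGrading ρ d ↔ (a : A) ∈ 𝒜 d := Iff.rfl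

/-- The homogeneous components of an invariant are invariant. -/
def invComponent (a : invSubring ρ) (i : ℕ) : invGrading ρ i :=
  ⟨⟨DirectSum.decompose 𝒜 (a : A) i, fun g => by
    rw [GradedRingHom.map_directSumDecompose, a.2 g]⟩, (DirectSum.decompose 𝒜 (a : A) i).2⟩

open Classical in
/-- The decomposition of an invariant into homogeneous components. -/
def invDecompose (a : invSubring ρ) : DirectSum ℕ fun i => invGrading ρ i :=
  ∑ i ∈ (DirectSum.decompose 𝒜 (a : A)).support, DirectSum.of _ i (invComponent ρ a i)

lemma invDecompose_apply (a : invSubring ρ) (i : ℕ) : invDecompose ρ a i = invComponent ρ a i := by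
  classical
  rw [invDecompose, DFinsupp.finsetSum_apply]
  by_cases h : i ∈ (DirectSum.decompose 𝒜 (a : A)).support
  · rw [Finset.sum_eq_single_of_mem i h fun j _ hj => DirectSum.of_eq_of_ne _ _ _ hj.symm,
      DirectSum.of_eq_same]
  · rw [Finset.sum_eq_zero fun j hj => DirectSum.of_eq_of_ne _ _ _ fun h' : i = j => h (h' ▸ hj)]
    rw [DFinsupp.notMem_support_iff] at h
    ext
    simp [invComponent, h]

/-- The decomposition of invariants into homogeneous components. -/
def invDecomposeHom : invSubring ρ →+ DirectSum ℕ fun i => invGrading ρ i where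
  toFun := invDecompose ρ
  map_zero' := by
    refine DFinsupp.ext fun i => ?_
    rw [invDecompose_apply]
    ext
    simp [invComponent]
  map_add' a b := by
    refine DFinsupp.ext fun i => ?_
    rw [DirectSum.add_apply, invDecompose_apply, invDecompose_apply, invDecompose_apply]
    ext
    simp [invComponent]

instance : GradedRing (invGrading ρ) where
  one_mem := SetLike.one_mem_graded 𝒜
  mul_mem _ _ _ _ ha hb := SetLike.mul_mem_graded (A := 𝒜) ha hb
  toDecomposition := DirectSum.Decomposition.ofAddHom _ (invDecomposeHom ρ)
    (by
      refine AddMonoidHom.ext fun a => Subtype.ext ?_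
      change ((DirectSum.coeAddMonoidHom (invGrading ρ) (invDecompose ρ a) : invSubring ρ) : A) = a
      classical
      conv_rhs => rw [← DirectSum.sum_support_decompose 𝒜 (a : A)]
      rw [invDecompose, map_sum, AddSubmonoidClass.coe_finsetSum]
      refine Finset.sum_congr rfl fun i _ => ?_
      rw [DirectSum.coeAddMonoidHom_of]
      rfl)
    (by
      ext i a : 2
      refine DFinsupp.ext fun j => ?_
      change invDecompose ρ (DirectSum.coeAddMonoidHom (invGrading ρ)
        (DirectSum.of (fun i => invGrading ρ i) i a)) j = DirectSum.of (fun i => invGrading ρ i) i a j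
      rw [DirectSum.coeAddMonoidHom_of, invDecompose_apply]
      ext
      have ha : ((a : invSubring ρ) : A) ∈ 𝒜 i := a.2
      by_cases h : i = j
      · subst h
        simp [invComponent, DirectSum.decompose_of_mem_same 𝒜 ha]
      · simp [invComponent, DirectSum.decompose_of_mem_ne 𝒜 ha h,
          DirectSum.of_eq_of_ne _ _ _ (Ne.symm h)])

/-- The inclusion of the invariants. -/
def invIncl : invGrading ρ →+*ᵍ 𝒜 where
  __ := (invSubring ρ).subtype
  map_mem h := h

lemma invIncl_apply (a : invSubring ρ) : invIncl ρ a = a := rfl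

lemma invIncl_mem {d : ℕ} {a : invSubring ρ} (ha : a ∈ invGrading ρ d) : invIncl ρ a ∈ 𝒜 d := ha

lemma mem_invGrading_of {d : ℕ} {a : invSubring ρ} (ha : invIncl ρ a ∈ 𝒜 d) :
    a ∈ invGrading ρ d := ha

lemma apply_invIncl (a : invSubring ρ) (g : G) : ρ g (invIncl ρ a) = invIncl ρ a := a.2 g

variable {ρ}

lemma pow_le_comap {f : A} (hf : ∀ g, ρ g f = f) (g : G) :
    Submonoid.powers f ≤ (Submonoid.powers f).comap (ρ g) := by
  rintro _ ⟨n, rfl⟩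
  exact ⟨n, by rw [map_pow, hf]⟩

/-- The action on the fractions with invariant denominator. -/
def awayAct {f : A} (hf : ∀ g, ρ g f = f) (g : G) : Away 𝒜 f →+* Away 𝒜 f :=
  HomogeneousLocalization.map (ρ g) (pow_le_comap hf g)

lemma awayAct_mk {f : A} (hf : ∀ g, ρ g f = f) (g : G) {d : ℕ} (hd : f ∈ 𝒜 d) (k : ℕ) (a : A)
    (ha : a ∈ 𝒜 (k • d)) : awayAct hf g (Away.mk 𝒜 hd k a ha) =
      Away.mk 𝒜 hd k (ρ g a) (gradedMap_mem _ ha) := by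
  rw [awayAct, Away.mk, HomogeneousLocalization.map_mk]
  apply val_injective
  simp [Away.mk, hf]

/-- The action on the fractions with invariant denominator. -/
abbrev awayAction {f : A} (hf : ∀ g, ρ g f = f) {d : ℕ} (hd : f ∈ 𝒜 d) :
    MulSemiringAction G (Away 𝒜 f) where
  smul g x := awayAct hf g x
  one_smul x := by
    obtain ⟨k, a, ha, rfl⟩ := Away.mk_surjective 𝒜 hd x
    change awayAct hf 1 _ = _
    rw [awayAct_mk]
    simp
  mul_smul g h x := by
    obtain ⟨k, a, ha, rfl⟩ := Away.mk_surjective 𝒜 hd x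
    change awayAct hf (g * h) _ = awayAct hf g (awayAct hf h _)
    simp only [awayAct_mk]
    simp
  smul_zero g := map_zero (awayAct hf g)
  smul_add g := map_add (awayAct hf g)
  smul_one g := map_one (awayAct hf g)
  smul_mul g := map_mul (awayAct hf g)

/-- No domain hypothesis is made, so numerators over the same denominator are compared only up to a
power of `f`. -/
lemma awayMk_eq_iff {f : A} {d : ℕ} (hd : f ∈ 𝒜 d) {k : ℕ} {a b : A}
    (ha : a ∈ 𝒜 (k • d)) (hb : b ∈ 𝒜 (k • d)) :
    Away.mk 𝒜 hd k a ha = Away.mk 𝒜 hd k b hb ↔ ∃ m, f ^ m * a = f ^ m * b := by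
  rw [← (val_injective _).eq_iff, Away.val_mk, Away.val_mk, Localization.mk_eq_mk_iff,
    Localization.r_iff_exists]
  constructor
  · rintro ⟨⟨_, m, rfl⟩, h⟩
    refine ⟨m + k, ?_⟩
    simpa only [pow_add, mul_assoc] using h
  · rintro ⟨m, h⟩
    refine ⟨⟨_, m, rfl⟩, ?_⟩
    dsimp only
    rw [mul_left_comm, h, mul_left_comm]

lemma awayMk_mul_pow {f : A} {d : ℕ} (hd : f ∈ 𝒜 d) {k : ℕ} {a : A}
    (ha : a ∈ 𝒜 (k • d)) (m : ℕ) (hm : f ^ m * a ∈ 𝒜 ((m + k) • d)) :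
    Away.mk 𝒜 hd k a ha = Away.mk 𝒜 hd (m + k) (f ^ m * a) hm := by
  apply val_injective
  rw [Away.val_mk, Away.val_mk, Localization.mk_eq_mk_iff, Localization.r_iff_exists]
  exact ⟨1, by simp only [OneMemClass.coe_one, one_mul, pow_add]; ring⟩

lemma pow_mul_mem {f : A} {d : ℕ} (hd : f ∈ 𝒜 d) {k : ℕ} {a : A}
    (ha : a ∈ 𝒜 (k • d)) (m : ℕ) : f ^ m * a ∈ 𝒜 ((m + k) • d) := by
  rw [add_smul]
  exact SetLike.mul_mem_graded (SetLike.pow_mem_graded _ hd) ha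

/-- Fractions with invariant denominator which are invariant have an invariant numerator. -/
lemma awayAct_invariant [Finite G] (f : invSubring ρ) {d : ℕ} (hd : f ∈ invGrading ρ d)
    (x : Away 𝒜 (invIncl ρ f)) (hx : ∀ g, awayAct (apply_invIncl ρ f) g x = x) :
    ∃ y : Away (invGrading ρ) f, Away.map (invIncl ρ) f y = x := by
  classical
  cases nonempty_fintype G
  have hd' := invIncl_mem ρ hd
  obtain ⟨k, a, ha, rfl⟩ := Away.mk_surjective 𝒜 hd' x
  have h1 : ∀ g, ∃ m, invIncl ρ f ^ m * ρ g a = invIncl ρ f ^ m * a := fun g => by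
    have := hx g
    rwa [awayAct_mk, awayMk_eq_iff] at this
  choose m hm using h1
  -- Each `g` fixes `a` up to the factor `f ^ m g`. Multiplying by all these powers at once gives an
  -- invariant numerator; nothing is averaged, so the order of `G` need not be invertible.
  have h2 : invIncl ρ f ^ (∑ g, m g) * a ∈ invSubring ρ := fun g => by
    rw [map_mul, map_pow, apply_invIncl, ← Finset.sum_erase_add _ _ (Finset.mem_univ g), pow_add,
      mul_assoc, hm, mul_assoc]
  have h3 := pow_mul_mem hd' ha (∑ g, m g)
  refine ⟨Away.mk (invGrading ρ) hd ((∑ g, m g) + k) ⟨_, h2⟩ (mem_invGrading_of ρ h3), ?_⟩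
  rw [Away.map_mk, awayMk_mul_pow hd' ha (∑ g, m g) h3]
  rfl

lemma awayMap_invIncl_injective (f : invSubring ρ) {d : ℕ} (hd : f ∈ invGrading ρ d) :
    Function.Injective (Away.map (invIncl ρ) f) := by
  rw [injective_iff_map_eq_zero]
  intro x hx
  obtain ⟨k, a, ha, rfl⟩ := Away.mk_surjective _ hd x
  have h0 : Away.mk 𝒜 (invIncl_mem ρ hd) k (invIncl ρ a) (invIncl_mem ρ ha) =
      Away.mk 𝒜 (invIncl_mem ρ hd) k 0 (zero_mem _) := by
    refine ((Away.map_mk (invIncl ρ) f hd k a ha).symm.trans hx).trans ?_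
    exact (mk_eq_zero_of_num _ rfl).symm
  rw [awayMk_eq_iff] at h0
  obtain ⟨m, hm⟩ := h0
  have h0 : Away.mk (invGrading ρ) hd k a ha = Away.mk (invGrading ρ) hd k 0 (zero_mem _) := by
    rw [awayMk_eq_iff]
    exact ⟨m, Subtype.ext hm⟩
  rw [h0]
  exact mk_eq_zero_of_num _ rfl

lemma awayAct_map (f : invSubring ρ) {d : ℕ} (hd : f ∈ invGrading ρ d) (g : G)
    (y : Away (invGrading ρ) f) :
    awayAct (apply_invIncl ρ f) g (Away.map (invIncl ρ) f y) = Away.map (invIncl ρ) f y := by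
  obtain ⟨k, a, ha, rfl⟩ := Away.mk_surjective _ hd y
  rw [Away.map_mk, awayAct_mk]
  simp only [apply_invIncl]

/-- By `awayAct_invariant` the source is the full ring of invariants of a finite group acting on the
target, and a ring is always integral over such invariants. -/
lemma awayMap_invIncl_isIntegral [Finite G] (f : invSubring ρ) {d : ℕ} (hd : f ∈ invGrading ρ d) :
    (Away.map (invIncl ρ) f).IsIntegral := by
  let := (Away.map (invIncl ρ) f).toAlgebra
  let := awayAction (apply_invIncl ρ f) (d := d) (invIncl_mem ρ hd)
  have : Algebra.IsInvariant (Away (invGrading ρ) f) (Away 𝒜 (invIncl ρ f)) G :=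
    ⟨fun b hb => awayAct_invariant f hd b hb⟩
  intro x
  exact (Algebra.IsInvariant.isIntegral (Away (invGrading ρ) f) (Away 𝒜 (invIncl ρ f)) G).isIntegral x

/-- Invariants separate orbits of homogeneous prime ideals. -/
lemma exists_comap_eq [Finite G] (P Q : Ideal A) [P.IsPrime] [Q.IsPrime]
    (h : ∀ a ∈ invSubring ρ, a ∈ P ↔ a ∈ Q) :
    ∃ g, Q = P.comap (ρ g) := by
  let : MulSemiringAction G A :=
    { smul := fun g a => ρ g a
      one_smul := fun a => by change ρ 1 a = a; simp
      mul_smul := fun g h a => by change ρ (g * h) a = ρ g (ρ h a); simp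
      smul_zero := fun g => map_zero (ρ g)
      smul_add := fun g => map_add (ρ g)
      smul_one := fun g => map_one (ρ g)
      smul_mul := fun g => map_mul (ρ g) }
  have : Algebra.IsInvariant (invSubring ρ) A G := ⟨fun b hb => ⟨⟨b, hb⟩, rfl⟩⟩
  have : SMulCommClass G (invSubring ρ) A := ⟨fun g a b => by
    change ρ g (a * b) = a * ρ g b
    rw [map_mul, a.2 g]⟩
  -- A finite group permutes transitively the primes lying over a given prime of the ring of
  -- invariants.
  obtain ⟨g, hg⟩ := Algebra.IsInvariant.exists_smul_of_under_eq (invSubring ρ) A G P Q (by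
    ext a
    exact h a a.2)
  refine ⟨g⁻¹, ?_⟩
  ext a
  rw [hg, Ideal.mem_pointwise_smul_iff_inv_smul_mem]
  rfl

/-- Every point of `Proj 𝒜` has a neighbourhood `D₊(f)` with `f` invariant. -/
lemma invIncl_isRegular [Finite G] : IsRegularOnProj (invIncl ρ) := by
  classical
  intro x
  by_contra! h
  have hP := x.isPrime
  -- Suppose every invariant of positive degree vanishes at `x`. Then the prime of `x` and the prime
  -- of elements whose degree-zero part lies in it contain the same invariants, so they are
  -- conjugate. The second contains everything of positive degree, hence so does the first, which is
  -- impossible on `Proj`.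
  obtain ⟨g, hg⟩ := exists_comap_eq (ρ := ρ) x.asHomogeneousIdeal.toIdeal
    (x.asHomogeneousIdeal.toIdeal.comap (GradedRing.projZeroRingHom 𝒜)) fun a ha => by
      have h1 : a - GradedRing.projZeroRingHom 𝒜 a ∈ x.asHomogeneousIdeal.toIdeal := by
        have h2 : ∀ i ≠ 0, (DirectSum.decompose 𝒜 a i : A) ∈ x.asHomogeneousIdeal.toIdeal :=
          fun i hi => by
            have := h i (invComponent ρ ⟨a, ha⟩ i) (Nat.pos_of_ne_zero hi)
              (invComponent ρ ⟨a, ha⟩ i).2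
            exact not_not.1 this
        rw [GradedRing.projZeroRingHom_apply]
        nth_rewrite 1 [← DirectSum.sum_support_decompose 𝒜 a]
        by_cases h0 : 0 ∈ (DirectSum.decompose 𝒜 a).support
        · rw [← Finset.sum_erase_add _ _ h0, add_sub_cancel_right]
          exact Ideal.sum_mem _ fun i hi => h2 i (Finset.ne_of_mem_erase hi)
        · rw [DFinsupp.notMem_support_iff] at h0
          rw [h0]
          simp only [ZeroMemClass.coe_zero, sub_zero]
          refine Ideal.sum_mem _ fun i hi => h2 i fun hi0 => ?_
          subst hi0
          exact DFinsupp.mem_support_iff.1 hi h0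
      rw [Ideal.mem_comap]
      exact ⟨fun h => by simpa using Ideal.sub_mem _ h h1,
        fun h => by simpa using Ideal.add_mem _ h1 h⟩
  refine x.not_irrelevant_le ((HomogeneousIdeal.irrelevant_le _).mpr fun i hi a ha => ?_)
  have h1 : ρ g⁻¹ a ∈ x.asHomogeneousIdeal.toIdeal.comap (GradedRing.projZeroRingHom 𝒜) := by
    rw [Ideal.mem_comap, GradedRing.projZeroRingHom_apply,
      DirectSum.decompose_of_mem_ne 𝒜 (gradedMap_mem _ ha) hi.ne']
    exact Ideal.zero_mem _
  rw [hg, Ideal.mem_comap] at h1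
  have h2 : ρ g (ρ g⁻¹ a) = a := by
    change (ρ g * ρ g⁻¹) a = a
    rw [← map_mul, mul_inv_cancel, map_one]
    rfl
  rwa [h2] at h1

end InvariantRing

end QuotientToric

namespace QuotientToric

/-! ### Recognising invariant functions on affine charts and on a basis of open sets. -/

section Sections

open Opposite TopologicalSpace

/-- The function on `Spec R` obtained from a function on an open set containing its image. -/
def pullSection {Y : Scheme.{0}} {R : CommRingCat.{0}} (j : Spec R ⟶ Y) (U : Y.Opens)
    (e : ⊤ ≤ j ⁻¹ᵁ U) : Γ(Y, U) ⟶ R :=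
  j.appLE U ⊤ e ≫ (Scheme.ΓSpecIso R).hom

lemma appLE_pullSection {X Y : Scheme.{0}} {R S : CommRingCat.{0}} (i : Spec S ⟶ X)
    (j : Spec R ⟶ Y) (f : X ⟶ Y) (φ : R ⟶ S) (h : i ≫ f = Spec.map φ ≫ j) (U : Y.Opens)
    (V : X.Opens) (e : V ≤ f ⁻¹ᵁ U) (e₁ : ⊤ ≤ i ⁻¹ᵁ V) (e₂ : ⊤ ≤ j ⁻¹ᵁ U) :
    f.appLE U V e ≫ pullSection i V e₁ = pullSection j U e₂ ≫ φ := by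
  have h1 : ∀ (g : Spec S ⟶ Y) (e' : ⊤ ≤ g ⁻¹ᵁ U), g = Spec.map φ ≫ j →
      g.appLE U ⊤ e' = j.appLE U ⊤ e₂ ≫ (Spec.map φ).appLE ⊤ ⊤ le_top := by
    rintro g e' rfl
    exact (Scheme.Hom.appLE_comp_appLE _ _ _ _ _ _ _).symm
  have h2 : (Spec.map φ).appLE ⊤ ⊤ le_top = (Spec.map φ).appTop :=
    Scheme.Hom.appLE_eq_app (Spec.map φ)
  rw [pullSection, pullSection, Category.assoc, ← Scheme.ΓSpecIso_naturality, ← h2,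
    ← Category.assoc, ← Category.assoc, Scheme.Hom.appLE_comp_appLE, h1 _ _ h]

lemma pullSection_isIso {Y : Scheme.{0}} {R : CommRingCat.{0}} (j : Spec R ⟶ Y)
    [IsOpenImmersion j] (U : Y.Opens) (hU : U = j.opensRange) :
    IsIso (pullSection j U (by rw [hU, Scheme.Hom.preimage_opensRange])) := by
  subst hU
  have : IsIso (j.appLE j.opensRange ⊤ (by rw [Scheme.Hom.preimage_opensRange])) := by
    rw [Scheme.Hom.appLE]
    have := Scheme.Hom.isIso_app j j.opensRange le_rfl
    have h2 : IsIso (homOfLE (show ⊤ ≤ j ⁻¹ᵁ j.opensRange by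
        rw [Scheme.Hom.preimage_opensRange])) :=
      ⟨homOfLE le_top, Subsingleton.elim _ _, Subsingleton.elim _ _⟩
    infer_instance
  rw [pullSection]
  infer_instance

variable {G : Type} {X Y : Scheme.{0}} (ρ : G → (X ⟶ X)) (π : X ⟶ Y) (hπ : ∀ g, ρ g ≫ π = π)

/-- Over `U`, the functions on `Y` are the invariant functions on `X`. -/
structure IsQuotientOver (U : Y.Opens) : Prop where
  injective : Function.Injective (π.app U)
  range : ∀ s : Γ(X, π ⁻¹ᵁ U),
    (∀ g, (ρ g).appLE (π ⁻¹ᵁ U) (π ⁻¹ᵁ U)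
      (by rw [← Scheme.Hom.comp_preimage, hπ g]) s = s) → s ∈ Set.range (π.app U)

/-- When an affine chart of `X` is the full preimage of an affine chart of `Y`, the sections are `S`
and `R`, and it remains to know that `φ` identifies `R` with the invariants of `S`. -/
lemma isQuotientOver_affine {R S : CommRingCat.{0}} (i : Spec S ⟶ X) (j : Spec R ⟶ Y)
    [IsOpenImmersion i] [IsOpenImmersion j] (φ : R ⟶ S) (h : i ≫ π = Spec.map φ ≫ j)
    (h' : π ⁻¹ᵁ j.opensRange = i.opensRange) (α : G → (S ⟶ S))
    (hα : ∀ g, i ≫ ρ g = Spec.map (α g) ≫ i) (hφ : Function.Injective φ)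
    (hr : ∀ s : S, (∀ g, α g s = s) → s ∈ Set.range φ) :
    IsQuotientOver ρ π hπ j.opensRange := by
  have hj := pullSection_isIso j j.opensRange rfl
  have hi := pullSection_isIso i (π ⁻¹ᵁ j.opensRange) h'
  have e := appLE_pullSection i j π φ h j.opensRange (π ⁻¹ᵁ j.opensRange) le_rfl
    (by rw [h', Scheme.Hom.preimage_opensRange]) (by rw [Scheme.Hom.preimage_opensRange])
  rw [Scheme.Hom.appLE_eq_app] at e
  have hj' := (ConcreteCategory.bijective_of_isIso (pullSection j j.opensRange
    _))
  have hi' := (ConcreteCategory.bijective_of_isIso (pullSection i (π ⁻¹ᵁ j.opensRange)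
    _))
  have e' : ∀ t, pullSection i (π ⁻¹ᵁ j.opensRange)
    (by rw [h', Scheme.Hom.preimage_opensRange]) (π.app j.opensRange t) =
      φ (pullSection j j.opensRange (by rw [Scheme.Hom.preimage_opensRange]) t) := fun t =>
    congr($e t)
  refine ⟨fun s t hst => ?_, fun s hs => ?_⟩
  · apply hj'.1
    apply hφ
    rw [← e', ← e', hst]
  · obtain ⟨r, hr⟩ := hr (pullSection i (π ⁻¹ᵁ j.opensRange)
      (by rw [h', Scheme.Hom.preimage_opensRange]) s) fun g => by
        have := appLE_pullSection i i (ρ g) (α g) (hα g) (π ⁻¹ᵁ j.opensRange) (π ⁻¹ᵁ j.opensRange)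
          (by rw [← Scheme.Hom.comp_preimage, hπ g])
          (by rw [h', Scheme.Hom.preimage_opensRange]) (by rw [h', Scheme.Hom.preimage_opensRange])
        have := congr($this s)
        refine this.symm.trans ?_
        exact congrArg (fun z => pullSection i (π ⁻¹ᵁ j.opensRange)
          (by rw [h', Scheme.Hom.preimage_opensRange]) z) (hs g)
    obtain ⟨t, rfl⟩ := hj'.2 r
    refine ⟨t, hi'.1 ?_⟩
    rw [e', hr]

variable {ρ π hπ}

/-- An invariant section restricts to invariant sections over the basis; these descend uniquely, so
the descended sections agree on overlaps and glue. -/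
lemma isQuotientOver_of_basis (P : Y.Opens → Prop) (hP : ∀ U, P U → IsQuotientOver ρ π hπ U)
    (hb : ∀ (U : Y.Opens) (y : Y), y ∈ U → ∃ W, P W ∧ y ∈ W ∧ W ≤ U) (U : Y.Opens) :
    IsQuotientOver ρ π hπ U := by
  have cover : ∀ U : Y.Opens, U ≤ ⨆ W : {W : Y.Opens // P W ∧ W ≤ U}, W.1 := fun U y hy => by
    obtain ⟨W, h1, h2, h3⟩ := hb U y hy
    exact Opens.mem_iSup.2 ⟨⟨W, h1, h3⟩, h2⟩
  have nat : ∀ (W U : Y.Opens) (h : W ≤ U) (s : Γ(Y, U)),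
      π.app W (Y.presheaf.map (homOfLE h).op s) =
        X.presheaf.map ((Opens.map π.base).map (homOfLE h)).op (π.app U s) := fun W U h s =>
    congr($(π.naturality (homOfLE h).op) s)
  -- Injectivity is established for every open set before gluing, because overlaps of basis sets
  -- need not belong to the basis.
  have inj : ∀ U : Y.Opens, Function.Injective (π.app U) := fun U s t hst => by
    refine Y.sheaf.eq_of_locally_eq' (fun W : {W : Y.Opens // P W ∧ W ≤ U} => W.1) U
      (fun W => homOfLE W.2.2) (cover U) s t fun W => ?_
    apply (hP W.1 W.2.1).injective
    refine (nat _ _ W.2.2 s).trans (Eq.trans ?_ (nat _ _ W.2.2 t).symm)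
    rw [hst]
  refine ⟨inj U, fun s hs => ?_⟩
  have h1 : ∀ W : {W : Y.Opens // P W ∧ W ≤ U}, ∃ t : Γ(Y, W.1), π.app W.1 t =
      X.presheaf.map ((Opens.map π.base).map (homOfLE W.2.2)).op s := fun W => by
    refine (hP W.1 W.2.1).range _ fun g => ?_
    have h2 : X.presheaf.map ((Opens.map π.base).map (homOfLE W.2.2)).op ≫
        (ρ g).appLE (π ⁻¹ᵁ W.1) (π ⁻¹ᵁ W.1) (by rw [← Scheme.Hom.comp_preimage, hπ g]) =
        (ρ g).appLE (π ⁻¹ᵁ U) (π ⁻¹ᵁ U) (by rw [← Scheme.Hom.comp_preimage, hπ g]) ≫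
        X.presheaf.map ((Opens.map π.base).map (homOfLE W.2.2)).op := by
      rw [Scheme.Hom.map_appLE, Scheme.Hom.appLE_map]
    refine (congr($h2 s)).trans ?_
    exact congrArg _ (hs g)
  choose t ht using h1
  obtain ⟨t', ht', -⟩ := Y.sheaf.existsUnique_gluing' (fun W : {W : Y.Opens // P W ∧ W ≤ U} => W.1)
    U (fun W => homOfLE W.2.2) (cover U) t (fun W W' => by
      apply inj
      refine (nat _ _ inf_le_left (t W)).trans (Eq.trans ?_ (nat _ _ inf_le_right (t W')).symm)
      rw [ht, ht, ← ConcreteCategory.comp_apply, ← ConcreteCategory.comp_apply, ← Functor.map_comp,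
        ← Functor.map_comp]
      rfl)
  refine ⟨t', ?_⟩
  refine X.sheaf.eq_of_locally_eq' (fun W : {W : Y.Opens // P W ∧ W ≤ U} => π ⁻¹ᵁ W.1) (π ⁻¹ᵁ U)
      (fun W => (Opens.map π.base).map (homOfLE W.2.2)) (fun x hx => ?_) _ _ fun W => ?_
  · obtain ⟨W, hW⟩ := Opens.mem_iSup.1 (cover U hx)
    exact Opens.mem_iSup.2 ⟨W, hW⟩
  · refine (nat _ _ W.2.2 t').symm.trans (Eq.trans ?_ (ht W))
    exact congrArg _ (ht' W)

end Sections

/-! ### `Proj` of the invariants as a quotient scheme. -/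

section ProjQuotient

variable {σ A G : Type} [CommRing A] [SetLike σ A] [AddSubgroupClass σ A] {𝒜 : ℕ → σ}
  [GradedRing 𝒜] [Group G] (ρ : G →* (𝒜 →+*ᵍ 𝒜))

open HomogeneousLocalization

/-- The equation `b = θ a` is kept separate so that, for invariant `a` and `θ` the action of a group
element, one may take `b = a` and have the same chart on both sides. -/
lemma awayι_projMap_of_eq {τ B : Type} [CommRing B] [SetLike τ B] [AddSubgroupClass τ B]
    {ℬ : ℕ → τ} [GradedRing ℬ] (θ : 𝒜 →+*ᵍ ℬ)
    (hθ : HomogeneousIdeal.irrelevant ℬ ≤ (HomogeneousIdeal.irrelevant 𝒜).map θ)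
    {d : ℕ} (h0 : 0 < d) {a : A} (ha : a ∈ 𝒜 d) {b : B} (hb : b ∈ ℬ d) (h : b = θ a)
    (hab : Submonoid.powers a ≤ (Submonoid.powers b).comap θ) :
    Proj.awayι ℬ b hb h0 ≫ Proj.map θ hθ =
      Spec.map (CommRingCat.ofHom (HomogeneousLocalization.map θ hab)) ≫ Proj.awayι 𝒜 a ha h0 := by
  subst h
  exact Proj.awayι_comp_map θ hθ h0 a ha

variable (h : ∀ g, HomogeneousIdeal.irrelevant 𝒜 ≤ (HomogeneousIdeal.irrelevant 𝒜).map (ρ g))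
  [Finite G]

/-- The quotient morphism `Proj A → Proj A^G`. -/
abbrev projQuot : Proj 𝒜 ⟶ Proj (invGrading ρ) := projMap (invIncl_isRegular (ρ := ρ))

/-- On the charts with invariant denominator, the group fixes every fraction that comes from the
invariants. -/
lemma projMap_comp_projQuot (g : G) : Proj.map (ρ g) (h g) ≫ projQuot ρ = projQuot ρ := by
  refine (regularCover (invIncl_isRegular (ρ := ρ))).openCover.hom_ext _ _ ?_
  rintro ⟨⟨d, a⟩, h0, ha⟩
  change Proj.awayι 𝒜 (invIncl ρ a) (gradedMap_mem (invIncl ρ) ha) h0 ≫ _ =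
    Proj.awayι 𝒜 (invIncl ρ a) (gradedMap_mem (invIncl ρ) ha) h0 ≫ _
  rw [← Category.assoc, awayι_projMap_of_eq (ρ g) (h g) h0 (gradedMap_mem (invIncl ρ) ha)
    (gradedMap_mem (invIncl ρ) ha) (apply_invIncl ρ a g).symm (pow_le_comap (apply_invIncl ρ a) g),
    Category.assoc, awayι_projMap _ h0 ha, ← Spec.map_comp_assoc, ← CommRingCat.ofHom_comp]
  congr 3
  exact RingHom.ext fun y => awayAct_map a ha g y

lemma projQuot_mem {x : Proj 𝒜} {d : ℕ} (h0 : 0 < d) {a : invSubring ρ}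
    (ha : a ∈ invGrading ρ d) :
    invIncl ρ a ∈ x.asHomogeneousIdeal ↔ a ∈ (projQuot ρ x).asHomogeneousIdeal := by
  have h1 := projMap_preimage (invIncl_isRegular (ρ := ρ)) h0 ha
  have h2 : projQuot ρ x ∈ Proj.basicOpen (invGrading ρ) a ↔
    x ∈ Proj.basicOpen 𝒜 (invIncl ρ a) := iff_of_eq congr(x ∈ $h1)
  rw [Proj.mem_basicOpen, Proj.mem_basicOpen] at h2
  exact not_iff_not.1 h2.symm

lemma mem_of_homogeneous (x : Proj 𝒜) (a : A)
    (h : ∀ i, (DirectSum.decompose 𝒜 a i : A) ∈ x.asHomogeneousIdeal) :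
    a ∈ x.asHomogeneousIdeal := by
  classical
  rw [← DirectSum.sum_support_decompose 𝒜 a]
  exact Ideal.sum_mem _ fun i _ => h i

lemma mem_iff_homogeneous (x : Proj 𝒜) (a : A) :
    a ∈ x.asHomogeneousIdeal ↔ ∀ i, (DirectSum.decompose 𝒜 a i : A) ∈ x.asHomogeneousIdeal :=
  ⟨fun h i => x.asHomogeneousIdeal.isHomogeneous i h, mem_of_homogeneous x a⟩

/-- The image point records which invariants of positive degree lie in the prime. Multiplying by an
invariant of positive degree outside both primes extends this to degree zero, and taking components
extends it to all invariants; then `exists_comap_eq` applies. -/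
lemma projQuot_orbit (x y : Proj 𝒜) (hxy : projQuot ρ x = projQuot ρ y) :
    ∃ g, Proj.map (ρ g) (h g) x = y := by
  have hx := x.isPrime
  have hy := y.isPrime
  have key0 : ∀ i > 0, ∀ a ∈ invSubring ρ, a ∈ 𝒜 i →
      (a ∈ x.asHomogeneousIdeal ↔ a ∈ y.asHomogeneousIdeal) := fun i hi a ha hai => by
    have h1 := projQuot_mem ρ (x := x) hi (a := ⟨a, ha⟩) hai
    have h2 := projQuot_mem ρ (x := y) hi (a := ⟨a, ha⟩) hai
    rw [hxy, ← h2] at h1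
    exact h1
  obtain ⟨d, f, hd, hf, hfx⟩ := invIncl_isRegular (ρ := ρ) x
  have hfy : invIncl ρ f ∉ y.asHomogeneousIdeal := fun hy' =>
    hfx ((key0 d hd f f.2 hf).2 hy')
  have key : ∀ i, ∀ a ∈ invSubring ρ, a ∈ 𝒜 i →
      (a ∈ x.asHomogeneousIdeal ↔ a ∈ y.asHomogeneousIdeal) := fun i a ha hai => by
    have h1 := key0 (i + d) (by omega) (a * invIncl ρ f) (Subring.mul_mem _ ha f.2)
      (SetLike.mul_mem_graded hai (invIncl_mem ρ hf))
    have h2 : ∀ z : Proj 𝒜, invIncl ρ f ∉ z.asHomogeneousIdeal →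
        (a * invIncl ρ f ∈ z.asHomogeneousIdeal ↔ a ∈ z.asHomogeneousIdeal) := fun z hz =>
      ⟨fun h => (z.isPrime.mem_or_mem h).resolve_right hz, fun h => Ideal.mul_mem_right _ _ h⟩
    rwa [h2 x hfx, h2 y hfy] at h1
  obtain ⟨g, hg⟩ := exists_comap_eq (ρ := ρ) x.asHomogeneousIdeal.toIdeal
    y.asHomogeneousIdeal.toIdeal fun a ha => by
      change a ∈ x.asHomogeneousIdeal ↔ a ∈ y.asHomogeneousIdeal
      rw [mem_iff_homogeneous, mem_iff_homogeneous]
      exact forall_congr' fun i => key i _ (invComponent ρ ⟨a, ha⟩ i).1.2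
        (invComponent ρ ⟨a, ha⟩ i).2
  refine ⟨g, ?_⟩
  apply ProjectiveSpectrum.ext
  apply HomogeneousIdeal.toIdeal_injective
  exact hg.symm

lemma universallyClosed_comp_of_iso {X Y Z : Scheme.{0}} (e : X ≅ Y) (g : Y ⟶ Z)
    (_ : IsIntegralHom g) : UniversallyClosed (e.hom ≫ g) := inferInstance

/-- The question is local on the target, and over a chart the map is `Spec` of an integral
homomorphism. -/
lemma projQuot_universallyClosed : UniversallyClosed (projQuot ρ) := by
  refine IsZariskiLocalAtTarget.of_openCover (P := @UniversallyClosed.{0})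
    (Proj.affineOpenCover (invGrading ρ)).openCover fun i => ?_
  have hp := projMap_isPullback (invIncl_isRegular (ρ := ρ)) i.1.2 i.2.2
  have : IsIntegralHom (Spec.map (CommRingCat.ofHom (Away.map (invIncl ρ) (i.2 : invSubring ρ)))) :=
    IsIntegralHom.SpecMap_iff.2 (awayMap_invIncl_isIntegral (i.2 : invSubring ρ) i.2.2)
  have h2 : Scheme.Cover.pullbackHom (Proj.affineOpenCover (invGrading ρ)).openCover
      (projQuot ρ) i = hp.flip.isoPullback.inv ≫
        Spec.map (CommRingCat.ofHom (Away.map (invIncl ρ) (i.2 : invSubring ρ))) :=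
    hp.flip.isoPullback_inv_snd.symm
  rw [h2]
  exact universallyClosed_comp_of_iso hp.flip.isoPullback.symm _ this

/-- Lying over on each chart: the homomorphism of fractions is integral and injective. -/
lemma projQuot_surjective : Function.Surjective (projQuot ρ) := by
  intro y
  obtain ⟨i, z, rfl⟩ := (Proj.affineOpenCover (invGrading ρ)).openCover.exists_eq y
  have : Function.Surjective (Spec.map (CommRingCat.ofHom
      (Away.map (invIncl ρ) (i.2 : invSubring ρ)))) := by
    let := (Away.map (invIncl ρ) (i.2 : invSubring ρ)).toAlgebra
    have : Algebra.IsIntegral (Away (invGrading ρ) (i.2 : invSubring ρ))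
      (Away 𝒜 (invIncl ρ (i.2 : invSubring ρ))) :=
        ⟨awayMap_invIncl_isIntegral (i.2 : invSubring ρ) i.2.2⟩
    have : FaithfulSMul (Away (invGrading ρ) (i.2 : invSubring ρ))
      (Away 𝒜 (invIncl ρ (i.2 : invSubring ρ))) :=
        (faithfulSMul_iff_algebraMap_injective _ _).2
          (awayMap_invIncl_injective (i.2 : invSubring ρ) i.2.2)
    exact Algebra.IsIntegral.comap_surjective _ _
  obtain ⟨w, rfl⟩ := this z
  exact ⟨Proj.awayι 𝒜 _ (invIncl_mem ρ i.2.2) i.1.2 w,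
    congr($(awayι_projMap (invIncl_isRegular (ρ := ρ)) i.1.2 i.2.2) w)⟩

/-- `D₊(a)` is the union of the `D₊` of the components of `a`. The component that is nonzero at `y`
may have degree zero, so it is multiplied by an element of positive degree that is nonzero at `y`.
-/
lemma exists_basicOpen_le {A' σ' : Type} [CommRing A'] [SetLike σ' A'] [AddSubgroupClass σ' A']
    {𝒜' : ℕ → σ'} [GradedRing 𝒜'] (U : (Proj 𝒜').Opens) (y : Proj 𝒜') (hy : y ∈ U) :
    ∃ (d : ℕ) (a : A'), 0 < d ∧ a ∈ 𝒜' d ∧ y ∈ Proj.basicOpen 𝒜' a ∧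
      Proj.basicOpen 𝒜' a ≤ U := by
  obtain ⟨_, ⟨a, rfl⟩, h1, h2⟩ := (TopologicalSpace.Opens.isBasis_iff_nbhd.1
    (Proj.isBasis_basicOpen 𝒜')) hy
  rw [Proj.basicOpen_eq_iSup_proj] at h1 h2
  obtain ⟨i, hi⟩ := TopologicalSpace.Opens.mem_iSup.1 h1
  have : ∃ d > 0, ∃ b ∈ 𝒜' d, b ∉ y.asHomogeneousIdeal := by
    by_contra! h'
    exact y.not_irrelevant_le
      ((HomogeneousIdeal.irrelevant_le _).mpr fun i hi a ha => h' i hi a ha)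
  obtain ⟨d, hd, b, hb, hby⟩ := this
  refine ⟨i + d, GradedRing.proj 𝒜' i a * b, by omega,
    SetLike.mul_mem_graded (SetLike.coe_mem _) hb, ?_, ?_⟩
  · rw [Proj.basicOpen_mul]
    exact ⟨hi, hby⟩
  · rw [Proj.basicOpen_mul]
    exact inf_le_left.trans ((le_iSup (fun i => Proj.basicOpen 𝒜' (GradedRing.proj 𝒜' i a)) i).trans h2)

/-- `Proj A^G` is the quotient of `Proj A` by `G`. -/
theorem projQuot_isQuotient : IsQuotient (fun g => Proj.map (ρ g) (h g)) (projQuot ρ) := by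
  have hq := projMap_comp_projQuot ρ h
  have hover := isQuotientOver_of_basis (ρ := fun g => Proj.map (ρ g) (h g)) (π := projQuot ρ)
    (hπ := hq) (fun U => ∃ (d : ℕ) (a : invSubring ρ), 0 < d ∧ a ∈ invGrading ρ d ∧
      U = Proj.basicOpen (invGrading ρ) a) (by
    rintro U ⟨d, a, h0, ha, rfl⟩
    rw [← Proj.opensRange_awayι (invGrading ρ) a ha h0]
    refine isQuotientOver_affine _ _ hq (Proj.awayι 𝒜 (invIncl ρ a) (invIncl_mem ρ ha) h0)
      (Proj.awayι (invGrading ρ) a ha h0) (CommRingCat.ofHom (Away.map (invIncl ρ) a))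
      (awayι_projMap (invIncl_isRegular (ρ := ρ)) h0 ha) ?_
      (fun g => CommRingCat.ofHom (awayAct (apply_invIncl ρ a) g))
      (fun g => awayι_projMap_of_eq (ρ g) (h g) h0 _ _ (apply_invIncl ρ a g).symm _)
      (awayMap_invIncl_injective a ha) (fun s hs => awayAct_invariant a ha s hs)
    rw [Proj.opensRange_awayι, Proj.opensRange_awayι, projMap_preimage _ h0 ha])
    (fun U y hy => by
      obtain ⟨d, a, h0, ha, h1, h2⟩ := exists_basicOpen_le U y hy
      exact ⟨_, ⟨d, a, h0, ha, rfl⟩, h1, h2⟩)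
  have := projQuot_universallyClosed ρ
  exact
    { invariant := hq
      isQuotientMap := (projQuot ρ).isClosedMap.isQuotientMap (projQuot ρ).continuous
        (projQuot_surjective ρ)
      orbit := projQuot_orbit ρ h
      injective := fun U => (hover U).injective
      range := fun U => (hover U).range }

end ProjQuotient

end QuotientToric

namespace QuotientToric

/-! ### Base change of `Proj` along a ring with a finite basis. -/

section BaseChange

open HomogeneousLocalization

/-- The last two hypotheses say that `S` is free over `R` on the images of the basis, which is
exactly bijectivity of `E ⊗ R → S`. -/
lemma isPushout_of_basis {k E R S ι : Type} [CommRing k] [CommRing E] [Algebra k E] [CommRing R]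
    [CommRing S] [Fintype ι] (b : Module.Basis ι k E) (r : k →+* R) (e : E →+* S) (φ : R →+* S)
    (comm : ∀ x, φ (r x) = e (algebraMap k E x))
    (hs : ∀ s, ∃ x : ι → R, ∑ i, e (b i) * φ (x i) = s)
    (hi : ∀ x : ι → R, ∑ i, e (b i) * φ (x i) = 0 → ∀ i, x i = 0) :
    IsPushout (CommRingCat.ofHom (algebraMap k E)) (CommRingCat.ofHom r) (CommRingCat.ofHom e)
      (CommRingCat.ofHom φ) := by
  let : Algebra k R := r.toAlgebra
  let : Algebra k S := (φ.comp r).toAlgebra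
  let e' : E →ₐ[k] S := { e with commutes' := fun x => (comm x).symm }
  let φ' : R →ₐ[k] S := { φ with commutes' := fun x => rfl }
  have hmul : ∀ (x : E) (y : R), Algebra.TensorProduct.productMap e' φ' (x ⊗ₜ y) = e x * φ y :=
    fun x y => rfl
  have hbij : Function.Bijective (Algebra.TensorProduct.productMap e' φ') := by
    constructor
    · rw [injective_iff_map_eq_zero]
      intro z hz
      obtain ⟨c, rfl⟩ := TensorProduct.eq_repr_basis_left b z
      rw [Finsupp.sum_fintype _ _ (by simp), map_sum] at hz
      have := hi c hz
      rw [Finsupp.sum_fintype _ _ (by simp)]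
      simp [this]
    · intro s
      obtain ⟨x, hx⟩ := hs s
      exact ⟨∑ i, b i ⊗ₜ x i, by rw [map_sum]; exact hx⟩
  refine (CommRingCat.isPushout_tensorProduct k E R).of_iso (Iso.refl _) (Iso.refl _) (Iso.refl _)
    (RingEquiv.ofBijective (Algebra.TensorProduct.productMap e' φ' : E ⊗[k] R →+* S) hbij).toCommRingCatIso
    (by rfl) (by rfl) ?_ ?_
  · ext x
    change e x * φ 1 = e x
    rw [map_one, mul_one]
  · ext x
    change e 1 * φ x = φ x
    rw [map_one, one_mul]

variable {σ A : Type} [CommRing A] [SetLike σ A] [AddSubgroupClass σ A] {𝒜 : ℕ → σ}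
  [GradedRing 𝒜]

lemma fromZero_mul_awayMk {f : A} {d : ℕ} (hd : f ∈ 𝒜 d) (x : 𝒜 0) (k : ℕ) (a : A)
    (ha : a ∈ 𝒜 (k • d)) (hxa : (x : A) * a ∈ 𝒜 (k • d)) :
    fromZeroRingHom 𝒜 (Submonoid.powers f) x * Away.mk 𝒜 hd k a ha =
      Away.mk 𝒜 hd k (x * a) hxa := by
  apply val_injective
  rw [val_mul, Away.val_mk, Away.val_mk, fromZeroRingHom]
  change (HomogeneousLocalization.mk _).val * _ = _
  rw [val_mk, Localization.mk_mul]
  congr 1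
  exact Subtype.ext (one_mul _)

lemma sum_awayMk {ι : Type} (s : Finset ι) {f : A} {d : ℕ} (hd : f ∈ 𝒜 d) (k : ℕ) (a : ι → A)
    (ha : ∀ i, a i ∈ 𝒜 (k • d)) :
    ∑ i ∈ s, Away.mk 𝒜 hd k (a i) (ha i) =
      Away.mk 𝒜 hd k (∑ i ∈ s, a i) (sum_mem fun i _ => ha i) := by
  apply val_injective
  rw [← HomogeneousLocalization.algebraMap_apply, map_sum, Away.val_mk]
  simp only [HomogeneousLocalization.algebraMap_apply, Away.val_mk, Localization.mk_sum]

lemma mul_mem_of_zero {x a : A} {n : ℕ} (hx : x ∈ 𝒜 0) (ha : a ∈ 𝒜 n) : x * a ∈ 𝒜 n := by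
  simpa using SetLike.mul_mem_graded hx ha

/-- Finitely many fractions have a common denominator. -/
lemma exists_common_denominator {ι : Type} [Fintype ι] {f : A} {d : ℕ} (hd : f ∈ 𝒜 d)
    (x : ι → Away 𝒜 f) : ∃ (k : ℕ) (a : ι → A) (ha : ∀ i, a i ∈ 𝒜 (k • d)),
      ∀ i, x i = Away.mk 𝒜 hd k (a i) (ha i) := by
  classical
  choose k a ha hx using fun i => Away.mk_surjective 𝒜 hd (x i)
  have hk : ∀ i, (∑ j, k j - k i) + k i = ∑ j, k j := fun i =>
    Nat.sub_add_cancel (Finset.single_le_sum (fun _ _ => Nat.zero_le _) (Finset.mem_univ i))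
  have h := fun i => pow_mul_mem hd (ha i) (∑ j, k j - k i)
  refine ⟨∑ i, k i, fun i => f ^ (∑ j, k j - k i) * a i, fun i => by
    have := h i
    rwa [hk i] at this, fun i => ?_⟩
  rw [← hx i, awayMk_mul_pow hd (ha i) (∑ j, k j - k i) (h i)]
  have : ∀ (m n : ℕ) (c : A) (hm : c ∈ 𝒜 (m • d)) (hn : c ∈ 𝒜 (n • d)), m = n →
      Away.mk 𝒜 hd m c hm = Away.mk 𝒜 hd n c hn := by
    rintro m _ c hm hn rfl
    rfl
  exact this _ _ _ _ _ (hk i)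

variable {τ C k E ι : Type} [CommRing C] [SetLike τ C] [AddSubgroupClass τ C] {𝒞 : ℕ → τ}
  [GradedRing 𝒞] [CommRing k] [CommRing E] [Algebra k E] [Fintype ι]

/-- The graded ring `𝒞` is the base change of `𝒜` along `k → E`, where `b` is a basis of `E`. -/
structure IsGradedBaseChange (b : Module.Basis ι k E) (r : k →+* 𝒜 0) (e : E →+* 𝒞 0)
    (θ : 𝒜 →+*ᵍ 𝒞) : Prop where
  comm : ∀ x, θ (r x : A) = (e (algebraMap k E x) : C)
  exists_sum : ∀ d, ∀ c ∈ 𝒞 d, ∃ a : ι → A, (∀ i, a i ∈ 𝒜 d) ∧ ∑ i, (e (b i) : C) * θ (a i) = c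
  eq_zero : ∀ d, ∀ a : ι → A, (∀ i, a i ∈ 𝒜 d) → ∑ i, (e (b i) : C) * θ (a i) = 0 → ∀ i, a i = 0

variable {b : Module.Basis ι k E} {r : k →+* 𝒜 0} {e : E →+* 𝒞 0} {θ : 𝒜 →+*ᵍ 𝒞}

/-- The denominator `θ f` comes from `𝒜`, so a fraction is expanded along the basis by expanding its
numerator. For uniqueness the coefficients are first brought to a common denominator, and a power of
`f` absorbs the failure of cancellation. -/
lemma IsGradedBaseChange.away (h : IsGradedBaseChange b r e θ) {f : A} {d : ℕ} (hd : f ∈ 𝒜 d) :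
    IsPushout (CommRingCat.ofHom (algebraMap k E))
      (CommRingCat.ofHom ((fromZeroRingHom 𝒜 (Submonoid.powers f)).comp r))
      (CommRingCat.ofHom ((fromZeroRingHom 𝒞 (Submonoid.powers (θ f))).comp e))
      (CommRingCat.ofHom (Away.map θ f)) := by
  have hd' := gradedMap_mem θ hd
  have key : ∀ (n : ℕ) (a : ι → A) (ha : ∀ i, a i ∈ 𝒜 (n • d)),
      ∑ i, (fromZeroRingHom 𝒞 (Submonoid.powers (θ f))).comp e (b i) *
        Away.map θ f (Away.mk 𝒜 hd n (a i) (ha i)) =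
      Away.mk 𝒞 hd' n (∑ i, (e (b i) : C) * θ (a i))
        (sum_mem fun i _ => mul_mem_of_zero (e (b i)).2 (gradedMap_mem θ (ha i))) := by
    intro n a ha
    rw [← sum_awayMk _ hd' n _ fun i => mul_mem_of_zero (e (b i)).2 (gradedMap_mem θ (ha i))]
    refine Finset.sum_congr rfl fun i _ => ?_
    rw [Away.map_mk]
    exact fromZero_mul_awayMk hd' (e (b i)) n _ (gradedMap_mem θ (ha i)) _
  refine isPushout_of_basis b _ _ _ (fun x => ?_) (fun s => ?_) (fun x hx i => ?_)
  · have h1 : ∀ {σ A : Type} [CommRing A] [SetLike σ A] [AddSubgroupClass σ A] {𝒜 : ℕ → σ}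
        [GradedRing 𝒜] {f : A} {d : ℕ} (hd : f ∈ 𝒜 d) (x : 𝒜 0),
        fromZeroRingHom 𝒜 (Submonoid.powers f) x = Away.mk 𝒜 hd 0 x (by simp) := by
      intros
      apply val_injective
      rw [Away.val_mk]
      change (HomogeneousLocalization.mk _).val = _
      rw [val_mk]
      congr 1
      exact Subtype.ext (pow_zero _).symm
    rw [RingHom.comp_apply, RingHom.comp_apply, h1 hd, h1 hd', Away.map_mk]
    apply val_injective
    rw [Away.val_mk, Away.val_mk, h.comm]
  · obtain ⟨n, c, hc, rfl⟩ := Away.mk_surjective 𝒞 hd' s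
    obtain ⟨a, ha, rfl⟩ := h.exists_sum _ c hc
    exact ⟨fun i => Away.mk 𝒜 hd n (a i) (ha i), key n a ha⟩
  · obtain ⟨n, a, ha, hxa⟩ := exists_common_denominator hd x
    simp only [hxa, key] at hx
    rw [hxa i]
    have h0 : Away.mk 𝒞 hd' n (∑ i, (e (b i) : C) * θ (a i))
        (sum_mem fun i _ => mul_mem_of_zero (e (b i)).2 (gradedMap_mem θ (ha i))) =
        Away.mk 𝒞 hd' n 0 (zero_mem _) := hx.trans (mk_eq_zero_of_num _ rfl).symm
    rw [awayMk_eq_iff] at h0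
    obtain ⟨m, hm⟩ := h0
    have h1 := h.eq_zero _ (fun i => f ^ m * a i) (fun i => pow_mul_mem hd (ha i) m) (by
      rw [mul_zero] at hm
      rw [← hm, Finset.mul_sum]
      refine Finset.sum_congr rfl fun i _ => ?_
      rw [map_mul, map_pow, mul_left_comm]) i
    have h2 : Away.mk 𝒜 hd n (a i) (ha i) = Away.mk 𝒜 hd n 0 (zero_mem _) := by
      rw [awayMk_eq_iff]
      exact ⟨m, by rw [h1, mul_zero]⟩
    rw [h2]
    exact mk_eq_zero_of_num _ rfl

variable (𝒜) in
/-- The structure morphism of `Proj 𝒜` over `Spec k` for `k → 𝒜₀`. -/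
def projStr (r : k →+* 𝒜 0) : Proj 𝒜 ⟶ Spec (.of k) :=
  Proj.toSpecZero 𝒜 ≫ Spec.map (CommRingCat.ofHom r)

lemma awayι_projStr (r : k →+* 𝒜 0) {f : A} {d : ℕ} (hd : f ∈ 𝒜 d) (h0 : 0 < d) :
    Proj.awayι 𝒜 f hd h0 ≫ projStr 𝒜 r =
      Spec.map (CommRingCat.ofHom ((fromZeroRingHom 𝒜 (Submonoid.powers f)).comp r)) := by
  rw [projStr, Proj.awayι_toSpecZero_assoc, ← Spec.map_comp, ← CommRingCat.ofHom_comp]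

/-- The base change of `Proj 𝒜` along `k → E` is `Proj 𝒞`. -/
theorem IsGradedBaseChange.isPullback (h : IsGradedBaseChange b r e θ) (hθ : IsRegularOnProj θ) :
    IsPullback (projMap hθ) (projStr 𝒞 e) (projStr 𝒜 r)
      (Spec.map (CommRingCat.ofHom (algebraMap k E))) := by
  refine Scheme.isPullback_of_openCover _ _ _ _ (Proj.affineOpenCover 𝒜).openCover fun i => ?_
  have hp := projMap_isPullback hθ i.1.2 i.2.2
  have hq := isPullback_SpecMap_of_isPushout _ _ _ _ (h.away i.2.2).flip
  refine hq.of_iso hp.flip.isoPullback (Iso.refl _) (Iso.refl _) (Iso.refl _) ?_ ?_ ?_ ?_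
  · exact (Category.comp_id _).trans (hp.flip.isoPullback_hom_snd).symm
  · refine (Category.comp_id _).trans ?_
    refine Eq.trans ?_ (Category.assoc _ _ _)
    refine Eq.trans ?_ congr($(hp.flip.isoPullback_hom_fst.symm) ≫ projStr 𝒞 e)
    exact (awayι_projStr e (gradedMap_mem θ i.2.2) i.1.2).symm
  · refine (Category.comp_id _).trans (Eq.trans ?_ (Category.id_comp _).symm)
    exact (awayι_projStr r i.2.2 i.1.2).symm
  · exact (Category.comp_id _).trans (Category.id_comp _).symm

/-- If all `θ a` of positive degree vanished at `x`, so would their combinations, which fill the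
irrelevant ideal. -/
lemma IsGradedBaseChange.isRegular (h : IsGradedBaseChange b r e θ) : IsRegularOnProj θ := by
  intro x
  by_contra! h'
  refine x.not_irrelevant_le ((HomogeneousIdeal.irrelevant_le _).mpr fun d hd c hc => ?_)
  obtain ⟨a, ha, rfl⟩ := h.exists_sum d c hc
  exact Ideal.sum_mem _ fun i _ => Ideal.mul_mem_left _ _ (not_not.1 (h' d (a i) hd (ha i)))

end BaseChange

/-! ### Invariants and base change. -/

section Equivariant

variable {σ A G : Type} [CommRing A] [SetLike σ A] [AddSubgroupClass σ A] {𝒜 : ℕ → σ}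
  [GradedRing 𝒜] [Group G] {ρ : G →* (𝒜 →+*ᵍ 𝒜)}

/-- The homomorphism to the ring of invariants in degree zero. -/
def invZero {k : Type} [CommRing k] (r : k →+* 𝒜 0) (hr : ∀ g x, ρ g (r x : A) = r x) :
    k →+* invGrading ρ 0 where
  toFun x := ⟨⟨r x, fun g => hr g x⟩, (r x).2⟩
  map_one' := by ext; simp
  map_mul' x y := by ext; simp
  map_zero' := by ext; simp
  map_add' x y := by ext; simp

lemma projQuot_projStr {k : Type} [CommRing k] [Finite G] (r : k →+* 𝒜 0)
    (hr : ∀ g x, ρ g (r x : A) = r x) :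
    projQuot ρ ≫ projStr (invGrading ρ) (invZero r hr) = projStr 𝒜 r := by
  refine (regularCover (invIncl_isRegular (ρ := ρ))).openCover.hom_ext _ _ ?_
  rintro ⟨⟨d, a⟩, h0, ha⟩
  change Proj.awayι 𝒜 (invIncl ρ a) (gradedMap_mem (invIncl ρ) ha) h0 ≫ _ =
    Proj.awayι 𝒜 (invIncl ρ a) (gradedMap_mem (invIncl ρ) ha) h0 ≫ _
  rw [awayι_projStr, ← Category.assoc, awayι_projMap _ h0 ha, Category.assoc, awayι_projStr,
    ← Spec.map_comp, ← CommRingCat.ofHom_comp]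
  congr 2

variable {τ C : Type} [CommRing C] [SetLike τ C] [AddSubgroupClass τ C] {𝒞 : ℕ → τ}
  [GradedRing 𝒞] {ρ' : G →* (𝒞 →+*ᵍ 𝒞)}

/-- The homomorphism of rings of invariants induced by an equivariant homomorphism. -/
def invMap (θ : 𝒜 →+*ᵍ 𝒞) (hθ : ∀ g a, ρ' g (θ a) = θ (ρ g a)) :
    invGrading ρ →+*ᵍ invGrading ρ' where
  toFun a := ⟨θ a, fun g => by rw [hθ, a.2 g]⟩
  map_one' := by ext; simp
  map_mul' x y := by ext; simp
  map_zero' := by ext; simp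
  map_add' x y := by ext; simp
  map_mem h := gradedMap_mem θ h

lemma invIncl_invMap (θ : 𝒜 →+*ᵍ 𝒞) (hθ : ∀ g a, ρ' g (θ a) = θ (ρ g a)) (a : invSubring ρ) :
    invIncl ρ' (invMap θ hθ a) = θ (invIncl ρ a) := rfl

/-- The group fixes the images of the basis, so it acts on an element coefficient by coefficient; by
uniqueness of the expansion, the coefficients of an invariant are themselves invariant. -/
lemma IsGradedBaseChange.inv {k E ι : Type} [CommRing k] [CommRing E] [Algebra k E] [Fintype ι]
    {b : Module.Basis ι k E} {r : k →+* 𝒜 0} {e : E →+* 𝒞 0} {θ : 𝒜 →+*ᵍ 𝒞}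
    (h : IsGradedBaseChange b r e θ) (hθ : ∀ g a, ρ' g (θ a) = θ (ρ g a))
    (hr : ∀ g x, ρ g (r x : A) = r x) (he : ∀ g x, ρ' g (e x : C) = e x) :
    IsGradedBaseChange b (invZero r hr) (invZero e he) (invMap (ρ := ρ) (ρ' := ρ') θ hθ) where
  comm x := Subtype.ext (h.comm x)
  exists_sum d c hc := by
    obtain ⟨a, ha, hac⟩ := h.exists_sum d (c : C) hc
    have hinv : ∀ i, a i ∈ invSubring ρ := fun i g => by
      have h1 := h.eq_zero d (fun i => ρ g (a i) - a i)
        (fun i => sub_mem (gradedMap_mem _ (ha i)) (ha i)) (by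
          have h2 : ρ' g (c : C) = c := c.2 g
          rw [← hac, map_sum] at h2
          simp only [map_mul, he, hθ] at h2
          simp only [map_sub, mul_sub, Finset.sum_sub_distrib, h2, sub_self]) i
      exact sub_eq_zero.1 h1
    refine ⟨fun i => ⟨a i, hinv i⟩, ha, Subtype.ext ?_⟩
    rw [← hac, AddSubmonoidClass.coe_finsetSum]
    rfl
  eq_zero d a ha h0 i := by
    refine Subtype.ext (h.eq_zero d (fun i => (a i : A)) ha ?_ i)
    have := congrArg Subtype.val h0
    rw [AddSubmonoidClass.coe_finsetSum] at this
    exact this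

/-- Every point of `Proj` of the invariants lies over a set `D₊(θ a)` with `a` invariant. -/
lemma invMap_isRegular [Finite G] {θ : 𝒜 →+*ᵍ 𝒞} (hθ : ∀ g a, ρ' g (θ a) = θ (ρ g a))
    (h : IsRegularOnProj θ) : IsRegularOnProj (invMap (ρ := ρ) (ρ' := ρ') θ hθ) := by
  intro y
  obtain ⟨x, rfl⟩ := projQuot_surjective ρ' y
  obtain ⟨d, a, h0, ha, hx⟩ := invIncl_isRegular (ρ := ρ) (projMap h x)
  refine ⟨d, a, h0, ha, ?_⟩
  have h1 : x ∈ projMap h ⁻¹ᵁ Proj.basicOpen 𝒜 (invIncl ρ a) := hx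
  rw [projMap_preimage h h0 (invIncl_mem ρ ha), ← invIncl_invMap θ hθ a,
    ← projMap_preimage (invIncl_isRegular (ρ := ρ')) h0 (gradedMap_mem (invMap θ hθ) ha)] at h1
  exact h1

end Equivariant

end QuotientToric

namespace QuotientToric

/-! ### Orthogonality of characters with values in `E`. -/

section Orthogonality

set_option linter.unusedSectionVars false

variable {G : Type} [CommGroup G] [Fintype G]

lemma sum_charVal_eq_zero (χ : G →* ℂˣ) (hχ : χ ≠ 1) : ∑ g, charVal χ g = 0 := by
  obtain ⟨h, hh⟩ : ∃ h, χ h ≠ 1 := by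
    by_contra! h'
    exact hχ (MonoidHom.ext h')
  have h1 : charVal χ h * ∑ g, charVal χ g = ∑ g, charVal χ g := by
    rw [Finset.mul_sum, ← Equiv.sum_comp (Equiv.mulLeft h) fun g => charVal χ g]
    simp
  have h2 : charVal χ h ≠ 1 := fun h' => hh (Units.ext (congrArg Subtype.val h'))
  have h3 : (charVal χ h - 1) * ∑ g, charVal χ g = 0 := by rw [sub_mul, h1, one_mul, sub_self]
  exact (mul_eq_zero.1 h3).resolve_left (sub_ne_zero.2 h2)

lemma charVal_mul (χ ψ : G →* ℂˣ) (g : G) : charVal (χ * ψ) g = charVal χ g * charVal ψ g := rfl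

lemma charVal_one_left (g : G) : charVal (1 : G →* ℂˣ) g = 1 := rfl

lemma charVal_inv_left (χ : G →* ℂˣ) (g : G) : charVal χ⁻¹ g = charVal χ g⁻¹ := by
  refine Subtype.ext ?_
  change ((χ⁻¹ g : ℂˣ) : ℂ) = (χ g⁻¹ : ℂˣ)
  rw [MonoidHom.inv_apply, map_inv]

lemma card_chars : Fintype.card (G →* ℂˣ) = Fintype.card G := by
  rw [← Nat.card_eq_fintype_card, ← Nat.card_eq_fintype_card]
  exact CommGroup.card_monoidHom_of_hasEnoughRootsOfUnity G ℂ

/-- Multiplication by a character `ψ` with `ψ g ≠ 1` permutes the summands and scales the sum; such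
a `ψ` exists because characters separate the elements of a finite abelian group. -/
lemma sum_chars_eq_zero (g : G) (hg : g ≠ 1) : ∑ χ : G →* ℂˣ, charVal χ g = 0 := by
  obtain ⟨ψ, hψ⟩ := CommGroup.exists_apply_ne_one_of_hasEnoughRootsOfUnity G ℂ hg
  have h1 : charVal ψ g * ∑ χ : G →* ℂˣ, charVal χ g = ∑ χ : G →* ℂˣ, charVal χ g := by
    rw [Finset.mul_sum, ← Equiv.sum_comp (Equiv.mulLeft ψ) fun χ : G →* ℂˣ => charVal χ g]
    rfl
  have h2 : charVal ψ g ≠ 1 := fun h' => hψ (Units.ext (congrArg Subtype.val h'))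
  have h3 : (charVal ψ g - 1) * ∑ χ : G →* ℂˣ, charVal χ g = 0 := by
    rw [sub_mul, h1, one_mul, sub_self]
  exact (mul_eq_zero.1 h3).resolve_left (sub_ne_zero.2 h2)

lemma cardE_ne : (Fintype.card G : charField G) ≠ 0 := Nat.cast_ne_zero.2 Fintype.card_ne_zero

open Classical in
/-- Orthogonality of the characters. -/
lemma orthogonality_chars (g h : G) :
    ∑ χ : G →* ℂˣ, (Fintype.card G : charField G)⁻¹ * charVal χ g⁻¹ * charVal χ h =
      if g = h then 1 else 0 := by
  simp only [mul_assoc, ← map_mul, ← Finset.mul_sum]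
  split_ifs with hgh
  · subst hgh
    simp only [inv_mul_cancel, map_one, Finset.sum_const, Finset.card_univ, card_chars, nsmul_eq_mul,
      mul_one, inv_mul_cancel₀ cardE_ne]
  · rw [sum_chars_eq_zero _ fun h' => hgh (inv_mul_eq_one.1 h'), mul_zero]

open Classical in
/-- Orthogonality of the characters. -/
lemma orthogonality_elements (χ ψ : G →* ℂˣ) :
    ∑ g, (Fintype.card G : charField G)⁻¹ * charVal χ g⁻¹ * charVal ψ g =
      if χ = ψ then 1 else 0 := by
  simp only [mul_assoc, ← charVal_inv_left, ← charVal_mul, ← Finset.mul_sum]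
  split_ifs with hgh
  · subst hgh
    have h1 : χ⁻¹ * χ = 1 := inv_mul_cancel χ
    simp only [h1, charVal_one_left, Finset.sum_const, Finset.card_univ, nsmul_eq_mul,
      mul_one, inv_mul_cancel₀ cardE_ne]
  · rw [sum_charVal_eq_zero _ fun h' => hgh (inv_mul_eq_one.1 h'), mul_zero]

/-- `E` is generated by finitely many roots of unity. -/
instance : FiniteDimensional ℚ (charField G) := by
  have hfin : {z : ℂ | ∃ (χ : G →* ℂˣ) (g : G), z = χ g}.Finite := by
    refine (Set.finite_range fun p : (G →* ℂˣ) × G => (p.1 p.2 : ℂ)).subset ?_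
    rintro z ⟨χ, g, rfl⟩
    exact ⟨(χ, g), rfl⟩
  have := hfin.to_subtype
  refine IntermediateField.finiteDimensional_adjoin fun z hz => ?_
  obtain ⟨χ, g, rfl⟩ := hz
  refine IsIntegral.of_pow Fintype.card_pos (n := Fintype.card G) ?_
  rw [← Units.val_pow_eq_pow_val, ← map_pow, pow_card_eq_one, map_one, Units.val_one]
  exact isIntegral_one

end Orthogonality

/-! ### The coordinates along the idempotents. -/

section ChangeOfCoordinates

set_option linter.unusedSectionVars false

variable (G : Type) [CommGroup G] [Fintype G]

/-- The coordinates `Y` (index `none`) and `Z_χ` along the idempotents `v_χ`. -/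
abbrev CharPoly : Type := MvPolynomial (Option (G →* ℂˣ)) (charField G)

/-- The grading of `E[Y, Z_χ]` by degree. -/
abbrev charGrading : ℕ → Submodule (charField G) (CharPoly G) :=
  MvPolynomial.homogeneousSubmodule (Option (G →* ℂˣ)) (charField G)

instance : GradedAlgebra (charGrading G) := MvPolynomial.gradedAlgebra

variable {G}

lemma isHomogeneous_elim {σ τ R : Type} [CommRing R] (a : σ → MvPolynomial (Option τ) R)
    (ha : ∀ s, (a s).IsHomogeneous 1) (o : Option σ) :
    (o.elim (MvPolynomial.X none) a : MvPolynomial (Option τ) R).IsHomogeneous 1 := by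
  cases o with
  | none => exact MvPolynomial.isHomogeneous_X _ _
  | some s => exact ha s

/-- `X_g = (1/n) ∑ χ(g⁻¹) Z_χ`. -/
def toCharCoord (g : G) : CharPoly G := ∑ χ : G →* ℂˣ,
  MvPolynomial.C ((Fintype.card G : charField G)⁻¹ * charVal χ g⁻¹) * MvPolynomial.X (some χ)

/-- `Z_χ = ∑ χ(g) X_g`. -/
def ofCharCoord (χ : G →* ℂˣ) : MvPolynomial (Option G) (charField G) := ∑ g : G,
  MvPolynomial.C (charVal χ g) * MvPolynomial.X (some g)

lemma toCharCoord_isHomogeneous (g : G) : (toCharCoord g).IsHomogeneous 1 :=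
  MvPolynomial.IsHomogeneous.sum _ _ _ fun χ _ =>
    MvPolynomial.IsHomogeneous.C_mul (MvPolynomial.isHomogeneous_X _ (some χ)) _

lemma ofCharCoord_isHomogeneous (χ : G →* ℂˣ) : (ofCharCoord χ).IsHomogeneous 1 :=
  MvPolynomial.IsHomogeneous.sum _ _ _ fun g _ =>
    MvPolynomial.IsHomogeneous.C_mul (MvPolynomial.isHomogeneous_X _ (some g)) _

variable (G) in
/-- The linear change of coordinates. -/
def toChar : MvPolynomial (Option G) (charField G) →ₐ[charField G] CharPoly G :=
  MvPolynomial.aeval fun o => o.elim (MvPolynomial.X none) toCharCoord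

variable (G) in
/-- The inverse linear change of coordinates. -/
def ofChar : CharPoly G →ₐ[charField G] MvPolynomial (Option G) (charField G) :=
  MvPolynomial.aeval fun o => o.elim (MvPolynomial.X none) ofCharCoord

lemma toChar_ofCharCoord (χ : G →* ℂˣ) :
    toChar G (ofCharCoord χ) = MvPolynomial.X (some χ) := by
  classical
  have h1 : ∀ ψ g, toChar G (MvPolynomial.C (charVal ψ g) * MvPolynomial.X (some g)) =
      MvPolynomial.C (charVal ψ g) * toCharCoord g := fun ψ g => by
    rw [map_mul, toChar, MvPolynomial.algHom_C, MvPolynomial.aeval_X]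
    rfl
  have h2 : ∀ ψ, ∑ g, MvPolynomial.C (charVal χ g) *
      (MvPolynomial.C ((Fintype.card G : charField G)⁻¹ * charVal ψ g⁻¹) *
        (MvPolynomial.X (some ψ) : CharPoly G)) =
      MvPolynomial.C (if ψ = χ then 1 else 0) * MvPolynomial.X (some ψ) := fun ψ => by
    rw [← orthogonality_elements, map_sum, Finset.sum_mul]
    refine Finset.sum_congr rfl fun g _ => ?_
    rw [← mul_assoc, ← MvPolynomial.C_mul, mul_comm (charVal χ g)]
  rw [ofCharCoord, map_sum]
  simp only [h1, toCharCoord, Finset.mul_sum]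
  rw [Finset.sum_comm]
  simp only [h2]
  simp

lemma ofChar_toCharCoord (g : G) :
    ofChar G (toCharCoord g) = MvPolynomial.X (some g) := by
  classical
  have h1 : ∀ (a : charField G) ψ, ofChar G (MvPolynomial.C a * MvPolynomial.X (some ψ)) =
      MvPolynomial.C a * ofCharCoord ψ := fun a ψ => by
    rw [map_mul, ofChar, MvPolynomial.algHom_C, MvPolynomial.aeval_X]
    rfl
  have h2 : ∀ h, ∑ χ, MvPolynomial.C ((Fintype.card G : charField G)⁻¹ * charVal χ g⁻¹) *
      (MvPolynomial.C (charVal χ h) *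
        (MvPolynomial.X (some h) : MvPolynomial (Option G) (charField G))) =
      MvPolynomial.C (if g = h then 1 else 0) * MvPolynomial.X (some h) := fun h => by
    rw [← orthogonality_chars, map_sum, Finset.sum_mul]
    refine Finset.sum_congr rfl fun g _ => ?_
    rw [← mul_assoc, ← MvPolynomial.C_mul]
  rw [toCharCoord, map_sum]
  simp only [h1, ofCharCoord, Finset.mul_sum]
  rw [Finset.sum_comm]
  simp only [h2]
  simp

lemma toChar_ofChar (p : CharPoly G) : toChar G (ofChar G p) = p := by
  have : (toChar G).comp (ofChar G) = AlgHom.id _ _ := by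
    refine MvPolynomial.algHom_ext fun o => ?_
    cases o with
    | none => simp [toChar, ofChar]
    | some χ => simpa [ofChar] using toChar_ofCharCoord χ
  exact DFunLike.congr_fun this p

lemma ofChar_toChar (p : MvPolynomial (Option G) (charField G)) : ofChar G (toChar G p) = p := by
  have : (ofChar G).comp (toChar G) = AlgHom.id _ _ := by
    refine MvPolynomial.algHom_ext fun o => ?_
    cases o with
    | none => simp [toChar, ofChar]
    | some χ => simpa [toChar] using ofChar_toCharCoord χ
  exact DFunLike.congr_fun this p

lemma aeval_isHomogeneous {σ τ R S : Type} [CommRing R] [CommRing S] [Algebra R S]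
    (a : σ → MvPolynomial τ S) (ha : ∀ s, (a s).IsHomogeneous 1) {p : MvPolynomial σ R} {d : ℕ}
    (hp : p.IsHomogeneous d) : (MvPolynomial.aeval a p).IsHomogeneous d := by
  simpa using hp.aeval a ha

variable (G) in
/-- The homomorphism `ℚ[Y, X_g] → E[Y, Z_χ]`. -/
def extendCoord : projGrading G →+*ᵍ charGrading G where
  __ := (MvPolynomial.aeval (R := ℚ) fun o : Option G =>
    (o.elim (MvPolynomial.X none) toCharCoord : CharPoly G)).toRingHom
  map_mem hx := aeval_isHomogeneous _ (isHomogeneous_elim _ toCharCoord_isHomogeneous) hx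

lemma extendCoord_apply (p : MvPolynomial (Option G) ℚ) :
    extendCoord G p = MvPolynomial.aeval (fun o : Option G =>
    (o.elim (MvPolynomial.X none) toCharCoord : CharPoly G)) p := rfl

/-- This separates extension of scalars from an invertible linear substitution over `E`, so each can
be treated alone. -/
lemma extendCoord_eq_toChar (p : MvPolynomial (Option G) ℚ) :
    extendCoord G p = toChar G (MvPolynomial.map (algebraMap ℚ (charField G)) p) := by
  rw [extendCoord_apply, toChar, MvPolynomial.aeval_map_algebraMap]

lemma extendCoord_injective : Function.Injective (extendCoord G) := by
  intro p q hpq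
  rw [extendCoord_eq_toChar, extendCoord_eq_toChar] at hpq
  exact MvPolynomial.map_injective _ (algebraMap ℚ (charField G)).injective
    (Function.LeftInverse.injective ofChar_toChar hpq)

variable (G) in
/-- A basis of `E` over `ℚ`. -/
def fieldBasis : Module.Basis (Fin (Module.finrank ℚ (charField G))) ℚ (charField G) :=
  Module.finBasis ℚ (charField G)

/-- The coefficients of `p` are expanded along the basis one monomial at a time, which preserves the
degree. -/
lemma exists_sum_map {σ k E ι : Type} [Field k] [Field E] [Algebra k E] [Fintype ι]
    (b : Module.Basis ι k E) (p : MvPolynomial σ E) {d : ℕ} (hp : p.IsHomogeneous d) :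
    ∃ a : ι → MvPolynomial σ k, (∀ i, (a i).IsHomogeneous d) ∧
      ∑ i, MvPolynomial.C (b i) * MvPolynomial.map (algebraMap k E) (a i) = p := by
  refine ⟨fun i => ∑ m ∈ p.support, MvPolynomial.monomial m (b.repr (p.coeff m) i), fun i => ?_, ?_⟩
  · refine MvPolynomial.IsHomogeneous.sum _ _ _ fun m hm => ?_
    refine MvPolynomial.isHomogeneous_monomial _ ?_
    have := hp (MvPolynomial.mem_support_iff.1 hm)
    rwa [Finsupp.degree_eq_weight_one]
  · conv_rhs => rw [p.as_sum]
    simp only [map_sum, Finset.mul_sum, MvPolynomial.map_monomial, MvPolynomial.C_mul_monomial]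
    rw [Finset.sum_comm]
    refine Finset.sum_congr rfl fun m _ => ?_
    rw [← map_sum]
    congr 1
    conv_rhs => rw [← b.sum_repr (p.coeff m)]
    exact Finset.sum_congr rfl fun i _ => by rw [Algebra.smul_def, mul_comm]

lemma eq_zero_of_sum_map {σ k E ι : Type} [Field k] [Field E] [Algebra k E] [Fintype ι]
    (b : Module.Basis ι k E) (a : ι → MvPolynomial σ k)
    (h : ∑ i, MvPolynomial.C (b i) * MvPolynomial.map (algebraMap k E) (a i) = 0) (i : ι) :
    a i = 0 := by
  ext m
  have h1 := congrArg (MvPolynomial.coeff m) h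
  simp only [MvPolynomial.coeff_sum, MvPolynomial.coeff_C_mul, MvPolynomial.coeff_map,
    MvPolynomial.coeff_zero] at h1
  have h2 := Fintype.linearIndependent_iff.1 b.linearIndependent (fun i => (a i).coeff m) (by
    rw [← h1]
    exact Finset.sum_congr rfl fun i _ => by rw [Algebra.smul_def, mul_comm]) i
  simpa using h2

/-- For plain extension of scalars the expansion is coefficientwise. Composing with `toChar` changes
nothing, since it is bijective, preserves degrees and is `E`-linear. -/
theorem extendCoord_isGradedBaseChange :
    IsGradedBaseChange (fieldBasis G) (algebraMap ℚ (projGrading G 0))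
      (algebraMap (charField G) (charGrading G 0)) (extendCoord G) where
  comm x := by
    change extendCoord G (MvPolynomial.C x) = MvPolynomial.C _
    rw [extendCoord_apply, MvPolynomial.algHom_C]
    rfl
  exists_sum d c hc := by
    obtain ⟨a, ha, hac⟩ := exists_sum_map (fieldBasis G) (ofChar G c)
      (aeval_isHomogeneous _ (isHomogeneous_elim _ ofCharCoord_isHomogeneous) hc)
    refine ⟨a, ha, ?_⟩
    rw [← toChar_ofChar c, ← hac, map_sum]
    refine Finset.sum_congr rfl fun i _ => ?_
    rw [map_mul, extendCoord_eq_toChar, MvPolynomial.algHom_C]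
    rfl
  eq_zero d a ha h := by
    refine eq_zero_of_sum_map (fieldBasis G) a (Function.LeftInverse.injective ofChar_toChar ?_)
    rw [map_zero, ← h, map_sum]
    refine Finset.sum_congr rfl fun i _ => ?_
    rw [map_mul, extendCoord_eq_toChar, MvPolynomial.algHom_C]
    rfl

end ChangeOfCoordinates

end QuotientToric

namespace QuotientToric

/-! ### The action of `G` in both coordinate systems. -/

section Actions

set_option linter.unusedSectionVars false

variable (G : Type) [CommGroup G] [Fintype G]

/-- The action of `G` on `ℚ[Y, X_g]`. -/
def translateAction : G →* (projGrading G →+*ᵍ projGrading G) where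
  toFun := projTranslateRing
  map_one' := by
    refine DFunLike.ext _ _ fun x => ?_
    change MvPolynomial.rename _ x = x
    simp
  map_mul' g h := by
    refine DFunLike.ext _ _ fun x => ?_
    change MvPolynomial.rename _ x = MvPolynomial.rename _ (MvPolynomial.rename _ x)
    rw [MvPolynomial.rename_rename, Option.map_comp_map]
    congr 3
    ext k
    simp only [Function.comp_apply, mul_inv_rev, mul_assoc, mul_left_comm]

variable {G}

/-- The homomorphism `Y ↦ Y`, `Z_χ ↦ χ(h) Z_χ`. -/
def charScaleHom (h : G) : CharPoly G →ₐ[charField G] CharPoly G :=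
  MvPolynomial.aeval fun o : Option (G →* ℂˣ) =>
    (o.elim (MvPolynomial.X none) fun χ => MvPolynomial.C (charVal χ h) * MvPolynomial.X (some χ) :
      CharPoly G)

/-- The homomorphism `Y ↦ Y`, `Z_χ ↦ χ(h) Z_χ`. -/
def charScale (h : G) : charGrading G →+*ᵍ charGrading G where
  __ := (charScaleHom h).toRingHom
  map_mem hx := aeval_isHomogeneous _ (isHomogeneous_elim _ fun χ =>
    MvPolynomial.IsHomogeneous.C_mul (MvPolynomial.isHomogeneous_X _ (some χ)) _) hx

lemma charScale_apply (h : G) (p : CharPoly G) : charScale h p = charScaleHom h p := rfl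

lemma charScale_C (h : G) (a : charField G) :
    charScale h (MvPolynomial.C a) = MvPolynomial.C a := by
  rw [charScale_apply, MvPolynomial.algHom_C, MvPolynomial.algebraMap_eq]

lemma charScale_X (h : G) (χ : G →* ℂˣ) : charScale h (MvPolynomial.X (some χ)) =
    MvPolynomial.C (charVal χ h) * MvPolynomial.X (some χ) := by
  rw [charScale_apply, charScaleHom, MvPolynomial.aeval_X]
  rfl

lemma charScale_X_none (h : G) : charScale h (MvPolynomial.X none) = MvPolynomial.X none := by
  rw [charScale_apply, charScaleHom, MvPolynomial.aeval_X]
  rfl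

lemma charPoly_ringHom_ext {R : Type} [CommRing R] {f g : CharPoly G →+* R}
    (hC : ∀ a, f (MvPolynomial.C a) = g (MvPolynomial.C a))
    (h0 : f (MvPolynomial.X none) = g (MvPolynomial.X none))
    (h : ∀ χ, f (MvPolynomial.X (some χ)) = g (MvPolynomial.X (some χ))) : f = g :=
  MvPolynomial.ringHom_ext hC fun o => by
    cases o with
    | none => exact h0
    | some χ => exact h χ

lemma charScaleHom_one : charScaleHom (1 : G) = AlgHom.id _ _ := by
  refine MvPolynomial.algHom_ext fun o => ?_
  rw [charScaleHom, MvPolynomial.aeval_X]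
  cases o with
  | none => rfl
  | some χ =>
    rw [Option.elim_some, map_one, map_one, one_mul]
    rfl

lemma charScaleHom_mul (g h : G) :
    charScaleHom (g * h) = (charScaleHom g).comp (charScaleHom h) := by
  refine MvPolynomial.algHom_ext fun o => ?_
  cases o with
  | none => simp [charScaleHom]
  | some χ =>
    have h1 : ∀ k, charScaleHom k (MvPolynomial.X (some χ)) =
      MvPolynomial.C (charVal χ k) * MvPolynomial.X (some χ) := fun k => charScale_X k χ
    have h2 : ∀ k a, charScaleHom k (MvPolynomial.C a : CharPoly G) = MvPolynomial.C a :=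
      fun k a => charScale_C k a
    rw [AlgHom.comp_apply, h1, h1, map_mul (charScaleHom g), h2, h1, ← mul_assoc,
      ← MvPolynomial.C_mul, mul_comm (charVal χ h), ← map_mul]

variable (G) in
/-- The action of `G` on `E[Y, Z_χ]`. -/
def charAction : G →* (charGrading G →+*ᵍ charGrading G) where
  toFun := charScale
  map_one' := DFunLike.ext _ _ fun x => DFunLike.congr_fun charScaleHom_one x
  map_mul' g h := DFunLike.ext _ _ fun x => DFunLike.congr_fun (charScaleHom_mul g h) x

lemma charAction_apply (h : G) : charAction G h = charScale h := rfl

lemma extendCoord_X (g : G) : extendCoord G (MvPolynomial.X (some g)) = toCharCoord g := by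
  rw [extendCoord_apply, MvPolynomial.aeval_X]
  rfl

lemma extendCoord_X_none : extendCoord G (MvPolynomial.X none) = MvPolynomial.X none := by
  rw [extendCoord_apply, MvPolynomial.aeval_X]
  rfl

lemma projTranslateRing_X (h g : G) : projTranslateRing h (MvPolynomial.X (some g)) =
    MvPolynomial.X (some (h⁻¹ * g)) :=
  MvPolynomial.rename_X _ _

lemma projTranslateRing_X_none (h : G) : projTranslateRing h (MvPolynomial.X none) =
    MvPolynomial.X none :=
  MvPolynomial.rename_X _ _

lemma projTranslateRing_C (h : G) (a : ℚ) : projTranslateRing h (MvPolynomial.C a) =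
    MvPolynomial.C a :=
  MvPolynomial.rename_C _ _

lemma projPoly_ringHom_ext {R : Type} [CommRing R] {f g : MvPolynomial (Option G) ℚ →+* R}
    (h0 : f (MvPolynomial.X none) = g (MvPolynomial.X none))
    (h : ∀ χ, f (MvPolynomial.X (some χ)) = g (MvPolynomial.X (some χ))) : f = g :=
  MvPolynomial.ringHom_ext (fun a => DFunLike.congr_fun (RingHom.ext_rat
    (f.comp MvPolynomial.C) (g.comp MvPolynomial.C)) a) fun o => by
    cases o with
    | none => exact h0
    | some χ => exact h χ

/-- Translation becomes diagonal: the coefficient of `Z_χ` in `X_{h⁻¹g}` carries `χ(g⁻¹h)`, which is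
`χ(h)` times the factor `χ(g⁻¹)` in `X_g`. -/
lemma charAction_extendCoord (h : G) (a : MvPolynomial (Option G) ℚ) :
    charAction G h (extendCoord G a) = extendCoord G (translateAction G h a) := by
  refine DFunLike.congr_fun
    (f := (charScale h : CharPoly G →+* CharPoly G).comp
      (extendCoord G : MvPolynomial (Option G) ℚ →+* CharPoly G))
    (g := (extendCoord G : MvPolynomial (Option G) ℚ →+* CharPoly G).comp
      (projTranslateRing h : MvPolynomial (Option G) ℚ →+* MvPolynomial (Option G) ℚ))
    (projPoly_ringHom_ext ?_ fun g => ?_) a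
  · change charScale h (extendCoord G _) = extendCoord G (projTranslateRing h _)
    rw [projTranslateRing_X_none, extendCoord_X_none, charScale_X_none]
  · change charScale h (extendCoord G _) = extendCoord G (projTranslateRing h _)
    rw [projTranslateRing_X, extendCoord_X, extendCoord_X, toCharCoord, toCharCoord, map_sum]
    refine Finset.sum_congr rfl fun χ _ => ?_
    rw [map_mul, charScale_C, charScale_X, ← mul_assoc, ← MvPolynomial.C_mul, mul_assoc, ← map_mul,
      mul_inv_rev, inv_inv]

end Actions

/-! ### Integral coordinates on `M'`, and `M` as the sublattice of trivial weight. -/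

section Lattice

set_option linter.unusedSectionVars false

variable {G : Type} [CommGroup G] [Fintype G]

/-- The linear form with coordinates `a`. -/
def ofCoord (a : (G →* ℂˣ) → ℤ) : Module.Dual ℝ (cocharSpace G) :=
  ∑ χ, (a χ : ℝ) • LinearMap.proj χ

lemma ofCoord_apply (a : (G →* ℂˣ) → ℤ) (v : cocharSpace G) :
    ofCoord a v = ∑ χ, (a χ : ℝ) * v χ := by
  simp [ofCoord, LinearMap.sum_apply]

lemma ofCoord_charVec (a : (G →* ℂˣ) → ℤ) (χ : G →* ℂˣ) : ofCoord a (charVec χ) = a χ := by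
  classical
  simp [ofCoord_apply, charVec, Pi.single_apply]

lemma ofCoord_injective : Function.Injective (ofCoord (G := G)) := by
  intro a b hab
  funext χ
  have := congrArg (fun u : Module.Dual ℝ (cocharSpace G) => u (charVec χ)) hab
  simpa [ofCoord_charVec] using this

lemma ofCoord_add (a b : (G →* ℂˣ) → ℤ) : ofCoord (a + b) = ofCoord a + ofCoord b := by
  refine LinearMap.ext fun v => ?_
  simp [ofCoord_apply, add_mul, Finset.sum_add_distrib]

lemma eq_sum_charVec (v : cocharSpace G) : v = ∑ χ, v χ • charVec χ := by
  classical
  funext ψ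
  simp [charVec, Pi.single_apply]

lemma mem_unitsLattice {v : cocharSpace G} :
    v ∈ unitsLattice G ↔ ∀ χ, ∃ m : ℤ, v χ = m := by
  classical
  constructor
  · intro hv χ
    exact (dualVec χ).2.1 v hv
  · intro h
    rw [eq_sum_charVec v]
    refine AddSubgroup.sum_mem _ fun χ _ => ?_
    obtain ⟨m, hm⟩ := h χ
    rw [hm, Int.cast_smul_eq_zsmul]
    exact AddSubgroup.zsmul_mem _ (AddSubgroup.subset_closure (Set.mem_range_self _)) m

lemma ofCoord_unitsLattice (a : (G →* ℂˣ) → ℤ) (v : cocharSpace G) (hv : v ∈ unitsLattice G) :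
    ∃ m : ℤ, ofCoord a v = m := by
  choose m hm using mem_unitsLattice.1 hv
  refine ⟨∑ χ, a χ * m χ, ?_⟩
  simp [ofCoord_apply, hm]

lemma eq_ofCoord (u : Module.Dual ℝ (cocharSpace G)) (a : (G →* ℂˣ) → ℤ)
    (h : ∀ χ, u (charVec χ) = a χ) : u = ofCoord a := by
  refine LinearMap.ext fun v => ?_
  rw [ofCoord_apply]
  conv_lhs => rw [eq_sum_charVec v]
  simp [h, mul_comm]

lemma exists_eq_ofCoord (u : Module.Dual ℝ (cocharSpace G))
    (h : ∀ v ∈ unitsLattice G, ∃ m : ℤ, u v = m) : ∃ a, u = ofCoord a := by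
  choose a ha using fun χ => h (charVec χ) (AddSubgroup.subset_closure (Set.mem_range_self _))
  exact ⟨a, eq_ofCoord u a ha⟩

/-- The restriction of `∑ a_χ χ` to `G`, a character of `G`. -/
def charWeight (a : (G →* ℂˣ) → ℤ) : G →* ℂˣ := ∏ χ : G →* ℂˣ, χ ^ a χ

lemma charWeight_apply (a : (G →* ℂˣ) → ℤ) (g : G) :
    charWeight a g = ∏ χ : G →* ℂˣ, χ g ^ a χ := by
  rw [charWeight, MonoidHom.finsetProd_apply]
  rfl

/-- The coordinates of `ω` are logarithms of the values `χ(g⁻¹)`, so pairing with `ω` is a logarithm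
of the weight at `g⁻¹`. -/
lemma exp_ofCoord_omegaVec (a : (G →* ℂˣ) → ℤ) (g : G) :
    Complex.exp (2 * Real.pi * Complex.I * (ofCoord a (omegaVec g) : ℝ)) = charWeight a g⁻¹ := by
  classical
  have h1 : ∀ χ, (omegaVec g : cocharSpace G) χ = angle (χ g⁻¹ : ℂˣ) := fun χ => by
    simp [omegaVec, charVec, Pi.single_apply]
  rw [ofCoord_apply, charWeight_apply, Complex.ofReal_sum, Finset.mul_sum, Complex.exp_sum,
    Units.coe_prod]
  refine Finset.prod_congr rfl fun χ _ => ?_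
  rw [h1, Units.val_zpow_eq_zpow_val, ← exp_angle (norm_char χ g⁻¹), ← Complex.exp_int_mul]
  congr 1
  rw [exp_angle (norm_char χ g⁻¹)]
  push_cast
  ring

lemma exp_eq_one_iff_int (x : ℝ) :
    Complex.exp (2 * Real.pi * Complex.I * (x : ℝ)) = 1 ↔ ∃ m : ℤ, x = m := by
  rw [Complex.exp_eq_one_iff]
  refine exists_congr fun m => ?_
  rw [mul_comm, mul_left_inj' Complex.two_pi_I_ne_zero]
  exact_mod_cast Iff.rfl

lemma ofCoord_omegaVec_int (a : (G →* ℂˣ) → ℤ) (g : G) :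
    (∃ m : ℤ, ofCoord a (omegaVec g) = m) ↔ charWeight a g = 1 := by
  rw [← exp_eq_one_iff_int, exp_ofCoord_omegaVec, map_inv, Units.val_eq_one, inv_eq_one]

variable {K : ℕ} {c : Fin K → G}

lemma charWeight_eq_one_iff
    (hc : Function.Bijective fun x : ∀ j, Subgroup.zpowers (c j) => ∏ j, (x j : G))
    (χ : G →* ℂˣ) : (∀ j, χ (c j) = 1) ↔ χ = 1 := by
  constructor
  · intro h
    refine MonoidHom.ext fun g => ?_
    obtain ⟨x, hx⟩ := hc.2 g
    rw [← hx]
    change χ (∏ j, (x j : G)) = 1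
    rw [map_prod]
    refine Finset.prod_eq_one fun j _ => ?_
    obtain ⟨m, hm⟩ := Subgroup.mem_zpowers_iff.1 (x j).2
    rw [← hm, map_zpow, h, one_zpow]
  · rintro rfl j
    rfl

/-- Integrality on `N_E'` is automatic, and integrality on `ω_j` means that the weight is trivial at
`c j`. Since the `c j` generate `G`, the lattice `M` is the kernel of the restriction `M' → G^∨`. -/
lemma ofCoord_torusLattice
    (hc : Function.Bijective fun x : ∀ j, Subgroup.zpowers (c j) => ∏ j, (x j : G))
    (a : (G →* ℂˣ) → ℤ) :
    (∀ v ∈ torusLattice c, ∃ m : ℤ, ofCoord a v = m) ↔ charWeight a = 1 := by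
  rw [← charWeight_eq_one_iff hc]
  constructor
  · intro h j
    rw [← ofCoord_omegaVec_int]
    exact h _ (AddSubgroup.mem_sup_right (AddSubgroup.subset_closure (Set.mem_range_self j)))
  · intro h v hv
    let S : AddSubgroup (cocharSpace G) :=
      (Int.castAddHom ℝ).range.comap (ofCoord a).toAddMonoidHom
    have hS : ∀ w, w ∈ S ↔ ∃ m : ℤ, ofCoord a w = m := fun w =>
      ⟨fun ⟨m, hm⟩ => ⟨m, hm.symm⟩, fun ⟨m, hm⟩ => ⟨m, hm.symm⟩⟩
    rw [← hS]
    refine (sup_le (fun w hw => (hS w).2 (ofCoord_unitsLattice a w hw))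
      ((AddSubgroup.closure_le _).2 ?_) : torusLattice c ≤ S) hv
    rintro _ ⟨j, rfl⟩
    exact (hS _).2 ((ofCoord_omegaVec_int a (c j)).2 (h j))

lemma exists_eq_ofCoord_torus
    (hc : Function.Bijective fun x : ∀ j, Subgroup.zpowers (c j) => ∏ j, (x j : G))
    (u : Module.Dual ℝ (cocharSpace G)) :
    (∀ v ∈ torusLattice c, ∃ m : ℤ, u v = m) ↔ ∃ a, u = ofCoord a ∧ charWeight a = 1 := by
  constructor
  · intro h
    obtain ⟨a, rfl⟩ := exists_eq_ofCoord u fun v hv => h v (AddSubgroup.mem_sup_left hv)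
    exact ⟨a, rfl, (ofCoord_torusLattice hc a).1 h⟩
  · rintro ⟨a, rfl, ha⟩
    exact (ofCoord_torusLattice hc a).2 ha

/-- The coordinates of a character of `𝒢_E`. -/
def coord (u : unitsChars G) : (G →* ℂˣ) → ℤ := (exists_eq_ofCoord u.1 u.2.1).choose

lemma ofCoord_coord (u : unitsChars G) : ofCoord (coord u) = u.1 :=
  (exists_eq_ofCoord u.1 u.2.1).choose_spec.symm

/-- The character of `𝒢_E` with given coordinates. -/
def unitsCharOf (a : (G →* ℂˣ) → ℤ) : unitsChars G :=
  ⟨ofCoord a, ofCoord_unitsLattice a, fun v hv => by rw [(Submodule.mem_bot _).1 hv, map_zero]⟩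

lemma coord_unitsCharOf (a : (G →* ℂˣ) → ℤ) : coord (unitsCharOf a) = a :=
  ofCoord_injective (ofCoord_coord _)

lemma unitsCharOf_coord (u : unitsChars G) : unitsCharOf (coord u) = u :=
  Subtype.ext (ofCoord_coord u)

lemma coord_add (u w : unitsChars G) : coord (u + w) = coord u + coord w :=
  ofCoord_injective (by rw [ofCoord_coord, ofCoord_add, ofCoord_coord, ofCoord_coord]; rfl)

variable (G) in
/-- The lattice `M'` is `ℤ^{G^∨}`. -/
def coordEquiv : unitsChars G ≃+ ((G →* ℂˣ) → ℤ) where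
  toFun := coord
  invFun := unitsCharOf
  left_inv := unitsCharOf_coord
  right_inv := coord_unitsCharOf
  map_add' := coord_add

lemma coordEquiv_apply (u : unitsChars G) : coordEquiv G u = coord u := rfl

lemma coord_eq {u : unitsChars G} {χ : G →* ℂˣ} {m : ℤ} (h : u.1 (charVec χ) = m) :
    coord u χ = m := by
  rw [← ofCoord_coord u, ofCoord_charVec] at h
  exact_mod_cast h

open Classical in
lemma coord_dualVec (χ ψ : G →* ℂˣ) :
    coord (dualVec χ) ψ = if χ = ψ then 1 else 0 := by
  apply coord_eq
  change (charVec ψ : cocharSpace G) χ = _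
  by_cases h : χ = ψ
  · subst h; simp [charVec]
  · simp [charVec, h]

lemma unitsChars_ext {u w : unitsChars G} (h : ∀ χ, coord u χ = coord w χ) : u = w :=
  (coordEquiv G).injective (funext h)

lemma coord_sum_nsmul (m : (G →* ℂˣ) → ℕ) (ψ : G →* ℂˣ) :
    coord (∑ χ, m χ • dualVec χ) ψ = m ψ := by
  classical
  rw [← coordEquiv_apply, map_sum]
  simp only [map_nsmul, coordEquiv_apply, Finset.sum_apply, Pi.smul_apply, coord_dualVec]
  simp

/-- Every element of `M'` is a difference of sums of elements of the basis. -/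
lemma exists_add_eq (u : unitsChars G) : ∃ m m' : (G →* ℂˣ) → ℕ,
    u + ∑ χ, m χ • dualVec χ = ∑ χ, m' χ • dualVec χ := by
  -- The truncated difference of the first two terms of `m` is zero, so `m` is the negative part and
  -- `m'` the positive part of the coordinates of `u`.
  refine ⟨fun χ => (coord u χ).toNat - (coord u χ).natAbs + (-coord u χ).toNat,
    fun χ => (coord u χ).toNat, unitsChars_ext fun χ => ?_⟩
  rw [coord_add, Pi.add_apply, coord_sum_nsmul, coord_sum_nsmul]
  omega

/-- Ring homomorphisms from `E[M']` are determined by their values on `E` and on a basis of `M'`. -/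
lemma unitsChars_ringHom_ext {E R : Type} [CommRing E] [CommRing R]
    {f g : AddMonoidAlgebra E (unitsChars G) →+* R}
    (h0 : ∀ a, f (.single 0 a) = g (.single 0 a))
    (h : ∀ χ, f (.single (dualVec χ) 1) = g (.single (dualVec χ) 1)) : f = g := by
  have hsum : ∀ m : (G →* ℂˣ) → ℕ, (AddMonoidAlgebra.single (∑ χ, m χ • dualVec χ) 1 :
      AddMonoidAlgebra E (unitsChars G)) = ∏ χ, .single (dualVec χ) 1 ^ m χ := fun m => by
    simp only [AddMonoidAlgebra.single_pow, one_pow]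
    rw [AddMonoidAlgebra.prod_single, Finset.prod_const_one]
  have hone : ∀ u, f (.single u 1) = g (.single u 1) := fun u => by
    obtain ⟨m, m', hm⟩ := exists_add_eq u
    have hu : IsUnit (AddMonoidAlgebra.single (∑ χ, m χ • dualVec χ) 1 :
        AddMonoidAlgebra E (unitsChars G)) := by
      refine IsUnit.of_mul_eq_one (.single ((coordEquiv G).symm (-coordEquiv G (∑ χ, m χ • dualVec χ))) 1) ?_
      rw [AddMonoidAlgebra.single_mul_single, mul_one]
      have : (∑ χ, m χ • dualVec χ) +
          (coordEquiv G).symm (-coordEquiv G (∑ χ, m χ • dualVec χ)) = 0 :=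
        (coordEquiv G).injective (by simp)
      rw [this]
      rfl
    apply (hu.map f).mul_left_injective
    have e1 : f (.single (∑ χ, m χ • dualVec χ) 1) = g (.single (∑ χ, m χ • dualVec χ) 1) := by
      rw [hsum, map_prod, map_prod]
      simp only [map_pow, h]
    have e2 : f (.single (∑ χ, m' χ • dualVec χ) 1) = g (.single (∑ χ, m' χ • dualVec χ) 1) := by
      rw [hsum, map_prod, map_prod]
      simp only [map_pow, h]
    dsimp only
    conv_rhs => rw [e1]
    rw [← map_mul, ← map_mul, AddMonoidAlgebra.single_mul_single, hm, mul_one, e2]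
  refine AddMonoidAlgebra.ringHom_ext h0 fun u => hone u

end Lattice

end QuotientToric

namespace QuotientToric

/-! ### The fan spanned by proper subsets of the rays. -/

section Fan

set_option linter.unusedSectionVars false

variable {G : Type} [CommGroup G] [Fintype G]

/-- The generators `v_0` (index `none`) and `v_χ` of the rays. -/
def ray (o : Option (G →* ℂˣ)) : cocharSpace G := o.elim (zeroVec G) charVec

/-- The vector `∑ b_o v_o`. -/
def rayComb (b : Option (G →* ℂˣ) → ℝ) : cocharSpace G := fun χ => b (some χ) - b none

lemma zeroVec_apply (χ : G →* ℂˣ) : zeroVec G χ = -1 := by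
  classical
  simp [zeroVec, charVec, Pi.single_apply]

lemma ray_mem_rayVecs (o : Option (G →* ℂˣ)) : ray o ∈ rayVecs G := by
  cases o with
  | none => exact Or.inl rfl
  | some χ => exact Or.inr ⟨χ, rfl⟩

lemma rayVecs_eq_range : rayVecs G = Set.range ray := by
  ext v
  constructor
  · rintro (rfl | ⟨χ, rfl⟩)
    · exact ⟨none, rfl⟩
    · exact ⟨some χ, rfl⟩
  · rintro ⟨o, rfl⟩
    exact ray_mem_rayVecs o

open Classical in
lemma ray_eq_rayComb (o : Option (G →* ℂˣ)) :
    ray o = rayComb fun o' => if o' = o then 1 else 0 := by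
  funext χ
  cases o with
  | none => simp [ray, rayComb, zeroVec_apply]
  | some ψ => simp [ray, rayComb, charVec, Pi.single_apply]

lemma rayComb_add (b b' : Option (G →* ℂˣ) → ℝ) :
    rayComb (b + b') = rayComb b + rayComb b' := by
  funext χ
  simp only [rayComb, Pi.add_apply]
  ring

lemma rayComb_smul (a : ℝ) (b : Option (G →* ℂˣ) → ℝ) :
    rayComb (a • b) = a • rayComb b := by
  funext χ
  simp only [rayComb, Pi.smul_apply, smul_eq_mul]
  ring

lemma rayComb_zero : rayComb (0 : Option (G →* ℂˣ) → ℝ) = 0 := by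
  funext χ
  simp [rayComb]

lemma rayComb_eq_sum (b : Option (G →* ℂˣ) → ℝ) : rayComb b = ∑ o, b o • ray o := by
  classical
  funext χ
  rw [Fintype.sum_option]
  simp [ray, rayComb, zeroVec_apply, charVec, Pi.single_apply]
  ring

/-- The only linear relation among the rays is `v_0 + ∑ v_χ = 0`, so `b - b'` is constant. Both
families are nonnegative and take the value zero, hence the constant is zero. All statements about
the cones rest on this uniqueness. -/
lemma rayComb_unique {b b' : Option (G →* ℂˣ) → ℝ} (hb : ∀ o, 0 ≤ b o) (hb' : ∀ o, 0 ≤ b' o)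
    (h0 : ∃ o, b o = 0) (h0' : ∃ o, b' o = 0) (h : rayComb b = rayComb b') : b = b' := by
  have h1 : ∀ o, b o - b' o = b none - b' none := fun o => by
    cases o with
    | none => rfl
    | some χ =>
      have := congrFun h χ
      simp only [rayComb] at this
      linarith
  obtain ⟨o, ho⟩ := h0
  obtain ⟨o', ho'⟩ := h0'
  have h2 := h1 o
  have h3 := h1 o'
  have h4 := hb' o
  have h5 := hb o'
  funext o''
  have h6 := h1 o''
  linarith

/-- The cone spanned by the rays with index in `J`. -/
def rayCone (J : Set (Option (G →* ℂˣ))) : PointedCone ℝ (cocharSpace G) :=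
  PointedCone.hull ℝ (ray '' J)

lemma mem_rayCone {J : Set (Option (G →* ℂˣ))} {v : cocharSpace G} : v ∈ rayCone J ↔
    ∃ b : Option (G →* ℂˣ) → ℝ, (∀ o, 0 ≤ b o) ∧ (∀ o, o ∉ J → b o = 0) ∧ v = rayComb b := by
  classical
  constructor
  · intro hv
    induction hv using Submodule.span_induction with
    | mem v hv =>
      obtain ⟨o, ho, rfl⟩ := hv
      refine ⟨_, fun o' => ?_, fun o' ho' => ?_, ray_eq_rayComb o⟩
      · split_ifs <;> norm_num
      · exact if_neg fun h : o' = o => ho' (h.symm ▸ ho)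
    | zero => exact ⟨0, fun _ => le_rfl, fun _ _ => rfl, rayComb_zero.symm⟩
    | add v w _ _ hv hw =>
      obtain ⟨b, hb, hJ, rfl⟩ := hv
      obtain ⟨b', hb', hJ', rfl⟩ := hw
      refine ⟨b + b', fun o => add_nonneg (hb o) (hb' o), fun o ho => ?_, (rayComb_add b b').symm⟩
      rw [Pi.add_apply, hJ o ho, hJ' o ho, add_zero]
    | smul a v _ hv =>
      obtain ⟨b, hb, hJ, rfl⟩ := hv
      refine ⟨(a : ℝ) • b, fun o => mul_nonneg a.2 (hb o), fun o ho => ?_, (rayComb_smul a b).symm⟩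
      rw [Pi.smul_apply, hJ o ho, smul_zero]
  · rintro ⟨b, hb, hJ, rfl⟩
    rw [rayComb_eq_sum]
    refine Submodule.sum_mem _ fun o _ => ?_
    by_cases ho : o ∈ J
    · exact Submodule.smul_mem _ (⟨b o, hb o⟩ : {x : ℝ // 0 ≤ x})
        (Submodule.subset_span ⟨o, ho, rfl⟩)
    · rw [hJ o ho, zero_smul]
      exact Submodule.zero_mem _

lemma ray_mem_rayCone {J : Set (Option (G →* ℂˣ))} {o : Option (G →* ℂˣ)} (h : o ∈ J) :
    ray o ∈ rayCone J := Submodule.subset_span ⟨o, h, rfl⟩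

lemma exists_eq_zero {J : Set (Option (G →* ℂˣ))} (hJ : J ≠ Set.univ)
    {b : Option (G →* ℂˣ) → ℝ} (h : ∀ o, o ∉ J → b o = 0) : ∃ o, b o = 0 := by
  obtain ⟨o, ho⟩ := (Set.ne_univ_iff_exists_notMem J).1 hJ
  exact ⟨o, h o ho⟩

lemma mem_of_ray_mem_rayCone {J : Set (Option (G →* ℂˣ))} (hJ : J ≠ Set.univ)
    {o : Option (G →* ℂˣ)} (h : ray o ∈ rayCone J) : o ∈ J := by
  classical
  obtain ⟨b, hb, hbJ, e⟩ := mem_rayCone.1 h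
  have h1 := rayComb_unique (b := fun o' => if o' = o then 1 else 0) (b' := b)
    (fun o' => by split_ifs <;> norm_num) hb
    (by
      cases o with
      | none => exact ⟨some 1, by simp⟩
      | some χ => exact ⟨none, by simp⟩)
    (exists_eq_zero hJ hbJ) (by rw [← ray_eq_rayComb, e])
  by_contra ho
  have := hbJ o ho
  rw [← h1] at this
  simp at this

lemma ray_injective : Function.Injective (ray (G := G)) := by
  intro o o' h
  have h1 : o ∈ ({o'} : Set (Option (G →* ℂˣ))) := by
    -- A single ray is a proper subset, because `v_0` and the vector of the trivial character are
    -- two different indices.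
    refine mem_of_ray_mem_rayCone (fun h' => ?_) (h ▸ ray_mem_rayCone rfl)
    have h2 : (none : Option (G →* ℂˣ)) ∈ ({o'} : Set _) := h' ▸ Set.mem_univ _
    have h3 : some (1 : G →* ℂˣ) ∈ ({o'} : Set _) := h' ▸ Set.mem_univ _
    rw [Set.mem_singleton_iff] at h2 h3
    exact Option.some_ne_none _ (h3.trans h2.symm)
  exact h1

lemma mem_fanCones {σ : PointedCone ℝ (cocharSpace G)} :
    σ ∈ fanCones G ↔ ∃ J : Set (Option (G →* ℂˣ)), J ≠ Set.univ ∧ σ = rayCone J := by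
  constructor
  · rintro ⟨I, hI, rfl⟩
    have h1 : ray '' (ray ⁻¹' I) = I := by
      rw [Set.image_preimage_eq_inter_range, ← rayVecs_eq_range,
        Set.inter_eq_left.2 hI.1]
    refine ⟨ray ⁻¹' I, fun h => hI.2 ?_, by rw [rayCone, h1]⟩
    rw [← h1, h, Set.image_univ, rayVecs_eq_range]
  · rintro ⟨J, hJ, rfl⟩
    refine ⟨ray '' J, ?_, rfl⟩
    rw [rayVecs_eq_range, ← Set.image_univ]
    exact ray_injective.image_strictMono (Set.ssubset_univ_iff.2 hJ)

/-- The indices of the rays of a cone. -/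
def coneRays (σ : PointedCone ℝ (cocharSpace G)) : Set (Option (G →* ℂˣ)) := {o | ray o ∈ σ}

lemma coneRays_rayCone {J : Set (Option (G →* ℂˣ))} (hJ : J ≠ Set.univ) :
    coneRays (rayCone J) = J :=
  Set.ext fun _ => ⟨mem_of_ray_mem_rayCone hJ, ray_mem_rayCone⟩

lemma rayCone_coneRays {σ : PointedCone ℝ (cocharSpace G)} (hσ : σ ∈ fanCones G) :
    rayCone (coneRays σ) = σ := by
  obtain ⟨J, hJ, rfl⟩ := mem_fanCones.1 hσ
  rw [coneRays_rayCone hJ]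

lemma coneRays_ne_univ {σ : PointedCone ℝ (cocharSpace G)} (hσ : σ ∈ fanCones G) :
    coneRays σ ≠ Set.univ := by
  obtain ⟨J, hJ, rfl⟩ := mem_fanCones.1 hσ
  rwa [coneRays_rayCone hJ]

lemma rayCone_mono {J J' : Set (Option (G →* ℂˣ))} (h : J ⊆ J') : rayCone J ≤ rayCone J' :=
  Submodule.span_mono (Set.image_mono h)

/-- By uniqueness, a common point has the same coefficients in both cones, so they are supported on
the common rays. -/
lemma rayCone_inf {J J' : Set (Option (G →* ℂˣ))} (hJ : J ≠ Set.univ) (hJ' : J' ≠ Set.univ) :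
    rayCone J ⊓ rayCone J' = rayCone (J ∩ J') := by
  refine le_antisymm ?_ (le_inf (rayCone_mono Set.inter_subset_left)
    (rayCone_mono Set.inter_subset_right))
  rintro v ⟨h, h'⟩
  obtain ⟨b, hb, hbJ, rfl⟩ := mem_rayCone.1 h
  obtain ⟨b', hb', hbJ', e⟩ := mem_rayCone.1 h'
  obtain rfl := rayComb_unique hb hb' (exists_eq_zero hJ hbJ) (exists_eq_zero hJ' hbJ') e
  refine mem_rayCone.2 ⟨b, hb, fun o ho => ?_, rfl⟩
  by_cases h1 : o ∈ J
  · exact hbJ' o fun h2 => ho ⟨h1, h2⟩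
  · exact hbJ o h1

/-- The coefficients of `a x + y` are sums of nonnegative terms, so where they vanish those of `x`
vanish too, as `a > 0`. -/
lemma rayCone_isFaceOf {J J' : Set (Option (G →* ℂˣ))} (hJ : J ≠ Set.univ) (h : J' ⊆ J) :
    (rayCone J').IsFaceOf (rayCone J) where
  le := rayCone_mono h
  mem_of_smul_add_mem {x y a} hx hy ha hxy := by
    obtain ⟨b, hb, hbJ, rfl⟩ := mem_rayCone.1 hx
    obtain ⟨b', hb', hbJ', rfl⟩ := mem_rayCone.1 hy
    obtain ⟨d, hd, hdJ, e⟩ := mem_rayCone.1 hxy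
    rw [← rayComb_smul, ← rayComb_add] at e
    have hnn : ∀ o, 0 ≤ (a • b) o := fun o => mul_nonneg ha.le (hb o)
    have e1 := rayComb_unique (b := a • b + b') (fun o => add_nonneg (hnn o) (hb' o)) hd
      (exists_eq_zero hJ fun o ho => by
        rw [Pi.add_apply, Pi.smul_apply, hbJ o ho, hbJ' o ho, smul_zero, add_zero])
      (exists_eq_zero hJ fun o ho => hdJ o fun h' => ho (h h')) e
    refine mem_rayCone.2 ⟨b, hb, fun o ho => ?_, rfl⟩
    have h1 := congrFun e1 o
    rw [hdJ o ho, Pi.add_apply] at h1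
    have h2 : a * b o = 0 := le_antisymm (by
      have := hb' o
      change a * b o + b' o = 0 at h1
      linarith) (hnn o)
    exact (mul_eq_zero.1 h2).resolve_left ha.ne'

/-- If a point of `τ` has a positive coefficient at a ray, it is that multiple of the ray plus a
point of the cone, and the defining property of a face puts the ray in `τ`. -/
lemma eq_rayCone_of_isFaceOf {J : Set (Option (G →* ℂˣ))} {τ : PointedCone ℝ (cocharSpace G)}
    (h : τ.IsFaceOf (rayCone J)) : τ = rayCone (J ∩ coneRays τ) := by
  apply le_antisymm
  · intro v hv
    obtain ⟨b, hb, hbJ, rfl⟩ := mem_rayCone.1 (h.le hv)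
    refine mem_rayCone.2 ⟨b, hb, fun o ho => ?_, rfl⟩
    by_contra hbo
    refine ho ⟨not_not.1 fun h' => hbo (hbJ o h'), ?_⟩
    have hpos : 0 < b o := lt_of_le_of_ne (hb o) (Ne.symm hbo)
    classical
    refine h.mem_of_smul_add_mem (y := rayComb (Function.update b o 0)) (a := b o) ?_ ?_ hpos ?_
    · exact ray_mem_rayCone (not_not.1 fun h' => hbo (hbJ o h'))
    · refine mem_rayCone.2 ⟨_, fun o' => ?_, fun o' ho' => ?_, rfl⟩
      · by_cases h1 : o' = o
        · rw [h1, Function.update_self]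
        · rw [Function.update_of_ne h1]
          exact hb o'
      · by_cases h1 : o' = o
        · rw [h1, Function.update_self]
        · rw [Function.update_of_ne h1]
          exact hbJ o' ho'
    · convert hv using 1
      rw [ray_eq_rayComb, ← rayComb_smul, ← rayComb_add]
      congr 1
      funext o'
      by_cases h1 : o' = o
      · subst h1
        simp
      · simp [h1]
  · refine Submodule.span_le.2 ?_
    rintro _ ⟨o, ⟨-, ho⟩, rfl⟩
    exact ho

lemma charVec_mem_torusLattice {K : ℕ} (c : Fin K → G) (χ : G →* ℂˣ) :
    charVec χ ∈ torusLattice c :=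
  AddSubgroup.mem_sup_left (AddSubgroup.subset_closure (Set.mem_range_self χ))

lemma ray_mem_torusLattice {K : ℕ} (c : Fin K → G) (o : Option (G →* ℂˣ)) :
    ray o ∈ torusLattice c := by
  cases o with
  | none =>
    exact AddSubgroup.neg_mem _ (AddSubgroup.sum_mem _ fun χ _ => charVec_mem_torusLattice c χ)
  | some χ => exact charVec_mem_torusLattice c χ

theorem quotientDatum_isFan {K : ℕ} (c : Fin K → G) : (quotientDatum c).IsFan where
  finite := by
    refine (Set.finite_range (rayCone (G := G))).subset fun σ hσ => ?_
    obtain ⟨J, -, rfl⟩ := mem_fanCones.1 hσ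
    exact ⟨J, rfl⟩
  rational σ hσ := by
    classical
    obtain ⟨J, -, rfl⟩ := mem_fanCones.1 hσ
    refine ⟨(Set.toFinite (ray '' J)).toFinset, ?_, ?_⟩
    · rw [Set.Finite.coe_toFinset]
      rintro _ ⟨o, -, rfl⟩
      exact ray_mem_torusLattice c o
    · rw [Set.Finite.coe_toFinset]
      rfl
  salient σ hσ v hv hv' := by
    obtain ⟨J, hJ, rfl⟩ := mem_fanCones.1 hσ
    obtain ⟨b, hb, hbJ, rfl⟩ := mem_rayCone.1 hv
    obtain ⟨b', hb', hbJ', e⟩ := mem_rayCone.1 hv'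
    have h1 : rayComb (b + b') = rayComb 0 := by
      rw [rayComb_add, ← e, add_neg_cancel, rayComb_zero]
    have h2 := rayComb_unique (fun o => add_nonneg (hb o) (hb' o)) (fun _ => le_rfl)
      (exists_eq_zero hJ fun o ho => by
        rw [hbJ o ho, hbJ' o ho, add_zero]) ⟨none, rfl⟩ h1
    have h3 : b = 0 := funext fun o => by
      have h4 := congrFun h2 o
      have h5 := hb o
      have h6 := hb' o
      simp only [Pi.zero_apply] at h4 ⊢
      linarith
    rw [h3, rayComb_zero]
  face σ hσ τ hτ := by
    obtain ⟨J, hJ, rfl⟩ := mem_fanCones.1 hσ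
    refine mem_fanCones.2 ⟨_, fun h => hJ ?_, eq_rayCone_of_isFaceOf hτ⟩
    exact Set.univ_subset_iff.1 (h ▸ Set.inter_subset_left)
  inter σ hσ τ hτ := by
    obtain ⟨J, hJ, rfl⟩ := mem_fanCones.1 hσ
    obtain ⟨J', hJ', rfl⟩ := mem_fanCones.1 hτ
    rw [rayCone_inf hJ hJ']
    exact rayCone_isFaceOf hJ Set.inter_subset_left

/-- The value of the linear form with coordinates `a` on a ray. -/
def rayPair (a : (G →* ℂˣ) → ℤ) (o : Option (G →* ℂˣ)) : ℤ := o.elim (-∑ χ, a χ) a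

lemma ofCoord_ray (a : (G →* ℂˣ) → ℤ) (o : Option (G →* ℂˣ)) :
    ofCoord a (ray o) = rayPair a o := by
  cases o with
  | none => simp [ray, rayPair, ofCoord_apply, zeroVec_apply]
  | some χ => exact ofCoord_charVec a χ

lemma nonneg_on_cone_iff {σ : PointedCone ℝ (cocharSpace G)} (hσ : σ ∈ fanCones G)
    (u : Module.Dual ℝ (cocharSpace G)) :
    (∀ v ∈ σ, 0 ≤ u v) ↔ ∀ o ∈ coneRays σ, 0 ≤ u (ray o) := by
  refine ⟨fun h o ho => h _ ho, fun h v hv => ?_⟩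
  rw [← rayCone_coneRays hσ] at hv
  obtain ⟨b, hb, hbJ, rfl⟩ := mem_rayCone.1 hv
  rw [rayComb_eq_sum, map_sum]
  refine Finset.sum_nonneg fun o _ => ?_
  rw [map_smul]
  by_cases ho : o ∈ coneRays σ
  · exact mul_nonneg (hb o) (h o ho)
  · rw [hbJ o ho, zero_smul]

/-- Description of `σ^∨ ∩ M`. -/
lemma mem_dualMonoid_iff {K : ℕ} {c : Fin K → G}
    (hc : Function.Bijective fun x : ∀ j, Subgroup.zpowers (c j) => ∏ j, (x j : G))
    {σ : PointedCone ℝ (cocharSpace G)} (hσ : σ ∈ fanCones G)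
    (u : Module.Dual ℝ (cocharSpace G)) : u ∈ dualMonoid (quotientDatum c).lattice σ ↔
      ∃ a, u = ofCoord a ∧ charWeight a = 1 ∧ ∀ o ∈ coneRays σ, 0 ≤ rayPair a o := by
  change ((∀ v ∈ torusLattice c, ∃ m : ℤ, u v = m) ∧ ∀ v ∈ σ, 0 ≤ u v) ↔ _
  rw [exists_eq_ofCoord_torus hc, nonneg_on_cone_iff hσ]
  constructor
  · rintro ⟨⟨a, rfl, ha⟩, h⟩
    refine ⟨a, rfl, ha, fun o ho => ?_⟩
    have := h o ho
    rw [ofCoord_ray] at this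
    exact_mod_cast this
  · rintro ⟨a, rfl, ha, h⟩
    refine ⟨⟨a, rfl, ha⟩, fun o ho => ?_⟩
    rw [ofCoord_ray]
    exact_mod_cast h o ho

end Fan

end QuotientToric

namespace QuotientToric

/-! ### Monomials as characters, and degree-zero fractions inside `E[M']`. -/

section MonomialEval

set_option linter.unusedSectionVars false

variable {G : Type} [CommGroup G] [Fintype G]

open HomogeneousLocalization

variable (G) in
/-- The exponents `(m_χ)` of a monomial as an element of `M'`. -/
def expVec : (Option (G →* ℂˣ) →₀ ℕ) →+ unitsChars G where
  toFun m := unitsCharOf fun χ => m (some χ)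
  map_zero' := (coordEquiv G).injective ((coord_unitsCharOf _).trans (map_zero (coordEquiv G)).symm)
  map_add' m m' := (coordEquiv G).injective (by
    rw [map_add]
    simp only [coordEquiv_apply, coord_unitsCharOf]
    funext χ
    simp)

lemma coord_expVec (m : Option (G →* ℂˣ) →₀ ℕ) (χ : G →* ℂˣ) :
    coord (expVec G m) χ = m (some χ) :=
  congrFun (coord_unitsCharOf _) χ

variable (G) in
/-- The homomorphism `E[Y, Z_χ] → E[M']`, `Y ↦ 1`, `Z_χ ↦ e^{v_χ^∨}`. -/
def toricEval : CharPoly G →+* AddMonoidAlgebra (charField G) (unitsChars G) :=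
  AddMonoidAlgebra.mapDomainRingHom (charField G) (expVec G)

lemma toricEval_monomial (m : Option (G →* ℂˣ) →₀ ℕ) (a : charField G) :
    toricEval G (MvPolynomial.monomial m a) = .single (expVec G m) a :=
  AddMonoidAlgebra.mapDomain_single

lemma toricEval_X (χ : G →* ℂˣ) :
    toricEval G (MvPolynomial.X (some χ)) = .single (dualVec χ) 1 := by
  classical
  refine (toricEval_monomial _ _).trans ?_
  congr 1
  refine unitsChars_ext fun ψ => ?_
  rw [coord_expVec, coord_dualVec, Finsupp.single_apply]
  simp

lemma toricEval_X_none : toricEval G (MvPolynomial.X none) = 1 := by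
  refine (toricEval_monomial _ _).trans ?_
  have : expVec G (Finsupp.single none 1) = 0 := by
    refine unitsChars_ext fun ψ => ?_
    rw [coord_expVec, ← coordEquiv_apply, map_zero, Finsupp.single_apply]
    simp
  rw [this]
  rfl

lemma toricEval_C (a : charField G) : toricEval G (MvPolynomial.C a) = .single 0 a := by
  refine (toricEval_monomial 0 a).trans ?_
  rw [map_zero]

lemma exists_of_coeff_toricEval_ne_zero {p : CharPoly G} {u : unitsChars G}
    (h : (toricEval G p).coeff u ≠ 0) : ∃ m, MvPolynomial.coeff m p ≠ 0 ∧ expVec G m = u := by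
  classical
  have h1 : u ∈ (Finsupp.mapDomain (expVec G) (AddMonoidAlgebra.coeff p)).support := Finsupp.mem_support_iff.2 h
  obtain ⟨m, hm, rfl⟩ := Finset.mem_image.1 (Finsupp.mapDomain_support h1)
  exact ⟨m, Finsupp.mem_support_iff.1 hm, rfl⟩

/-- Setting `Y = 1` forgets the exponent of `Y`, but the total degree restores it. -/
lemma expVec_injOn (d : ℕ) : Set.InjOn (expVec G) {m | m.degree = d} := by
  intro m hm m' hm' h
  have h1 : ∀ χ, m (some χ) = m' (some χ) := fun χ => by
    have := congrArg (fun u => coord u χ) h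
    simp only [coord_expVec] at this
    exact_mod_cast this
  have h2 : m.degree = m'.degree := hm.trans hm'.symm
  rw [Finsupp.degree_eq_sum, Finsupp.degree_eq_sum, Fintype.sum_option, Fintype.sum_option] at h2
  simp only [h1, add_left_inj] at h2
  ext o
  cases o with
  | none => exact h2
  | some χ => exact h1 χ

lemma degree_of_coeff_ne_zero {σ R : Type} [CommRing R] {p : MvPolynomial σ R} {d : ℕ}
    (hp : p.IsHomogeneous d) {m : σ →₀ ℕ} (hm : MvPolynomial.coeff m p ≠ 0) : m.degree = d := by
  have := hp hm
  rwa [Finsupp.degree_eq_weight_one]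

lemma toricEval_injective {d : ℕ} {p : CharPoly G} (hp : p ∈ charGrading G d)
    (h : toricEval G p = 0) : p = 0 := by
  have h1 := Finsupp.mapDomain_injOn (M := charField G)
    {m : Option (G →* ℂˣ) →₀ ℕ | m.degree = d} (expVec_injOn (G := G) d)
    (x₁ := AddMonoidAlgebra.coeff p) (x₂ := 0)
    (fun m hm => degree_of_coeff_ne_zero (p := p) hp (Finsupp.mem_support_iff.1 hm))
    (by simp) (by
      rw [Finsupp.mapDomain_zero]
      exact congrArg AddMonoidAlgebra.coeff h)
  exact AddMonoidAlgebra.coeff_injective h1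

/-- The character by which `G` acts on a monomial. -/
def monoWeight (m : Option (G →* ℂˣ) →₀ ℕ) : G →* ℂˣ := charWeight fun χ => m (some χ)

lemma charVal_charWeight (m : Option (G →* ℂˣ) →₀ ℕ) (h : G) :
    charVal (monoWeight m) h = ∏ χ : G →* ℂˣ, charVal χ h ^ m (some χ) := by
  refine Subtype.ext ?_
  change ((charWeight _ h : ℂˣ) : ℂ) = _
  rw [charWeight_apply, Units.coe_prod]
  have := map_prod (charField G).val (fun χ : G →* ℂˣ => charVal χ h ^ m (some χ)) Finset.univ
  refine Eq.trans ?_ this.symm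
  refine Finset.prod_congr rfl fun χ _ => ?_
  rw [map_pow]
  simp
  rfl

lemma charScale_monomial (h : G) (m : Option (G →* ℂˣ) →₀ ℕ) (a : charField G) :
    charScale h (MvPolynomial.monomial m a) =
      MvPolynomial.monomial m (charVal (monoWeight m) h * a) := by
  rw [charScale_apply, charScaleHom, MvPolynomial.aeval_monomial, MvPolynomial.monomial_eq,
    Finsupp.prod_fintype _ _ (fun _ => pow_zero _), Finsupp.prod_fintype _ _ (fun _ => pow_zero _),
    Fintype.prod_option, Fintype.prod_option, charVal_charWeight]
  simp only [Option.elim_none, Option.elim_some, mul_pow, Finset.prod_mul_distrib,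
    MvPolynomial.algebraMap_eq, MvPolynomial.C_mul, map_prod, MvPolynomial.C_pow]
  ring

lemma coeff_charScale (h : G) (p : CharPoly G) (m : Option (G →* ℂˣ) →₀ ℕ) :
    MvPolynomial.coeff m (charScale h p) = charVal (monoWeight m) h * MvPolynomial.coeff m p := by
  classical
  induction p using MvPolynomial.induction_on' with
  | monomial m' a =>
    rw [charScale_monomial, MvPolynomial.coeff_monomial, MvPolynomial.coeff_monomial]
    split_ifs with h1
    · rw [h1]
    · rw [mul_zero]
  | add p q hp hq => rw [map_add, MvPolynomial.coeff_add, hp, hq, MvPolynomial.coeff_add, mul_add]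

lemma charVal_eq_one {χ : G →* ℂˣ} (h : ∀ g, charVal χ g = 1) : χ = 1 :=
  MonoidHom.ext fun g => Units.ext (congrArg Subtype.val (h g))

/-- The action scales the coefficient of a monomial by the weight of the monomial, so in an
invariant polynomial only monomials of trivial weight survive. -/
lemma monoWeight_eq_one {p : CharPoly G} (hp : p ∈ invSubring (charAction G))
    {m : Option (G →* ℂˣ) →₀ ℕ} (hm : MvPolynomial.coeff m p ≠ 0) : monoWeight m = 1 := by
  refine charVal_eq_one fun h => ?_
  have h1 := coeff_charScale h p m
  rw [← charAction_apply, hp h] at h1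
  exact mul_right_cancel₀ hm (by rw [← h1, one_mul])

lemma monomial_mem_invSubring {m : Option (G →* ℂˣ) →₀ ℕ} (hm : monoWeight m = 1)
    (a : charField G) : MvPolynomial.monomial m a ∈ invSubring (charAction G) := fun h => by
  rw [charAction_apply, charScale_monomial, hm]
  congr 1
  exact one_mul a

variable (G) in
/-- The grading of the ring of invariants `E[Y, Z_χ]^G`. -/
abbrev charInvGrading : ℕ → AddSubgroup (invSubring (charAction G)) := invGrading (charAction G)

variable (G) in
/-- The homomorphism `E[Y, Z_χ]^G → E[M']`. -/
def invEval : invSubring (charAction G) →+* AddMonoidAlgebra (charField G) (unitsChars G) :=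
  (toricEval G).comp (invSubring (charAction G)).subtype

lemma invEval_injective (d : ℕ) (a : invSubring (charAction G)) (ha : a ∈ charInvGrading G d)
    (h : invEval G a = 0) : a = 0 :=
  Subtype.ext (toricEval_injective ha h)

open Classical in
/-- The exponents of `∏ Z_o ^ n` over the complement of `J`. -/
def faceExp (J : Set (Option (G →* ℂˣ))) : Option (G →* ℂˣ) →₀ ℕ :=
  Finsupp.equivFunOnFinite.symm fun o => if o ∈ J then 0 else Fintype.card G

open Classical in
lemma faceExp_apply (J : Set (Option (G →* ℂˣ))) (o : Option (G →* ℂˣ)) :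
    faceExp J o = if o ∈ J then 0 else Fintype.card G := rfl

lemma charWeight_add_smul (k : ℤ) (a b : (G →* ℂˣ) → ℤ) (hb : charWeight b = 1) :
    charWeight (a + k • b) = charWeight a := by
  refine MonoidHom.ext fun g => ?_
  have h := DFunLike.congr_fun hb g
  rw [charWeight_apply] at h
  rw [charWeight_apply, charWeight_apply]
  simp only [Pi.add_apply, Pi.smul_apply, smul_eq_mul, mul_comm k, zpow_add, zpow_mul,
    Finset.prod_mul_distrib, Finset.prod_zpow, h]
  rw [MonoidHom.one_apply, one_zpow, mul_one]

/-- Every character of `G` has trivial power of order the cardinality of `G`; this is why the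
denominators are made of `n`-th powers of the variables. -/
lemma monoWeight_faceExp (J : Set (Option (G →* ℂˣ))) : monoWeight (faceExp J) = 1 := by
  refine MonoidHom.ext fun g => (charWeight_apply _ g).trans (Finset.prod_eq_one fun χ _ => ?_)
  rw [faceExp_apply]
  split_ifs
  · exact zpow_zero _
  · rw [zpow_natCast, ← map_pow, pow_card_eq_one, map_one]

/-- The monomial `∏ Z_o ^ n` over the complement of `J`. -/
def faceMono (J : Set (Option (G →* ℂˣ))) : invSubring (charAction G) :=
  ⟨MvPolynomial.monomial (faceExp J) 1, monomial_mem_invSubring (monoWeight_faceExp J) 1⟩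

lemma faceMono_mem (J : Set (Option (G →* ℂˣ))) :
    faceMono J ∈ charInvGrading G (faceExp J).degree :=
  MvPolynomial.isHomogeneous_monomial _ rfl

lemma faceExp_degree_pos {J : Set (Option (G →* ℂˣ))} (hJ : J ≠ Set.univ) :
    0 < (faceExp J).degree := by
  obtain ⟨o, ho⟩ := (Set.ne_univ_iff_exists_notMem J).1 hJ
  rw [Nat.pos_iff_ne_zero, Ne, Finsupp.degree_eq_zero_iff]
  intro h
  have := DFunLike.congr_fun h o
  rw [faceExp_apply, if_neg ho] at this
  exact Fintype.card_ne_zero this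

/-- The complement of `J'` is the disjoint union of the complement of `J` and of `J \ J'`, the
complement of `J' ∪ Jᶜ`. -/
lemma faceMono_mul {J J' : Set (Option (G →* ℂˣ))} (h : J' ⊆ J) :
    faceMono J' = faceMono J * faceMono (J' ∪ Jᶜ) := by
  refine Subtype.ext ?_
  change MvPolynomial.monomial _ _ = MvPolynomial.monomial _ _ * MvPolynomial.monomial _ _
  rw [MvPolynomial.monomial_mul, one_mul]
  refine congrArg (fun m => MvPolynomial.monomial m 1) (Finsupp.ext fun o => ?_)
  rw [Finsupp.add_apply, faceExp_apply, faceExp_apply, faceExp_apply]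
  by_cases h1 : o ∈ J'
  · simp [h1, h h1]
  · by_cases h2 : o ∈ J <;> simp [h1, h2]

lemma invEval_faceMono (J : Set (Option (G →* ℂˣ))) :
    invEval G (faceMono J) = .single (expVec G (faceExp J)) 1 := toricEval_monomial _ _

lemma isUnit_single (u : unitsChars G) :
    IsUnit (AddMonoidAlgebra.single u 1 : AddMonoidAlgebra (charField G) (unitsChars G)) := by
  refine IsUnit.of_mul_eq_one (.single ((coordEquiv G).symm (-coordEquiv G u)) 1) ?_
  rw [AddMonoidAlgebra.single_mul_single, mul_one]
  have : u + (coordEquiv G).symm (-coordEquiv G u) = 0 := (coordEquiv G).injective (by simp)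
  rw [this]
  rfl

lemma isUnit_invEval_faceMono (J : Set (Option (G →* ℂˣ))) : IsUnit (invEval G (faceMono J)) := by
  rw [invEval_faceMono]
  exact isUnit_single _

/-- The functions on the open set `∏ Z_o ≠ 0` over the complement of `J`, as elements of `E[M']`. -/
def faceEval (J : Set (Option (G →* ℂˣ))) :
    Away (charInvGrading G) (faceMono J) →+* AddMonoidAlgebra (charField G) (unitsChars G) :=
  evalAway (charInvGrading G) (invEval G) (isUnit_invEval_faceMono J)

lemma faceEval_injective (J : Set (Option (G →* ℂˣ))) : Function.Injective (faceEval J) :=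
  evalAway_injective _ _ (faceMono_mem J) invEval_injective

lemma sum_rayPair (a : (G →* ℂˣ) → ℤ) : ∑ o, rayPair a o = 0 := by
  rw [Fintype.sum_option]
  simp [rayPair]

/-- A Laurent monomial of degree zero is determined by its exponents at the `Z_χ`, and then its
exponent at every variable, `Y` included, is the pairing with the corresponding ray. -/
lemma rayPair_of_sum_eq_zero {b : Option (G →* ℂˣ) → ℤ} (hb : ∑ o, b o = 0)
    (o : Option (G →* ℂˣ)) : rayPair (fun χ => b (some χ)) o = b o := by
  cases o with
  | none =>
    rw [Fintype.sum_option] at hb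
    simp only [rayPair, Option.elim_none]
    linarith
  | some χ => rfl

/-- The exponents occurring in functions on the open set `∏ Z_o ≠ 0`. -/
lemma faceEval_coeff (J : Set (Option (G →* ℂˣ))) (x : Away (charInvGrading G) (faceMono J))
    (u : unitsChars G) (hu : (faceEval J x).coeff u ≠ 0) :
    charWeight (coord u) = 1 ∧ ∀ o ∈ J, 0 ≤ rayPair (coord u) o := by
  obtain ⟨k, a, ha, rfl⟩ := Away.mk_surjective _ (faceMono_mem J) x
  have h1 := evalAway_mk (invEval G) (isUnit_invEval_faceMono J) (faceMono_mem J) k a ha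
  rw [invEval_faceMono, AddMonoidAlgebra.single_pow, one_pow] at h1
  -- The coefficient of the fraction at `u` is that of its numerator at `u` shifted by the exponent
  -- of the denominator.
  have h2 := congrArg (fun z => AddMonoidAlgebra.coeff z (u + k • expVec G (faceExp J))) h1
  rw [AddMonoidAlgebra.coeff_mul_single_eq_coeff_mul (m₂ := u) (H := fun m' _ => ⟨fun h =>
    (coordEquiv G).injective (add_right_cancel (b := coordEquiv G (k • expVec G (faceExp J))) (by
      rw [← map_add, ← map_add, h])), fun h => by rw [h]⟩), mul_one] at h2
  have h3 : (toricEval G (a : CharPoly G)).coeff (u + k • expVec G (faceExp J)) ≠ 0 :=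
    fun h => hu (h2.trans h)
  obtain ⟨m, hm, e⟩ := exists_of_coeff_toricEval_ne_zero h3
  have h4 : ∀ χ, coord u χ = (m (some χ) : ℤ) - k * faceExp J (some χ) := fun χ => by
    have := congrArg (fun w => coord w χ) e
    rw [← map_nsmul] at this
    simp only [coord_add, Pi.add_apply, coord_expVec, Finsupp.smul_apply, smul_eq_mul] at this
    push_cast at this
    linarith
  -- Numerator and denominator have the same degree, so the exponents of the quotient sum to zero;
  -- this recovers the exponent of `Y`.
  have hdeg : ∑ o, ((m o : ℤ) - k * faceExp J o) = 0 := by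
    have h5 : m.degree = k • (faceExp J).degree := degree_of_coeff_ne_zero ha hm
    rw [Finsupp.degree_eq_sum, Finsupp.degree_eq_sum, smul_eq_mul] at h5
    rw [Finset.sum_sub_distrib, ← Finset.mul_sum]
    exact sub_eq_zero.2 (by exact_mod_cast h5)
  have h6 : coord u = fun χ => (m (some χ) : ℤ) - k * faceExp J (some χ) := funext h4
  constructor
  · have h7 := monoWeight_eq_one a.2 hm
    have h8 : (fun χ => (m (some χ) : ℤ)) = coord u + (k : ℤ) • fun χ => (faceExp J (some χ) : ℤ) := by
      funext χ
      rw [h6]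
      simp
    rwa [monoWeight, h8, charWeight_add_smul _ _ _ (monoWeight_faceExp J)] at h7
  · intro o ho
    rw [h6, rayPair_of_sum_eq_zero (b := fun o => (m o : ℤ) - k * faceExp J o) hdeg o]
    rw [faceExp_apply, if_pos ho]
    simp

/-- Conversely to `faceEval_coeff`, negative exponents of `e^u` occur only off `J`, where a large
power of the denominator clears them. -/
lemma exists_faceEval (J : Set (Option (G →* ℂˣ))) (u : unitsChars G) (a : charField G)
    (hw : charWeight (coord u) = 1) (hu : ∀ o ∈ J, 0 ≤ rayPair (coord u) o) :
    ∃ x, faceEval J x = .single u a := by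
  classical
  -- This `k` bounds every `|⟨u, v_o⟩|`, and the `k`-th power of the denominator raises each
  -- exponent off `J` by `k n ≥ k`.
  set k : ℕ := ∑ o, (rayPair (coord u) o).natAbs with hk
  have h1 : ∀ o, 0 ≤ rayPair (coord u) o + k * faceExp J o := fun o => by
    rw [faceExp_apply]
    split_ifs with ho
    · simpa using hu o ho
    · have h2 : (rayPair (coord u) o).natAbs ≤ k :=
        Finset.single_le_sum (f := fun o => (rayPair (coord u) o).natAbs)
          (fun _ _ => Nat.zero_le _) (Finset.mem_univ o)
      have h3 : (1 : ℤ) ≤ Fintype.card G := by exact_mod_cast Fintype.card_pos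
      have h4 : (k : ℤ) * 1 ≤ k * Fintype.card G := by gcongr
      omega
  choose m hm using fun o => Int.eq_ofNat_of_zero_le (h1 o)
  let m' : Option (G →* ℂˣ) →₀ ℕ := Finsupp.equivFunOnFinite.symm m
  have hm' : ∀ o, (m' o : ℤ) = rayPair (coord u) o + k * faceExp J o := fun o => (hm o).symm
  have hdeg : m'.degree = k • (faceExp J).degree := by
    have : (m'.degree : ℤ) = k * (faceExp J).degree := by
      rw [Finsupp.degree_eq_sum, Finsupp.degree_eq_sum]
      push_cast
      simp only [hm', Finset.sum_add_distrib, sum_rayPair, Finset.mul_sum, zero_add]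
    exact_mod_cast this
  have hexp : expVec G m' = u + k • expVec G (faceExp J) := by
    rw [← map_nsmul]
    refine unitsChars_ext fun χ => ?_
    rw [coord_expVec, hm', coord_add, Pi.add_apply, coord_expVec, Finsupp.smul_apply]
    simp [rayPair]
  have hmw : monoWeight m' = 1 := by
    have h8 : (fun χ => (m' (some χ) : ℤ)) =
        coord u + (k : ℤ) • fun χ => (faceExp J (some χ) : ℤ) := by
      funext χ
      rw [hm']
      simp [rayPair]
    rw [monoWeight, h8, charWeight_add_smul _ _ _ (monoWeight_faceExp J), hw]
  refine ⟨Away.mk (charInvGrading G) (faceMono_mem J) k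
    ⟨MvPolynomial.monomial m' a, monomial_mem_invSubring hmw a⟩
    (MvPolynomial.isHomogeneous_monomial _ hdeg), ?_⟩
  apply ((isUnit_invEval_faceMono J).pow k).mul_left_injective
  dsimp only
  refine (evalAway_mk (invEval G) (isUnit_invEval_faceMono J) (faceMono_mem J) k _ _).trans ?_
  rw [invEval_faceMono, AddMonoidAlgebra.single_pow, one_pow, AddMonoidAlgebra.single_mul_single,
    mul_one, ← hexp]
  exact toricEval_monomial _ _

end MonomialEval

end QuotientToric

namespace QuotientToric

/-! ### Comparing rings through their images in a common ring. -/

section RangeEquiv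

variable {R S T : Type} [CommRing R] [CommRing S] [CommRing T]

/-- Two injective homomorphisms with the same range have isomorphic sources. -/
def equivOfRangeEq (f : R →+* T) (g : S →+* T) (hf : Function.Injective f)
    (hg : Function.Injective g) (h : f.range = g.range) : R ≃+* S :=
  (RingEquiv.ofBijective f.rangeRestrict ⟨fun _ _ hxy => hf (congrArg Subtype.val hxy),
    f.rangeRestrict_surjective⟩).trans ((RingEquiv.subringCongr h).trans
  (RingEquiv.ofBijective g.rangeRestrict ⟨fun _ _ hxy => hg (congrArg Subtype.val hxy),
    g.rangeRestrict_surjective⟩).symm)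

lemma equivOfRangeEq_apply (f : R →+* T) (g : S →+* T) (hf : Function.Injective f)
    (hg : Function.Injective g) (h : f.range = g.range) (x : R) :
    g (equivOfRangeEq f g hf hg h x) = f x := by
  have := RingEquiv.apply_symm_apply (RingEquiv.ofBijective g.rangeRestrict
    ⟨fun _ _ hxy => hg (congrArg Subtype.val hxy), g.rangeRestrict_surjective⟩)
    (RingEquiv.subringCongr h (f.rangeRestrict x))
  exact congrArg Subtype.val this

end RangeEquiv

/-! ### The scheme `ℙ/G` and its base change to `E`. -/

section QuotientScheme

set_option linter.unusedSectionVars false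

variable (G : Type) [CommGroup G] [Fintype G]

open HomogeneousLocalization

/-- The ring of invariants `ℚ[Y, X_g]^G` with its grading. -/
abbrev quotGrading : ℕ → AddSubgroup (invSubring (translateAction G)) :=
  invGrading (translateAction G)

variable {G} in
lemma translateAction_const (h : G) (x : ℚ) :
    translateAction G h (algebraMap ℚ (projGrading G 0) x : MvPolynomial (Option G) ℚ) =
      (algebraMap ℚ (projGrading G 0) x : MvPolynomial (Option G) ℚ) :=
  projTranslateRing_C h x

variable {G} in
lemma charAction_const (h : G) (x : charField G) :
    charAction G h (algebraMap (charField G) (charGrading G 0) x : CharPoly G) =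
      (algebraMap (charField G) (charGrading G 0) x : CharPoly G) :=
  charScale_C h x

/-- The quotient `ℙ/G`. -/
def quotSpace : Scheme.{0} := Proj (quotGrading G)

/-- The structure morphism of `ℙ/G` over `ℚ`. -/
def quotStr : quotSpace G ⟶ Spec (.of ℚ) :=
  projStr (quotGrading G) (invZero (algebraMap ℚ (projGrading G 0)) translateAction_const)

/-- The quotient morphism `ℙ → ℙ/G`. -/
def quotMap : projSpace G ⟶ quotSpace G := projQuot (translateAction G)

theorem quotMap_isQuotient : IsQuotient projTranslate (quotMap G) :=
  projQuot_isQuotient (translateAction G) projTranslateRing_irrelevant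

theorem quotMap_quotStr : quotMap G ≫ quotStr G = projSpaceStr G :=
  projQuot_projStr (algebraMap ℚ (projGrading G 0)) translateAction_const

/-- The inclusion `ℚ[Y, X_g]^G → E[Y, Z_χ]^G`. -/
def extendInv : quotGrading G →+*ᵍ charInvGrading G :=
  invMap (extendCoord G) charAction_extendCoord

lemma extendInv_isRegular : IsRegularOnProj (extendInv G) :=
  invMap_isRegular (ρ := translateAction G) (ρ' := charAction G) (θ := extendCoord G)
    charAction_extendCoord (IsGradedBaseChange.isRegular extendCoord_isGradedBaseChange)

lemma extendInv_isGradedBaseChange : IsGradedBaseChange (fieldBasis G)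
    (invZero (ρ := translateAction G) (algebraMap ℚ (projGrading G 0)) translateAction_const)
    (invZero (ρ := charAction G) (algebraMap (charField G) (charGrading G 0)) charAction_const)
    (extendInv G) :=
  IsGradedBaseChange.inv (ρ := translateAction G) (ρ' := charAction G)
    extendCoord_isGradedBaseChange charAction_extendCoord translateAction_const charAction_const

/-- The structure morphism of `Proj E[Y, Z_χ]^G` over `E`. -/
def charSpaceStr : Proj (charInvGrading G) ⟶ Spec (.of (charField G)) :=
  projStr (charInvGrading G)
    (invZero (algebraMap (charField G) (charGrading G 0)) charAction_const)

/-- The projection from `(ℙ/G)_E = Proj E[Y, Z_χ]^G` to `ℙ/G`. -/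
def charSpaceProj : Proj (charInvGrading G) ⟶ quotSpace G := projMap (extendInv_isRegular G)

lemma charSpace_isPullback : IsPullback (charSpaceProj G) (charSpaceStr G) (quotStr G)
    (Spec.map (CommRingCat.ofHom (algebraMap ℚ (charField G)))) :=
  IsGradedBaseChange.isPullback (extendInv_isGradedBaseChange G) (extendInv_isRegular G)

/-- `Proj E[Y, Z_χ]^G = (ℙ/G)_E`. -/
def charSpaceIso : Proj (charInvGrading G) ≅ ToricDatum.baseChange ℚ (charField G) (quotStr G) :=
  (charSpace_isPullback G).isoPullback

lemma charSpaceIso_fst : (charSpaceIso G).hom ≫ Limits.pullback.fst _ _ = charSpaceProj G :=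
  (charSpace_isPullback G).isoPullback_hom_fst

lemma charSpaceIso_snd : (charSpaceIso G).hom ≫ Limits.pullback.snd _ _ = charSpaceStr G :=
  (charSpace_isPullback G).isoPullback_hom_snd

end QuotientScheme

/-! ### The toric charts of `(ℙ/G)_E`. -/

section Charts

set_option linter.unusedSectionVars false

variable {G : Type} [CommGroup G] [Fintype G] {K : ℕ} {c : Fin K → G}

open HomogeneousLocalization

lemma dualMonoid_le_unitsChars (σ : PointedCone ℝ (cocharSpace G)) :
    dualMonoid (quotientDatum c).lattice σ ≤ unitsChars G := dualMonoid_anti le_sup_left bot_le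

variable (c) in
/-- The inclusion `E[σ^∨ ∩ M] ⊆ E[M']`. -/
def chartIncl (σ : PointedCone ℝ (cocharSpace G)) : (quotientDatum c).chartRing σ →+*
    AddMonoidAlgebra (charField G) (unitsChars G) :=
  AddMonoidAlgebra.mapDomainRingHom (charField G)
    (AddSubmonoid.inclusion (dualMonoid_le_unitsChars σ))

lemma chartIncl_single (σ : PointedCone ℝ (cocharSpace G))
    (u : dualMonoid (quotientDatum c).lattice σ) (a : charField G) :
    chartIncl c σ (.single u a) =
      .single (AddSubmonoid.inclusion (dualMonoid_le_unitsChars σ) u) a :=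
  AddMonoidAlgebra.mapDomain_single

lemma chartIncl_injective (σ : PointedCone ℝ (cocharSpace G)) :
    Function.Injective (chartIncl c σ) :=
  AddMonoidAlgebra.mapDomain_injective (AddSubmonoid.inclusion_injective _)

lemma chartIncl_restrict {σ τ : PointedCone ℝ (cocharSpace G)} (h : τ ≤ σ)
    (x : (quotientDatum c).chartRing σ) :
    chartIncl c τ ((quotientDatum c).restrict h x) = chartIncl c σ x := by
  induction x using AddMonoidAlgebra.induction_linear with
  | zero => simp
  | add x y hx hy => rw [map_add, map_add, map_add, hx, hy]
  | single u a =>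
    have : (quotientDatum c).restrict h (.single u a) =
      .single (AddSubmonoid.inclusion (dualMonoid_anti le_rfl h) u) a :=
        AddMonoidAlgebra.mapDomain_single
    rw [this, chartIncl_single, chartIncl_single]
    rfl

lemma mem_dualMonoid_iff_coord
    (hc : Function.Bijective fun x : ∀ j, Subgroup.zpowers (c j) => ∏ j, (x j : G))
    {σ : PointedCone ℝ (cocharSpace G)} (hσ : σ ∈ fanCones G) (u : unitsChars G) :
    u.1 ∈ dualMonoid (quotientDatum c).lattice σ ↔
      charWeight (coord u) = 1 ∧ ∀ o ∈ coneRays σ, 0 ≤ rayPair (coord u) o := by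
  rw [mem_dualMonoid_iff hc hσ]
  constructor
  · rintro ⟨a, ha, h⟩
    obtain rfl : coord u = a := ofCoord_injective ((ofCoord_coord u).trans ha)
    exact h
  · intro h
    exact ⟨coord u, (ofCoord_coord u).symm, h⟩

/-- Inside `E[M']` both rings are spanned by the `e^u` with `u` of trivial weight and nonnegative on
the rays of `σ`: for the fractions by `faceEval_coeff` and `exists_faceEval`, for the toric chart by
`mem_dualMonoid_iff_coord`. -/
lemma range_faceEval
    (hc : Function.Bijective fun x : ∀ j, Subgroup.zpowers (c j) => ∏ j, (x j : G))
    {σ : PointedCone ℝ (cocharSpace G)} (hσ : σ ∈ fanCones G) :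
    (faceEval (coneRays σ)).range = (chartIncl c σ).range := by
  apply le_antisymm
  · rintro _ ⟨x, rfl⟩
    rw [← AddMonoidAlgebra.sum_coeff_single (faceEval (coneRays σ) x)]
    refine Subring.sum_mem _ fun u hu => ?_
    have h1 := (mem_dualMonoid_iff_coord hc hσ u).2
      (faceEval_coeff (coneRays σ) x u (Finsupp.mem_support_iff.1 hu))
    exact ⟨.single ⟨u.1, h1⟩ _, chartIncl_single σ _ _⟩
  · rintro _ ⟨x, rfl⟩
    induction x using AddMonoidAlgebra.induction_linear with
    | zero => rw [map_zero]; exact Subring.zero_mem _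
    | add x y hx hy => rw [map_add]; exact Subring.add_mem _ hx hy
    | single u a =>
      rw [chartIncl_single]
      have h1 := (mem_dualMonoid_iff_coord hc hσ
        (AddSubmonoid.inclusion (dualMonoid_le_unitsChars σ) u)).1 u.2
      exact exists_faceEval _ _ a h1.1 h1.2

/-- The functions on the open set of `(ℙ/G)_E` attached to `σ` are `E[σ^∨ ∩ M]`. -/
def chartEquiv (hc : Function.Bijective fun x : ∀ j, Subgroup.zpowers (c j) => ∏ j, (x j : G))
    {σ : PointedCone ℝ (cocharSpace G)} (hσ : σ ∈ fanCones G) :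
    Away (charInvGrading G) (faceMono (coneRays σ)) ≃+* (quotientDatum c).chartRing σ :=
  equivOfRangeEq (faceEval (coneRays σ)) (chartIncl c σ) (faceEval_injective _)
    (chartIncl_injective σ) (range_faceEval hc hσ)

lemma chartIncl_chartEquiv
    (hc : Function.Bijective fun x : ∀ j, Subgroup.zpowers (c j) => ∏ j, (x j : G))
    {σ : PointedCone ℝ (cocharSpace G)} (hσ : σ ∈ fanCones G)
    (x : Away (charInvGrading G) (faceMono (coneRays σ))) :
    chartIncl c σ (chartEquiv hc hσ x) = faceEval (coneRays σ) x :=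
  equivOfRangeEq_apply _ _ _ _ _ x

/-- The inclusion of the open set attached to `σ`. -/
def faceι {σ : PointedCone ℝ (cocharSpace G)} (hσ : σ ∈ fanCones G) :
    Spec (.of (Away (charInvGrading G) (faceMono (coneRays σ)))) ⟶ Proj (charInvGrading G) :=
  Proj.awayι (charInvGrading G) (faceMono (coneRays σ)) (faceMono_mem _)
    (faceExp_degree_pos (coneRays_ne_univ hσ))

/-- The chart `U_σ → Proj E[Y, Z_χ]^G`. -/
def coneChart (hc : Function.Bijective fun x : ∀ j, Subgroup.zpowers (c j) => ∏ j, (x j : G))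
    {σ : PointedCone ℝ (cocharSpace G)} (hσ : σ ∈ fanCones G) :
    Spec (.of ((quotientDatum c).chartRing σ)) ⟶ Proj (charInvGrading G) :=
  Spec.map (CommRingCat.ofHom (chartEquiv hc hσ).toRingHom) ≫ faceι hσ

variable (hc : Function.Bijective fun x : ∀ j, Subgroup.zpowers (c j) => ∏ j, (x j : G))

lemma isIso_specMap_ringEquiv {R S : Type} [CommRing R] [CommRing S] (e : R ≃+* S) :
    IsIso (Spec.map (CommRingCat.ofHom e.toRingHom)) := by
  have : IsIso (CommRingCat.ofHom e.toRingHom) := e.toCommRingCatIso.isIso_hom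
  infer_instance

lemma faceι_isOpenImmersion {σ : PointedCone ℝ (cocharSpace G)} (hσ : σ ∈ fanCones G) :
    IsOpenImmersion (faceι hσ) := by
  rw [faceι]
  infer_instance

lemma coneChart_isOpenImmersion {σ : PointedCone ℝ (cocharSpace G)} (hσ : σ ∈ fanCones G) :
    IsOpenImmersion (coneChart hc hσ) := by
  have := isIso_specMap_ringEquiv (chartEquiv hc hσ)
  have := faceι_isOpenImmersion hσ
  rw [coneChart]
  infer_instance

lemma range_coneChart {σ : PointedCone ℝ (cocharSpace G)} (hσ : σ ∈ fanCones G) :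
    Set.range (coneChart hc hσ) = Proj.basicOpen (charInvGrading G) (faceMono (coneRays σ)) := by
  have h1 := isIso_specMap_ringEquiv (chartEquiv hc hσ)
  have h2 := coneChart_isOpenImmersion hc hσ
  have h5 := faceι_isOpenImmersion hσ
  have h3 : (coneChart hc hσ).opensRange = (faceι hσ).opensRange :=
    Scheme.Hom.opensRange_comp_of_isIso _ _
  have h4 : (faceι hσ).opensRange = Proj.basicOpen (charInvGrading G) (faceMono (coneRays σ)) :=
    Proj.opensRange_awayι _ _ _ _
  exact congrArg (fun U : (Proj (charInvGrading G)).Opens => (U : Set (Proj (charInvGrading G))))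
    (h3.trans h4)

/-- The inclusion of charts is inversion of the variables in `coneRays σ` outside `coneRays τ`. It
matches the inclusion of monoid algebras because both become inclusions inside `E[M']`. -/
lemma coneChart_face {σ τ : PointedCone ℝ (cocharSpace G)} (hσ : σ ∈ fanCones G)
    (hτ : τ ∈ fanCones G) (h : τ ≤ σ) :
    Spec.map (CommRingCat.ofHom ((quotientDatum c).restrict h)) ≫ coneChart hc hσ =
      coneChart hc hτ := by
  have hsub : coneRays τ ⊆ coneRays σ := fun o ho => h ho
  have h1 := Proj.SpecMap_awayMap_awayι (charInvGrading G) (faceMono_mem (coneRays σ))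
    (faceExp_degree_pos (coneRays_ne_univ hσ)) (faceMono_mem (coneRays τ ∪ (coneRays σ)ᶜ))
    (faceMono_mul hsub)
  have h2 : ((quotientDatum c).restrict h).comp (chartEquiv hc hσ).toRingHom =
      (chartEquiv hc hτ).toRingHom.comp (awayMap (charInvGrading G)
        (faceMono_mem (coneRays τ ∪ (coneRays σ)ᶜ)) (faceMono_mul hsub)) := by
    refine RingHom.ext fun x => chartIncl_injective (c := c) τ ?_
    change chartIncl c τ ((quotientDatum c).restrict h (chartEquiv hc hσ x)) =
      chartIncl c τ (chartEquiv hc hτ _)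
    rw [chartIncl_restrict, chartIncl_chartEquiv, chartIncl_chartEquiv]
    exact (DFunLike.congr_fun (evalAway_awayMap (𝒜 := charInvGrading G) (invEval G)
      (isUnit_invEval_faceMono _) (isUnit_invEval_faceMono _) (faceMono_mem (coneRays σ))
      (faceMono_mem (coneRays τ ∪ (coneRays σ)ᶜ)) (faceMono_mul hsub)) x).symm
  rw [coneChart, coneChart, ← Category.assoc, ← Spec.map_comp, ← CommRingCat.ofHom_comp, h2,
    CommRingCat.ofHom_comp, Spec.map_comp, Category.assoc]
  exact congrArg (Spec.map (CommRingCat.ofHom (chartEquiv hc hτ).toRingHom) ≫ ·) h1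

lemma coneChart_over {σ : PointedCone ℝ (cocharSpace G)} (hσ : σ ∈ fanCones G) :
    coneChart hc hσ ≫ charSpaceStr G =
      Spec.map (CommRingCat.ofHom (algebraMap (charField G) ((quotientDatum c).chartRing σ))) := by
  rw [coneChart, Category.assoc, faceι, charSpaceStr, awayι_projStr, ← Spec.map_comp,
    ← CommRingCat.ofHom_comp]
  congr 2
  refine RingHom.ext fun a => chartIncl_injective (c := c) σ ?_
  refine (chartIncl_chartEquiv hc hσ _).trans ?_
  have h1 : fromZeroRingHom (charInvGrading G) (Submonoid.powers (faceMono (coneRays σ)))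
      (invZero (algebraMap (charField G) (charGrading G 0)) charAction_const a) =
      Away.mk (charInvGrading G) (faceMono_mem _) 0
        (invZero (algebraMap (charField G) (charGrading G 0)) charAction_const a :
          charInvGrading G 0) (by simp) := by
    apply val_injective
    rw [Away.val_mk]
    change (HomogeneousLocalization.mk _).val = _
    rw [val_mk]
    congr 1
  have h2 := evalAway_mk (invEval G) (isUnit_invEval_faceMono (coneRays σ)) (faceMono_mem _) 0
    (invZero (algebraMap (charField G) (charGrading G 0)) charAction_const a :
          charInvGrading G 0) (by simp)
  rw [pow_zero, mul_one] at h2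
  rw [RingHom.comp_apply, h1]
  refine h2.trans ?_
  refine (toricEval_C a).trans ?_
  exact (chartIncl_single σ 0 a).symm

/-- Lift the point to `Proj E[Y, Z_χ]`, where some variable is nonzero. Its `n`-th power is the
denominator of the maximal cone spanned by all the other rays. -/
lemma coneChart_cover (y : Proj (charInvGrading G)) :
    ∃ (σ : PointedCone ℝ (cocharSpace G)) (hσ : σ ∈ fanCones G),
      y ∈ Set.range (coneChart hc hσ) := by
  obtain ⟨x, rfl⟩ := projQuot_surjective (charAction G) y
  have h1 : ∃ o : Option (G →* ℂˣ), MvPolynomial.X o ∉ x.asHomogeneousIdeal := by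
    by_contra! h
    refine x.not_irrelevant_le ((HomogeneousIdeal.irrelevant_le _).mpr fun d hd p hp => ?_)
    rw [p.as_sum]
    refine Ideal.sum_mem _ fun m hm => ?_
    have hdeg := degree_of_coeff_ne_zero hp (MvPolynomial.mem_support_iff.1 hm)
    obtain ⟨o, ho⟩ : ∃ o, m o ≠ 0 := by
      by_contra! h'
      have : m = 0 := Finsupp.ext h'
      rw [this, map_zero] at hdeg
      omega
    have : Finsupp.single o 1 + (m - Finsupp.single o 1) = m := by
      refine add_tsub_cancel_of_le (Finsupp.single_le_iff.2 (Nat.one_le_iff_ne_zero.2 ho))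
    rw [← this, ← one_mul (MvPolynomial.coeff _ p), ← MvPolynomial.monomial_mul]
    exact Ideal.mul_mem_right _ _ (h o)
  obtain ⟨o, ho⟩ := h1
  have hne : ({o}ᶜ : Set (Option (G →* ℂˣ))) ≠ Set.univ := fun h =>
    (h.symm ▸ Set.mem_univ o : o ∈ ({o}ᶜ : Set (Option (G →* ℂˣ)))) rfl
  -- The cone omits only the ray of the nonvanishing variable, so its denominator involves only that
  -- variable.
  refine ⟨rayCone {o}ᶜ, mem_fanCones.2 ⟨_, hne, rfl⟩, ?_⟩
  rw [range_coneChart]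
  change projQuot (charAction G) x ∈ Proj.basicOpen (charInvGrading G) _
  rw [coneRays_rayCone hne, Proj.mem_basicOpen, ← projQuot_mem (charAction G)
    (faceExp_degree_pos hne) (faceMono_mem _)]
  have h2 : invIncl (charAction G) (faceMono {o}ᶜ) = MvPolynomial.X o ^ Fintype.card G := by
    classical
    rw [MvPolynomial.X_pow_eq_monomial]
    refine congrArg (fun m => MvPolynomial.monomial m (1 : charField G)) (Finsupp.ext fun o' => ?_)
    rw [faceExp_apply, Finsupp.single_apply]
    by_cases h3 : o' = o
    · simp [h3]
    · simp [h3, Ne.symm h3]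
  rw [h2]
  have hp := x.isPrime
  exact fun h3 => ho (hp.mem_of_pow_mem _ h3)

lemma faceMono_dvd (J J' : Set (Option (G →* ℂˣ))) :
    ∃ x, faceMono J * faceMono J' = faceMono (J ∩ J') * x := by
  refine ⟨faceMono (J ∪ J'), Subtype.ext ?_⟩
  change MvPolynomial.monomial _ _ * MvPolynomial.monomial _ _ =
    MvPolynomial.monomial _ _ * MvPolynomial.monomial _ _
  rw [MvPolynomial.monomial_mul, MvPolynomial.monomial_mul]
  refine congrArg (fun m => MvPolynomial.monomial m (1 * 1 : charField G))
    (Finsupp.ext fun o => ?_)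
  simp only [Finsupp.add_apply, faceExp_apply]
  by_cases h1 : o ∈ J <;> by_cases h2 : o ∈ J' <;> simp [h1, h2]

/-- Where the denominators of `σ` and `τ` are both nonzero, so is their product, which is divisible
by the denominator of `σ ⊓ τ`. -/
lemma coneChart_inter {σ τ : PointedCone ℝ (cocharSpace G)} (hσ : σ ∈ fanCones G)
    (hτ : τ ∈ fanCones G) (y : Proj (charInvGrading G)) (h1 : y ∈ Set.range (coneChart hc hσ))
    (h2 : y ∈ Set.range (coneChart hc hτ)) :
    ∃ hρ : σ ⊓ τ ∈ fanCones G, y ∈ Set.range (coneChart hc hρ) := by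
  have hρ : σ ⊓ τ ∈ fanCones G := (quotientDatum_isFan c).face σ hσ _
    ((quotientDatum_isFan c).inter σ hσ τ hτ)
  refine ⟨hρ, ?_⟩
  rw [range_coneChart] at h1 h2 ⊢
  obtain ⟨x, hx⟩ := faceMono_dvd (coneRays σ) (coneRays τ)
  have h3 : y ∈ Proj.basicOpen (charInvGrading G) (faceMono (coneRays σ) * faceMono (coneRays τ)) := by
    rw [Proj.basicOpen_mul]
    exact ⟨h1, h2⟩
  rw [hx] at h3
  exact Proj.basicOpen_mono _ _ _ (Dvd.intro x rfl) h3

end Charts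

end QuotientToric

namespace QuotientToric

/-! ### Composition and evaluation for maps of `Proj`. -/

section ProjMap

set_option linter.unusedSectionVars false

open HomogeneousLocalization

variable {σ A τ B υ C : Type} [CommRing A] [SetLike σ A] [AddSubgroupClass σ A] {𝒜 : ℕ → σ}
  [GradedRing 𝒜] [CommRing B] [SetLike τ B] [AddSubgroupClass τ B] {ℬ : ℕ → τ} [GradedRing ℬ]
  [CommRing C] [SetLike υ C] [AddSubgroupClass υ C] {𝒞 : ℕ → υ} [GradedRing 𝒞]

lemma projMap_comp {θ : 𝒜 →+*ᵍ ℬ} {η : ℬ →+*ᵍ 𝒞} {ξ : 𝒜 →+*ᵍ 𝒞} (hθ : IsRegularOnProj θ)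
    (hη : IsRegularOnProj η) (hξ : IsRegularOnProj ξ) (h : ∀ a, ξ a = η (θ a)) :
    projMap hη ≫ projMap hθ = projMap hξ := by
  obtain rfl : ξ = η.comp θ := DFunLike.ext _ _ h
  refine (regularCover hξ).openCover.hom_ext _ _ ?_
  rintro ⟨⟨d, a⟩, h0, ha⟩
  change Proj.awayι 𝒞 (η (θ a)) (gradedMap_mem η (gradedMap_mem θ ha)) h0 ≫ _ = _
  refine Eq.trans ?_ (awayι_projMap hξ h0 ha).symm
  rw [← Category.assoc, awayι_projMap hη h0 (gradedMap_mem θ ha), Category.assoc,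
    awayι_projMap hθ h0 ha, ← Category.assoc, ← Spec.map_comp, ← CommRingCat.ofHom_comp]
  congr 3
  refine RingHom.ext fun x => ?_
  obtain ⟨k, b, hb, rfl⟩ := Away.mk_surjective 𝒜 ha x
  rw [RingHom.comp_apply, Away.map_mk, Away.map_mk]
  exact (Away.map_mk (η.comp θ) a ha k b hb).symm

lemma awayι_comp_projMap {θ : 𝒜 →+*ᵍ ℬ} (hθ : IsRegularOnProj θ) {d : ℕ} (h0 : 0 < d) {a : A}
    (ha : a ∈ 𝒜 d) {b : B} (hb : b ∈ ℬ d) (h : b = θ a)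
    (hab : Submonoid.powers a ≤ (Submonoid.powers b).comap θ) :
    Proj.awayι ℬ b hb h0 ≫ projMap hθ =
      Spec.map (CommRingCat.ofHom (HomogeneousLocalization.map θ hab)) ≫ Proj.awayι 𝒜 a ha h0 := by
  subst h
  exact awayι_projMap hθ h0 ha

lemma evalAway_comp_map {R : Type} [CommRing R] (θ : 𝒜 →+*ᵍ ℬ) (s : B →+* R) {a : A} {b : B}
    (h : b = θ a) (hb : IsUnit (s b)) (ha : IsUnit (s.comp (θ : A →+* B) a)) {d : ℕ}
    (hd : a ∈ 𝒜 d) (hab : Submonoid.powers a ≤ (Submonoid.powers b).comap θ) :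
    (evalAway ℬ s hb).comp (HomogeneousLocalization.map θ hab) =
      evalAway 𝒜 (s.comp (θ : A →+* B)) ha := by
  subst h
  exact evalAway_map θ s hb hd

lemma powers_le_comap {θ : 𝒜 →+*ᵍ ℬ} {a : A} {b : B} (h : b = θ a) :
    Submonoid.powers a ≤ (Submonoid.powers b).comap θ := by
  rintro _ ⟨n, rfl⟩
  exact ⟨n, by rw [map_pow, h]⟩

end ProjMap

/-! ### The Galois action on the charts. -/

section Galois

set_option linter.unusedSectionVars false

variable {G : Type} [CommGroup G] [Fintype G] {K : ℕ} {c : Fin K → G}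

open HomogeneousLocalization

/-- The semilinear automorphism `Y ↦ Y`, `Z_χ ↦ Z_{γχ}` of `E[Y, Z_χ]`. -/
def charGal (γ : charField G ≃ₐ[ℚ] charField G) : charGrading G →+*ᵍ charGrading G where
  __ := (MvPolynomial.rename (R := charField G)
    (Option.map (galChar γ))).toRingHom.comp (MvPolynomial.map (γ : charField G →+* charField G))
  map_mem hx := MvPolynomial.IsHomogeneous.rename_isHomogeneous
    (MvPolynomial.IsHomogeneous.map hx _)

lemma charGal_apply (γ : charField G ≃ₐ[ℚ] charField G) (p : CharPoly G) : charGal γ p =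
    MvPolynomial.rename (Option.map (galChar γ))
      (MvPolynomial.map (γ : charField G →+* charField G) p) := rfl

lemma charGal_C (γ : charField G ≃ₐ[ℚ] charField G) (a : charField G) :
    charGal γ (MvPolynomial.C a) = MvPolynomial.C (γ a) := by
  rw [charGal_apply, MvPolynomial.map_C, MvPolynomial.rename_C]
  rfl

lemma charGal_X (γ : charField G ≃ₐ[ℚ] charField G) (χ : G →* ℂˣ) :
    charGal γ (MvPolynomial.X (some χ)) = MvPolynomial.X (some (galChar γ χ)) := by
  rw [charGal_apply, MvPolynomial.map_X, MvPolynomial.rename_X]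
  rfl

lemma charGal_X_none (γ : charField G ≃ₐ[ℚ] charField G) :
    charGal γ (MvPolynomial.X none) = MvPolynomial.X none := by
  rw [charGal_apply, MvPolynomial.map_X, MvPolynomial.rename_X]
  rfl

lemma charGal_monomial (γ : charField G ≃ₐ[ℚ] charField G) (m : Option (G →* ℂˣ) →₀ ℕ)
    (a : charField G) : charGal γ (MvPolynomial.monomial m a) =
      MvPolynomial.monomial (m.mapDomain (Option.map (galChar γ))) (γ a) := by
  rw [charGal_apply, MvPolynomial.map_monomial, MvPolynomial.rename_monomial]
  rfl

/-- Compatibility comes from `γ(χ(h)) = (γχ)(h)`. It lets the semilinear automorphism descend to the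
invariants. -/
lemma charAction_charGal (γ : charField G ≃ₐ[ℚ] charField G) (h : G) (p : CharPoly G) :
    charAction G h (charGal γ p) = charGal γ (charAction G h p) := by
  refine DFunLike.congr_fun
    (f := (charScale h : CharPoly G →+* CharPoly G).comp (charGal γ : CharPoly G →+* CharPoly G))
    (g := (charGal γ : CharPoly G →+* CharPoly G).comp (charScale h : CharPoly G →+* CharPoly G))
    (charPoly_ringHom_ext (fun a => ?_) ?_ fun χ => ?_) p
  · change charScale h (charGal γ _) = charGal γ (charScale h _)
    rw [charGal_C, charScale_C, charScale_C, charGal_C]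
  · change charScale h (charGal γ _) = charGal γ (charScale h _)
    rw [charGal_X_none, charScale_X_none, charGal_X_none]
  · change charScale h (charGal γ _) = charGal γ (charScale h _)
    rw [charGal_X, charScale_X, charScale_X, map_mul, charGal_C, charGal_X, charVal_galChar]

lemma sum_galChar {M : Type} [AddCommMonoid M] (γ : charField G ≃ₐ[ℚ] charField G)
    (f : (G →* ℂˣ) → M) : ∑ χ, f (galChar γ χ) = ∑ χ, f χ :=
  Equiv.sum_comp (galPerm γ) f

/-- Applying the semilinear map to `X_g = (1/n) ∑ χ(g⁻¹) Z_χ` only permutes the summands. Hence the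
map it induces on `(ℙ/G)_E` lies over the identity of `ℙ/G`. -/
lemma charGal_extendCoord (γ : charField G ≃ₐ[ℚ] charField G) (p : MvPolynomial (Option G) ℚ) :
    charGal γ (extendCoord G p) = extendCoord G p := by
  refine DFunLike.congr_fun
    (f := (charGal γ : CharPoly G →+* CharPoly G).comp
      (extendCoord G : MvPolynomial (Option G) ℚ →+* CharPoly G))
    (g := (extendCoord G : MvPolynomial (Option G) ℚ →+* CharPoly G))
    (projPoly_ringHom_ext ?_ fun g => ?_) p
  · change charGal γ (extendCoord G _) = extendCoord G _
    rw [extendCoord_X_none, charGal_X_none]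
  · change charGal γ (extendCoord G _) = extendCoord G _
    rw [extendCoord_X, toCharCoord, map_sum]
    refine Eq.trans ?_ (sum_galChar γ _)
    refine Finset.sum_congr rfl fun χ _ => ?_
    rw [map_mul, charGal_C, charGal_X, map_mul, map_inv₀, map_natCast, charVal_galChar]

/-- The semilinear automorphism of `E[Y, Z_χ]^G`. -/
def charInvGal (γ : charField G ≃ₐ[ℚ] charField G) : charInvGrading G →+*ᵍ charInvGrading G :=
  invMap (charGal γ) (charAction_charGal γ)

lemma charInvGal_extendInv (γ : charField G ≃ₐ[ℚ] charField G)
    (p : invSubring (translateAction G)) :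
    extendInv G p = charInvGal γ (extendInv G p) :=
  Subtype.ext (charGal_extendCoord γ _).symm

/-- Invariants coming from `ℚ` already have no common zero, and they are fixed. -/
lemma charInvGal_isRegular (γ : charField G ≃ₐ[ℚ] charField G) :
    IsRegularOnProj (charInvGal γ) := by
  intro x
  obtain ⟨d, a, h0, ha, hx⟩ := extendInv_isRegular G x
  exact ⟨d, extendInv G a, h0, gradedMap_mem _ ha, by rwa [← charInvGal_extendInv]⟩

lemma charInvGal_charSpaceProj (γ : charField G ≃ₐ[ℚ] charField G) :
    projMap (charInvGal_isRegular γ) ≫ charSpaceProj G = charSpaceProj G :=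
  projMap_comp _ _ _ (charInvGal_extendInv γ)

/-- The action `u ↦ u ∘ γ⁻¹` on `M'`. -/
def galUnits (γ : charField G ≃ₐ[ℚ] charField G) : unitsChars G →+ unitsChars G where
  toFun u := ⟨u.1 ∘ₗ (galVec γ⁻¹).toLinearMap, fun v hv => u.2.1 _ (galVec_unitsLattice γ⁻¹ v hv),
    fun v hv => by rw [(Submodule.mem_bot _).1 hv, map_zero]⟩
  map_zero' := by ext; simp
  map_add' u w := by ext; simp

lemma coord_apply (u : unitsChars G) (χ : G →* ℂˣ) : u.1 (charVec χ) = coord u χ := by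
  rw [← ofCoord_coord u, ofCoord_charVec]

lemma coord_galUnits (γ : charField G ≃ₐ[ℚ] charField G) (u : unitsChars G) (χ : G →* ℂˣ) :
    coord (galUnits γ u) χ = coord u (galChar γ⁻¹ χ) := by
  apply coord_eq
  rw [← coord_apply]
  change u.1 (galVec γ⁻¹ (charVec χ)) = _
  rw [galVec_charVec]

lemma galUnits_dualVec (γ : charField G ≃ₐ[ℚ] charField G) (χ : G →* ℂˣ) :
    galUnits γ (dualVec χ) = dualVec (galChar γ χ) := by
  classical
  refine unitsChars_ext fun ψ => ?_
  rw [coord_galUnits, coord_dualVec, coord_dualVec]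
  refine if_congr ⟨?_, ?_⟩ rfl rfl
  · rintro rfl
    rw [← galChar_mul, mul_inv_cancel, galChar_one]
  · rintro rfl
    rw [← galChar_mul, inv_mul_cancel, galChar_one]

/-- The semilinear automorphism `a e^u ↦ γ(a) e^{γu}` of `E[M']`. -/
def galUnitsRing (γ : charField G ≃ₐ[ℚ] charField G) :
    AddMonoidAlgebra (charField G) (unitsChars G) →+*
      AddMonoidAlgebra (charField G) (unitsChars G) :=
  (AddMonoidAlgebra.mapDomainRingHom (charField G) (galUnits γ)).comp
    (AddMonoidAlgebra.mapRingHom _ (γ : charField G →+* charField G))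

lemma galUnitsRing_single (γ : charField G ≃ₐ[ℚ] charField G) (u : unitsChars G)
    (a : charField G) : galUnitsRing γ (.single u a) = .single (galUnits γ u) (γ a) := by
  rw [galUnitsRing, RingHom.comp_apply, AddMonoidAlgebra.mapRingHom_single]
  exact AddMonoidAlgebra.mapDomain_single

lemma galChart_single (γ : charField G ≃ₐ[ℚ] charField G) (σ : PointedCone ℝ (cocharSpace G))
    (u : dualMonoid (quotientDatum c).lattice σ) (a : charField G) :
    (quotientDatum c).galChart γ σ (.single u a) =
      .single ((quotientDatum c).galDual γ σ u) (γ a) := by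
  rw [ToricDatum.galChart, RingHom.comp_apply, AddMonoidAlgebra.mapRingHom_single]
  exact AddMonoidAlgebra.mapDomain_single

lemma chartIncl_galChart (γ : charField G ≃ₐ[ℚ] charField G) (σ : PointedCone ℝ (cocharSpace G))
    (x : (quotientDatum c).chartRing σ) :
    chartIncl c _ ((quotientDatum c).galChart γ σ x) = galUnitsRing γ (chartIncl c σ x) := by
  induction x using AddMonoidAlgebra.induction_linear with
  | zero => rw [map_zero, map_zero, map_zero, map_zero]
  | add x y hx hy => rw [map_add, map_add, map_add, map_add, hx, hy]
  | single u a =>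
    rw [galChart_single, chartIncl_single, chartIncl_single, galUnitsRing_single]
    rfl

lemma toricEval_charGal (γ : charField G ≃ₐ[ℚ] charField G) :
    (toricEval G).comp (charGal γ : CharPoly G →+* CharPoly G) =
      (galUnitsRing γ).comp (toricEval G) := by
  refine charPoly_ringHom_ext (fun a => ?_) ?_ fun χ => ?_
  · change toricEval G (charGal γ _) = galUnitsRing γ (toricEval G _)
    rw [charGal_C, toricEval_C, toricEval_C, galUnitsRing_single, map_zero]
  · change toricEval G (charGal γ _) = galUnitsRing γ (toricEval G _)
    rw [charGal_X_none, toricEval_X_none, map_one]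
  · change toricEval G (charGal γ _) = galUnitsRing γ (toricEval G _)
    rw [charGal_X, toricEval_X, toricEval_X, galUnitsRing_single, galUnits_dualVec, map_one]

lemma galVec_ray (γ : charField G ≃ₐ[ℚ] charField G) (o : Option (G →* ℂˣ)) :
    galVec γ (ray o) = ray (o.map (galChar γ)) := by
  cases o with
  | none => exact galVec_zeroVec γ
  | some χ => exact galVec_charVec γ χ

lemma mem_coneRays_map (γ : charField G ≃ₐ[ℚ] charField G) (σ : PointedCone ℝ (cocharSpace G))
    (o : Option (G →* ℂˣ)) :
    o.map (galChar γ) ∈ coneRays (PointedCone.map (galVec γ).toLinearMap σ) ↔ o ∈ coneRays σ := by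
  change ray _ ∈ PointedCone.map (galVec γ).toLinearMap σ ↔ ray o ∈ σ
  rw [← galVec_ray]
  constructor
  · rintro ⟨v, hv, h⟩
    rwa [← (galVec γ).injective h]
  · intro h
    exact ⟨_, h, rfl⟩

lemma mapDomain_faceExp (γ : charField G ≃ₐ[ℚ] charField G) (σ : PointedCone ℝ (cocharSpace G)) :
    (faceExp (coneRays σ)).mapDomain (Option.map (galChar γ)) =
      faceExp (coneRays (PointedCone.map (galVec γ).toLinearMap σ)) := by
  classical
  have hinj : Function.Injective (Option.map (galChar (G := G) γ)) :=
    Option.map_injective (galPerm γ).injective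
  refine Finsupp.ext fun o => ?_
  obtain ⟨o, rfl⟩ : ∃ o', Option.map (galChar γ) o' = o :=
    ((Finite.injective_iff_surjective).1 hinj) o
  rw [Finsupp.mapDomain_apply hinj, faceExp_apply, faceExp_apply]
  exact if_congr (mem_coneRays_map γ σ o).symm rfl rfl

lemma charInvGal_faceMono (γ : charField G ≃ₐ[ℚ] charField G)
    (σ : PointedCone ℝ (cocharSpace G)) :
    faceMono (coneRays (PointedCone.map (galVec γ).toLinearMap σ)) =
      charInvGal γ (faceMono (coneRays σ)) := by
  refine Subtype.ext ?_
  change MvPolynomial.monomial _ _ = charGal γ (MvPolynomial.monomial _ _)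
  rw [charGal_monomial, mapDomain_faceExp]
  exact congrArg (MvPolynomial.monomial _) (map_one γ).symm

variable (hc : Function.Bijective fun x : ∀ j, Subgroup.zpowers (c j) => ∏ j, (x j : G))

/-- After embedding in `E[M']`, both sides are the semilinear map `a e^u ↦ γ(a) e^{γu}`, by
`toricEval_charGal` and `chartIncl_galChart`. -/
lemma chartEquiv_gal (γ : charField G ≃ₐ[ℚ] charField G) {σ : PointedCone ℝ (cocharSpace G)}
    (hσ : σ ∈ fanCones G) :
    (chartEquiv hc (galVec_fanCones γ σ hσ)).toRingHom.comp (HomogeneousLocalization.map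
        (charInvGal γ) (powers_le_comap (charInvGal_faceMono γ σ))) =
      ((quotientDatum c).galChart γ σ).comp (chartEquiv hc hσ).toRingHom := by
  refine RingHom.ext fun x => chartIncl_injective (c := c) _ ?_
  refine (chartIncl_chartEquiv hc (galVec_fanCones γ σ hσ) _).trans ?_
  refine Eq.trans ?_ (chartIncl_galChart γ σ (chartEquiv hc hσ x)).symm
  rw [chartIncl_chartEquiv]
  have hs : (invEval G).comp (charInvGal γ : invSubring (charAction G) →+* invSubring (charAction G)) =
      (galUnitsRing γ).comp (invEval G) :=
    RingHom.ext fun p => DFunLike.congr_fun (toricEval_charGal γ) (p : CharPoly G)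
  have hu : IsUnit ((galUnitsRing γ).comp (invEval G) (faceMono (coneRays σ))) :=
    (isUnit_invEval_faceMono (coneRays σ)).map (galUnitsRing γ)
  have h1 := evalAway_comp_map (charInvGal γ) (invEval G) (charInvGal_faceMono γ σ)
    (isUnit_invEval_faceMono _) (by rw [hs]; exact hu) (faceMono_mem (coneRays σ))
    (powers_le_comap (charInvGal_faceMono γ σ))
  have h2 := evalAway_comp (invEval G) (galUnitsRing γ) (isUnit_invEval_faceMono (coneRays σ))
    (faceMono_mem (coneRays σ))
  simp only [hs] at h1
  exact DFunLike.congr_fun (h1.trans h2.symm) x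

lemma degree_faceExp_map (γ : charField G ≃ₐ[ℚ] charField G)
    (σ : PointedCone ℝ (cocharSpace G)) :
    faceMono (coneRays (PointedCone.map (galVec γ).toLinearMap σ)) ∈
      charInvGrading G (faceExp (coneRays σ)).degree := by
  rw [charInvGal_faceMono]
  exact gradedMap_mem _ (faceMono_mem _)

lemma awayι_congr {σ A : Type} [CommRing A] [SetLike σ A] [AddSubgroupClass σ A] (𝒜 : ℕ → σ)
    [GradedRing 𝒜] {f : A} {d e : ℕ} (hd : f ∈ 𝒜 d) (he : f ∈ 𝒜 e) (h0 : 0 < d) (h0' : 0 < e)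
    (h : d = e) : Proj.awayι 𝒜 f hd h0 = Proj.awayι 𝒜 f he h0' := by
  subst h
  rfl

/-- The map `projMap (charInvGal_isRegular γ)` carries the chart of `γσ` to that of `σ` and
disappears after projection to `ℙ/G`. This is one of the two components of the equality in
`(ℙ/G)_E`; the component over `E` is checked in `toricStructure`. -/
lemma coneChart_gal (γ : charField G ≃ₐ[ℚ] charField G) {σ : PointedCone ℝ (cocharSpace G)}
    (hσ : σ ∈ fanCones G) :
    Spec.map (CommRingCat.ofHom ((quotientDatum c).galChart γ σ)) ≫ coneChart hc hσ ≫
      charSpaceProj G = coneChart hc (galVec_fanCones γ σ hσ) ≫ charSpaceProj G := by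
  have hdeg : (faceExp (coneRays (PointedCone.map (galVec γ).toLinearMap σ))).degree =
      (faceExp (coneRays σ)).degree := by
    rw [← mapDomain_faceExp, Finsupp.degree_mapDomain]
  have h0 := faceExp_degree_pos (coneRays_ne_univ hσ)
  have h1 : faceι (galVec_fanCones γ σ hσ) ≫ projMap (charInvGal_isRegular γ) =
      Spec.map (CommRingCat.ofHom (HomogeneousLocalization.map (charInvGal γ)
        (powers_le_comap (charInvGal_faceMono γ σ)))) ≫ faceι hσ := by
    rw [faceι, awayι_congr (charInvGrading G) _ (degree_faceExp_map γ σ) _ h0 hdeg]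
    exact awayι_comp_projMap (charInvGal_isRegular γ) h0 (faceMono_mem _) (degree_faceExp_map γ σ)
      (charInvGal_faceMono γ σ) _
  have h2 : coneChart hc (galVec_fanCones γ σ hσ) ≫ projMap (charInvGal_isRegular γ) =
      Spec.map (CommRingCat.ofHom ((quotientDatum c).galChart γ σ)) ≫ coneChart hc hσ := by
    rw [coneChart, coneChart, Category.assoc, h1, ← Category.assoc, ← Category.assoc,
      ← Spec.map_comp, ← Spec.map_comp, ← CommRingCat.ofHom_comp, ← CommRingCat.ofHom_comp]
    congr 3
    exact chartEquiv_gal hc γ hσ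
  rw [← Category.assoc]
  refine congr($h2.symm ≫ charSpaceProj G).trans ?_
  exact (Category.assoc _ _ _).trans congr(_ ≫ $(charInvGal_charSpaceProj γ))

/-- The charts of `(ℙ/G)_E`. -/
def toricStructure : (quotientDatum c).ToricStructure (quotStr G) where
  chart σ := coneChart hc σ.2 ≫ (charSpaceIso G).hom
  isOpenImmersion σ := by
    have := coneChart_isOpenImmersion hc σ.2
    exact IsOpenImmersion.comp _ _
  chart_over σ := (Category.assoc _ _ _).trans
    (congr(coneChart hc σ.2 ≫ $(charSpaceIso_snd G)).trans (coneChart_over hc σ.2))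
  chart_face σ τ h := (Category.assoc _ _ _).symm.trans
    congr($(coneChart_face hc σ.2 τ.2 h) ≫ (charSpaceIso G).hom)
  cover := by
    refine Set.eq_univ_of_forall fun y => ?_
    obtain ⟨σ, hσ, x, hx⟩ := coneChart_cover hc ((charSpaceIso G).inv y)
    refine Set.mem_iUnion.2 ⟨⟨σ, hσ⟩, x, ?_⟩
    rw [Scheme.Hom.comp_apply, hx]
    exact Scheme.inv_hom_apply (charSpaceIso G) y
  inter σ τ := by
    rintro _ ⟨⟨x, rfl⟩, x', hx'⟩
    rw [Scheme.Hom.comp_apply, Scheme.Hom.comp_apply] at hx'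
    have hinj := (charSpaceIso G).hom.isOpenEmbedding.injective
    obtain ⟨hρ, z, hz⟩ := coneChart_inter hc σ.2 τ.2 _ ⟨x, rfl⟩ ⟨x', hinj hx'⟩
    refine Set.mem_iUnion₂.2 ⟨⟨_, hρ⟩, le_rfl, z, ?_⟩
    rw [Scheme.Hom.comp_apply, Scheme.Hom.comp_apply, hz]
  chart_gal γ σ := by
    -- The Galois action on the fibre product is the identity on the factor `ℙ/G` and `Spec γ` on
    -- the factor `Spec E`, so the two projections are treated separately.
    apply Limits.pullback.hom_ext
    · have h1 : ToricDatum.galBaseChange (quotStr G) γ ≫ Limits.pullback.fst _ _ =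
          Limits.pullback.fst _ _ :=
        (Limits.pullback.lift_fst _ _ _).trans (Category.comp_id _)
      rw [Category.assoc, Category.assoc, Category.assoc, Category.assoc, h1, charSpaceIso_fst]
      exact coneChart_gal hc γ σ.2
    · have h1 : ToricDatum.galBaseChange (quotStr G) γ ≫ Limits.pullback.snd _ _ =
          Limits.pullback.snd _ _ ≫ Spec.map (CommRingCat.ofHom
            (γ : charField G →+* charField G)) :=
        Limits.pullback.lift_snd _ _ _
      have h2 : ((quotientDatum c).galChart γ σ.1).comp
          (algebraMap (charField G) ((quotientDatum c).chartRing σ.1)) =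
          (algebraMap (charField G) ((quotientDatum c).chartRing _)).comp
            (γ : charField G →+* charField G) := by
        refine RingHom.ext fun a => (galChart_single γ σ.1 0 a).trans ?_
        rw [map_zero]
        rfl
      rw [Category.assoc, Category.assoc, Category.assoc, Category.assoc, h1,
        reassoc_of% (charSpaceIso_snd G), charSpaceIso_snd]
      refine congr(Spec.map (CommRingCat.ofHom ((quotientDatum c).galChart γ σ.1)) ≫
        $(coneChart_over hc σ.2)).trans ?_
      refine Eq.trans ?_ (Category.assoc _ _ _)
      refine Eq.trans ?_ congr($((coneChart_over hc (galVec_fanCones γ σ.1 σ.2)).symm) ≫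
        Spec.map (CommRingCat.ofHom (γ : charField G →+* charField G)))
      refine (Spec.map_comp _ _).symm.trans (Eq.trans ?_ (Spec.map_comp _ _))
      exact congrArg (fun f => Spec.map (CommRingCat.ofHom f)) h2

end Galois

end QuotientToric

namespace QuotientToric

/-! ### The orthogonal idempotents of the group algebra. -/

section Idempotents

set_option linter.unusedSectionVars false

variable {G : Type} [CommGroup G] [Fintype G] (R : Type) [CommRing R] [Algebra (charField G) R]

lemma coeff_idempotent (χ : G →* ℂˣ) (g : G) : (idempotent R χ).coeff g =
    algebraMap (charField G) R ((Fintype.card G : charField G)⁻¹ * charVal χ g⁻¹) :=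
  coeff_ofFun _ g

open Classical in
lemma idempotent_mul_idempotent (χ ψ : G →* ℂˣ) :
    idempotent R χ * idempotent R ψ = if χ = ψ then idempotent R ψ else 0 := by
  ext g
  rw [coeff_mul_fintype]
  simp only [coeff_idempotent, ← map_mul, ← map_sum]
  have h1 : ∑ h : G, (Fintype.card G : charField G)⁻¹ * charVal χ h⁻¹ *
      ((Fintype.card G : charField G)⁻¹ * charVal ψ (h⁻¹ * g)⁻¹) =
      (if χ = ψ then 1 else 0) * ((Fintype.card G : charField G)⁻¹ * charVal ψ g⁻¹) := by
    rw [← orthogonality_elements, Finset.sum_mul]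
    refine Finset.sum_congr rfl fun h _ => ?_
    rw [mul_inv_rev, inv_inv, map_mul]
    ring
  rw [h1]
  split_ifs
  · rw [one_mul, coeff_idempotent]
  · rw [zero_mul, map_zero]
    rfl

lemma sum_idempotent : ∑ χ : G →* ℂˣ, idempotent R χ = 1 := by
  classical
  ext g
  have h1 := orthogonality_chars g 1
  simp only [map_one, mul_one] at h1
  rw [MonoidAlgebra.coeff_sum, Finset.sum_apply']
  simp only [coeff_idempotent]
  rw [← map_sum, h1, MonoidAlgebra.one_def, MonoidAlgebra.coeff_single, Finsupp.single_apply]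
  simp only [eq_comm (a := g)]
  split_ifs <;> simp

variable {R}

lemma sum_smul_idempotent_mul (a b : (G →* ℂˣ) → R) :
    (∑ χ, a χ • idempotent R χ) * ∑ χ, b χ • idempotent R χ = ∑ χ, (a χ * b χ) • idempotent R χ := by
  classical
  rw [Finset.sum_mul_sum]
  refine Finset.sum_congr rfl fun χ _ => ?_
  simp only [smul_mul_smul_comm, idempotent_mul_idempotent]
  simp

/-- The unit `∑ a_χ v_χ` of the group algebra. -/
def idempotentUnit (a : (G →* ℂˣ) → Rˣ) : (MonoidAlgebra R G)ˣ where
  val := ∑ χ, (a χ : R) • idempotent R χ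
  inv := ∑ χ, ((a χ)⁻¹ : Rˣ).val • idempotent R χ
  val_inv := by
    rw [sum_smul_idempotent_mul]
    simp only [Units.mul_inv, one_smul, sum_idempotent]
  inv_val := by
    rw [sum_smul_idempotent_mul]
    simp only [Units.inv_mul, one_smul, sum_idempotent]

lemma coeff_sum_smul_idempotent (a : (G →* ℂˣ) → R) (g : G) :
    (∑ χ, a χ • idempotent R χ).coeff g = ∑ χ, a χ *
      algebraMap (charField G) R ((Fintype.card G : charField G)⁻¹ * charVal χ g⁻¹) := by
  rw [MonoidAlgebra.coeff_sum, Finset.sum_apply']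
  refine Finset.sum_congr rfl fun χ _ => ?_
  rw [MonoidAlgebra.coeff_smul, Finsupp.smul_apply, coeff_idempotent, smul_eq_mul]

end Idempotents

/-! ### Fourier inversion between the coordinates `X_g` and the characters of `𝒢`. -/

section UnitsTorus

set_option linter.unusedSectionVars false

variable {G : Type} [CommGroup G] [Fintype G]

lemma unitsRing_ringHom_ext {R : Type} [CommRing R] {f f' : UnitsRing G →+* R}
    (h : ∀ g : G, f (unitsX g) = f' (unitsX g)) : f = f' := by
  refine IsLocalization.ringHom_ext (Submonoid.powers (groupDet G)) ?_
  exact MvPolynomial.ringHom_ext (fun a => DFunLike.congr_fun (RingHom.ext_rat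
    ((f.comp (algebraMap (MvPolynomial G ℚ) (UnitsRing G))).comp MvPolynomial.C)
    ((f'.comp (algebraMap (MvPolynomial G ℚ) (UnitsRing G))).comp MvPolynomial.C)) a) h

lemma isUnit_ofFun_ringHom {R : Type} [CommRing R] (f : UnitsRing G →+* R) :
    IsUnit (ofFun fun g : G => f (unitsX g)) := by
  have h1 := (genUnit G).isUnit.map (MonoidAlgebra.mapRingHom G f)
  have h2 : MonoidAlgebra.mapRingHom G f (genUnit G : MonoidAlgebra (UnitsRing G) G) =
      ofFun fun g : G => f (unitsX g) := by
    ext g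
    rw [coeff_ofFun, ← coeff_genUnit]
    rfl
  rwa [h2] at h1

lemma coord_zero : coord (0 : unitsChars G) = 0 := map_zero (coordEquiv G)

/-- The homomorphism `E[M'] → R` with given values on the basis of `M'`. -/
def unitsCharsLift {E R : Type} [Field E] [CommRing R] [Algebra E R] (z : (G →* ℂˣ) → Rˣ) :
    AddMonoidAlgebra E (unitsChars G) →ₐ[E] R :=
  AddMonoidAlgebra.lift _ _ _
    { toFun := fun u => ((∏ χ, z χ ^ coord u.toAdd χ : Rˣ) : R)
      map_one' := by
        simp only [toAdd_one, coord_zero, Pi.zero_apply, zpow_zero, Finset.prod_const_one,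
          Units.val_one]
      map_mul' := fun u w => by
        simp only [toAdd_mul, coord_add, Pi.add_apply, zpow_add, Finset.prod_mul_distrib,
          Units.val_mul] }

lemma unitsCharsLift_single {E R : Type} [Field E] [CommRing R] [Algebra E R]
    (z : (G →* ℂˣ) → Rˣ) (u : unitsChars G) :
    unitsCharsLift (E := E) z (.single u 1) = ((∏ χ, z χ ^ coord u χ : Rˣ) : R) := by
  refine (AddMonoidAlgebra.lift_single _ _ _).trans ?_
  rw [one_smul]
  rfl

lemma unitsCharsLift_dualVec {E R : Type} [Field E] [CommRing R] [Algebra E R]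
    (z : (G →* ℂˣ) → Rˣ) (χ : G →* ℂˣ) : unitsCharsLift (E := E) z (.single (dualVec χ) 1) = z χ := by
  classical
  rw [unitsCharsLift_single, Finset.prod_eq_single χ
    (fun ψ _ hψ => by rw [coord_dualVec, if_neg hψ.symm, zpow_zero])
    (fun h => absurd (Finset.mem_univ χ) h), coord_dualVec, if_pos rfl, zpow_one]


lemma isUnit_single_dualVec (χ : G →* ℂˣ) : IsUnit
    (AddMonoidAlgebra.single (dualVec χ) 1 : AddMonoidAlgebra (charField G) (unitsChars G)) :=
  isUnit_single _

variable (G) in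
/-- The homomorphism `ℚ[𝒢] → E[M']`, `X_g ↦ (1/n) ∑ χ(g⁻¹) e^{v_χ^∨}`. -/
def unitsToChars : UnitsRing G →+* AddMonoidAlgebra (charField G) (unitsChars G) :=
  (unitsLift (idempotentUnit fun χ => (isUnit_single_dualVec χ).unit) :
    UnitsRing G →ₐ[ℚ] AddMonoidAlgebra (charField G) (unitsChars G)).toRingHom

lemma unitsToChars_X (g : G) : unitsToChars G (unitsX g) =
    ∑ χ, .single (dualVec χ) ((Fintype.card G : charField G)⁻¹ * charVal χ g⁻¹) := by
  refine (unitsLift_X _ g).trans ?_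
  refine (coeff_sum_smul_idempotent _ g).trans ?_
  refine Finset.sum_congr rfl fun χ _ => ?_
  change AddMonoidAlgebra.single (dualVec χ) 1 * AddMonoidAlgebra.single 0 _ = _
  rw [AddMonoidAlgebra.single_mul_single, add_zero, one_mul]
  rfl

section Generic

variable {E : Type} [Field E] (e : charField G →+* E)

/-- The homomorphism `ℚ[𝒢] → E[M']`, `X_g ↦ (1/n) ∑ χ(g⁻¹) e^{v_χ^∨}`, for a field `E` containing
the values of the characters. -/
def unitsToCharsMap : UnitsRing G →+* AddMonoidAlgebra E (unitsChars G) :=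
  (AddMonoidAlgebra.mapRingHom _ e).comp (unitsToChars G)

lemma unitsToCharsMap_X (g : G) : unitsToCharsMap e (unitsX g) =
    ∑ χ, .single (dualVec χ) (e ((Fintype.card G : charField G)⁻¹ * charVal χ g⁻¹)) := by
  refine (congrArg (AddMonoidAlgebra.mapRingHom _ e) (unitsToChars_X g)).trans ?_
  rw [map_sum]
  refine Finset.sum_congr rfl fun χ _ => ?_
  exact AddMonoidAlgebra.mapRingHom_single _ _ _

variable {R : Type} [CommRing R] [Algebra E R] (i : UnitsRing G →+* R)

/-- The function `∑ χ(g) X_g`. -/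
def charSum (χ : G →* ℂˣ) : R := ∑ g, algebraMap E R (e (charVal χ g)) * i (unitsX g)

/-- A character extends to a ring homomorphism `R[G] → R`, and the sum is the image of the unit `∑
i(X_g) g`. -/
lemma isUnit_charSum (χ : G →* ℂˣ) : IsUnit (charSum e i χ) := by
  have h1 := (isUnit_ofFun_ringHom i).map (MonoidAlgebra.lift R R G
    (((algebraMap E R : E →* R).comp (e : charField G →* E)).comp (charVal χ)))
  have h2 : MonoidAlgebra.lift R R G
      (((algebraMap E R : E →* R).comp (e : charField G →* E)).comp (charVal χ))
      (ofFun fun g => i (unitsX g)) = charSum e i χ := by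
    rw [ofFun, map_sum]
    refine Finset.sum_congr rfl fun g _ => ?_
    rw [MonoidAlgebra.lift_single, smul_eq_mul, mul_comm]
    rfl
  rwa [h2] at h1

/-- Fourier inversion: summing over the characters first isolates the term at `g`. -/
lemma sum_charSum (g : G) : ∑ χ : G →* ℂˣ, charSum e i χ * algebraMap E R
    (e ((Fintype.card G : charField G)⁻¹ * charVal χ g⁻¹)) = i (unitsX g) := by
  classical
  have h1 : ∀ χ : G →* ℂˣ, charSum e i χ * algebraMap E R
      (e ((Fintype.card G : charField G)⁻¹ * charVal χ g⁻¹)) = ∑ h, algebraMap E R (e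
        ((Fintype.card G : charField G)⁻¹ * charVal χ g⁻¹ * charVal χ h)) * i (unitsX h) :=
    fun χ => by
    rw [charSum, Finset.sum_mul]
    refine Finset.sum_congr rfl fun h _ => ?_
    rw [map_mul e _ (charVal χ h), map_mul (algebraMap E R) _ (e (charVal χ h))]
    ring
  simp only [h1]
  rw [Finset.sum_comm]
  simp only [← Finset.sum_mul, ← map_sum, orthogonality_chars]
  simp

/-- The homomorphism `E[M'] → R`, `e^{v_χ^∨} ↦ ∑ χ(g) X_g`. -/
def charsHom : AddMonoidAlgebra E (unitsChars G) →ₐ[E] R :=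
  unitsCharsLift fun χ => (isUnit_charSum e i χ).unit

lemma charsHom_dualVec (χ : G →* ℂˣ) :
    charsHom e i (.single (dualVec χ) 1) = charSum e i χ :=
  unitsCharsLift_dualVec _ χ

lemma charsHom_unitsToCharsMap (x : UnitsRing G) : charsHom e i (unitsToCharsMap e x) = i x := by
  have h1 : (charsHom e i).toRingHom.comp (unitsToCharsMap e) = i := by
    refine unitsRing_ringHom_ext fun g => ?_
    change charsHom e i (unitsToCharsMap e (unitsX g)) = _
    rw [unitsToCharsMap_X, map_sum, ← sum_charSum e]
    refine Finset.sum_congr rfl fun χ _ => ?_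
    rw [← charsHom_dualVec]
    refine Eq.trans ?_ (mul_comm _ _)
    refine Eq.trans ?_ (Algebra.smul_def _ _)
    rw [← map_smul, AddMonoidAlgebra.smul_single, smul_eq_mul, mul_one]
  exact DFunLike.congr_fun h1 x

/-- The inversion in the other direction: summing over the group first isolates the character `χ`.
-/
lemma charSum_unitsToCharsMap (χ : G →* ℂˣ) :
    charSum e (unitsToCharsMap e) χ = .single (dualVec χ) 1 := by
  classical
  have h1 : ∀ g, algebraMap E (AddMonoidAlgebra E (unitsChars G))
      (e (charVal χ g)) * unitsToCharsMap e (unitsX g) = ∑ ψ, .single (dualVec ψ)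
        (e ((Fintype.card G : charField G)⁻¹ * charVal ψ g⁻¹ * charVal χ g)) := fun g => by
    rw [unitsToCharsMap_X, Finset.mul_sum]
    refine Finset.sum_congr rfl fun ψ _ => ?_
    rw [← Algebra.smul_def, AddMonoidAlgebra.smul_single, smul_eq_mul, ← map_mul e, mul_comm]
  rw [charSum]
  simp only [h1]
  rw [Finset.sum_comm]
  have h2 : ∀ ψ : G →* ℂˣ, ∑ g, (AddMonoidAlgebra.single (dualVec ψ)
      (e ((Fintype.card G : charField G)⁻¹ * charVal ψ g⁻¹ * charVal χ g)) :
      AddMonoidAlgebra E (unitsChars G)) =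
      .single (dualVec ψ) (e (if ψ = χ then 1 else 0)) := fun ψ => by
    rw [← orthogonality_elements, map_sum]
    exact (map_sum (AddMonoidAlgebra.lsingle (R := E) (dualVec ψ)) _ _).symm
  simp only [h2]
  rw [Finset.sum_eq_single χ
    (fun ψ _ hψ => by rw [if_neg hψ, map_zero]; exact AddMonoidAlgebra.single_zero _)
    (fun h => absurd (Finset.mem_univ χ) h), if_pos rfl, map_one]

lemma map_charSum {R' : Type} [CommRing R'] [Algebra E R'] (i' : UnitsRing G →+* R')
    (s : R →ₐ[E] R') (h : ∀ x, s (i x) = i' x) (χ : G →* ℂˣ) :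
    s (charSum e i χ) = charSum e i' χ := by
  rw [charSum, charSum, map_sum]
  refine Finset.sum_congr rfl fun g _ => ?_
  rw [map_mul, AlgHom.commutes, h]

lemma charsHom_leftInverse (s : R →ₐ[E] AddMonoidAlgebra E (unitsChars G))
    (h : ∀ x, s (i x) = unitsToCharsMap e x) (x : AddMonoidAlgebra E (unitsChars G)) :
    s (charsHom e i x) = x := by
  have h1 : (s.comp (charsHom e i)).toRingHom = RingHom.id _ := by
    refine unitsChars_ringHom_ext (fun a => (s.comp (charsHom e i)).commutes a) fun χ => ?_
    change s (charsHom e i (.single (dualVec χ) 1)) = _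
    rw [charsHom_dualVec, map_charSum e i _ s h, charSum_unitsToCharsMap]
    rfl
  exact DFunLike.congr_fun h1 x

end Generic

end UnitsTorus

end QuotientToric

namespace QuotientToric

/-! ### Extension of scalars and group-like elements. -/

section ExtendScalars

set_option linter.unusedSectionVars false

variable {E A B : Type} [Field E] [Algebra ℚ E] [CommRing A] [Algebra E A] [CommRing B]

/-- The homomorphism `E ⊗ B → A` extending `B → A`. -/
def tensorLift [Algebra ℚ B] (s : B →+* A) : E ⊗[ℚ] B →ₐ[E] A :=
  let _ : Algebra ℚ A := Algebra.compHom A (algebraMap ℚ E)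
  have : IsScalarTower ℚ E A := IsScalarTower.of_algebraMap_eq' rfl
  Algebra.TensorProduct.productLeftAlgHom (Algebra.ofId _ _) (s.toRatAlgHom)

lemma tensorLift_tmul [Algebra ℚ B] (s : B →+* A) (a : E) (b : B) :
    tensorLift s (a ⊗ₜ b) = a • s b := by
  rw [Algebra.smul_def]
  rfl

lemma comp_tensorLift [Algebra ℚ B] (s : B →+* A) (h : A →ₐ[E] E ⊗[ℚ] B)
    (hs : ∀ b, h (s b) = 1 ⊗ₜ b) (x : E ⊗[ℚ] B) : h (tensorLift s x) = x := by
  induction x with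
  | zero => rw [map_zero, map_zero]
  | add x y hx hy => rw [map_add, map_add, hx, hy]
  | tmul a b =>
    rw [tensorLift_tmul, map_smul, hs, TensorProduct.smul_tmul', smul_eq_mul, mul_one]

open Classical in
-- On points the sum is the value of the multiplicative extension of `χ` at `∑ x_g g`. In the
-- comultiplication this is the splitting `χ(g) = χ(h) χ(h⁻¹g)`.
lemma isGroupLikeElem_sum_tmul [Bialgebra ℚ B] {G : Type} [Group G] [Fintype G] (x : G → B)
    (hcounit : ∀ g, Coalgebra.counit (R := ℚ) (x g) = if g = 1 then 1 else 0)
    (hcomul : ∀ g, Coalgebra.comul (R := ℚ) (x g) = ∑ h, x h ⊗ₜ x (h⁻¹ * g)) (χ : G →* E) :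
    IsGroupLikeElem E (∑ g, χ g ⊗ₜ[ℚ] x g) where
  counit_eq_one := by
    have h1 : ∀ g : G, Coalgebra.counit (R := E) (χ g ⊗ₜ[ℚ] x g) = if g = 1 then 1 else 0 :=
      fun g => by
      rw [TensorProduct.counit_tmul, hcounit]
      split_ifs with h
      · rw [h, map_one, one_smul]; rfl
      · rw [zero_smul]
    rw [map_sum]
    simp only [h1]
    simp
  comul_eq_tmul_self := by
    have h1 : ∀ g : G, Coalgebra.comul (R := E) (χ g ⊗ₜ[ℚ] x g) =
        ∑ h, (χ h ⊗ₜ[ℚ] x h) ⊗ₜ[E] (χ (h⁻¹ * g) ⊗ₜ[ℚ] x (h⁻¹ * g)) := fun g => by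
      rw [TensorProduct.comul_tmul, hcomul, TensorProduct.tmul_sum, map_sum]
      refine Finset.sum_congr rfl fun h _ => ?_
      have h2 : Coalgebra.comul (R := E) (χ g) = χ h ⊗ₜ χ (h⁻¹ * g) := by
        rw [CommSemiring.comul_apply]
        have : χ g = χ h * χ (h⁻¹ * g) := by rw [← map_mul, mul_inv_cancel_left]
        rw [this, ← smul_eq_mul, ← TensorProduct.smul_tmul, smul_eq_mul, mul_one]
      rw [h2]
      rfl
    rw [map_sum, TensorProduct.sum_tmul]
    simp only [h1, TensorProduct.tmul_sum]
    rw [Finset.sum_comm]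
    refine Finset.sum_congr rfl fun h _ => ?_
    exact Equiv.sum_comp (Equiv.mulLeft h⁻¹) fun g =>
      (χ h ⊗ₜ[ℚ] x h) ⊗ₜ[E] (χ g ⊗ₜ[ℚ] x g)

lemma addMonoidAlgebra_algHom_ext {N C : Type} [AddCommMonoid N] [CommRing C] [Algebra E C]
    {f f' : AddMonoidAlgebra E N →ₐ[E] C} (h : ∀ u, f (.single u 1) = f' (.single u 1)) : f = f' :=
  AddMonoidAlgebra.algHom_ext h (Subsingleton.elim _ _)

/-- An isomorphism from a monoid algebra is one of bialgebras if it maps the monoid to group-like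
elements. -/
def bialgEquivOfGroupLike {N C : Type} [AddCommMonoid N] [CommRing C] [Bialgebra E C]
    (f : AddMonoidAlgebra E N ≃ₐ[E] C) (hf : ∀ u, IsGroupLikeElem E (f (.single u 1))) :
    AddMonoidAlgebra E N ≃ₐc[E] C :=
  BialgEquiv.ofAlgEquiv f
    (addMonoidAlgebra_algHom_ext fun u => (hf u).counit_eq_one.trans
      (AddMonoidAlgebra.isGroupLikeElem_single_one (R := E) u).counit_eq_one.symm)
    (addMonoidAlgebra_algHom_ext fun u => by
      refine Eq.trans ?_ (hf u).comul_eq_tmul_self.symm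
      exact congrArg (Algebra.TensorProduct.map (f : AddMonoidAlgebra E N →ₐ[E] C)
        (f : AddMonoidAlgebra E N →ₐ[E] C))
        (AddMonoidAlgebra.isGroupLikeElem_single_one (R := E) u).comul_eq_tmul_self)

end ExtendScalars

end QuotientToric

namespace QuotientToric

/-! ### Descending group-like elements and invariants to subrings. -/

section Descent

set_option linter.unusedSectionVars false

variable {E : Type} [Field E]

/-- Over a field `f ⊗ f` is injective when `f` is, so the comultiplication may be compared in the
larger bialgebra. -/
lemma isGroupLikeElem_of_map {X Y : Type} [CommRing X] [Bialgebra E X] [CommRing Y] [Bialgebra E Y]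
    (f : X →ₐc[E] Y) (hf : Function.Injective f) {x : X} (h : IsGroupLikeElem E (f x)) :
    IsGroupLikeElem E x where
  counit_eq_one := by
    rw [← h.counit_eq_one]
    exact (CoalgHomClass.counit_comp_apply f x).symm
  comul_eq_tmul_self := by
    have h1 : Function.Injective (TensorProduct.map (f : X →ₗ[E] Y) (f : X →ₗ[E] Y)) :=
      TensorProduct.map_injective_of_flat_flat _ _ hf hf
    apply h1
    refine (CoalgHomClass.map_comp_comul_apply f x).trans ?_
    exact h.comul_eq_tmul_self

/-- Two injective homomorphisms of algebras with the same range have isomorphic sources. -/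
def algEquivOfRangeEq {X Y Z : Type} [CommRing X] [Algebra E X] [CommRing Y] [Algebra E Y]
    [CommRing Z] [Algebra E Z] (f : X →ₐ[E] Z) (g : Y →ₐ[E] Z) (hf : Function.Injective f)
    (hg : Function.Injective g) (h : f.toRingHom.range = g.toRingHom.range) : X ≃ₐ[E] Y :=
  AlgEquiv.ofRingEquiv (f := equivOfRangeEq f.toRingHom g.toRingHom hf hg h) fun a =>
    hg ((equivOfRangeEq_apply f.toRingHom g.toRingHom hf hg h _).trans
      ((f.commutes a).trans (g.commutes a).symm))

lemma algEquivOfRangeEq_apply {X Y Z : Type} [CommRing X] [Algebra E X] [CommRing Y] [Algebra E Y]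
    [CommRing Z] [Algebra E Z] (f : X →ₐ[E] Z) (g : Y →ₐ[E] Z) (hf : Function.Injective f)
    (hg : Function.Injective g) (h : f.toRingHom.range = g.toRingHom.range) (x : X) :
    g (algEquivOfRangeEq f g hf hg h x) = f x :=
  equivOfRangeEq_apply f.toRingHom g.toRingHom hf hg h x

variable [Algebra ℚ E] {B C : Type} [CommRing B] [Algebra ℚ B] [CommRing C] [Algebra ℚ C]

lemma lTensor_algHom_injective (i : C →ₐ[ℚ] B) (hi : Function.Injective i) :
    Function.Injective (Algebra.TensorProduct.map (AlgHom.id E E) i) :=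
  Module.Flat.lTensor_preserves_injective_linearMap (M := E) i.toLinearMap hi

lemma map_retraction {G : Type} [Fintype G] (ρ : G → B →ₐ[ℚ] B) (i : C →ₐ[ℚ] B) (r : B →ₗ[ℚ] C)
    (hr : ∀ b, i (r b) = (Fintype.card G : ℚ)⁻¹ • ∑ h, ρ h b) (x : E ⊗[ℚ] B) :
    Algebra.TensorProduct.map (AlgHom.id E E) i (TensorProduct.map LinearMap.id r x) =
      (Fintype.card G : ℚ)⁻¹ • ∑ h, Algebra.TensorProduct.map (AlgHom.id E E) (ρ h) x := by
  induction x with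
  | zero => simp
  | add x y hx hy => simp only [map_add, hx, hy, Finset.sum_add_distrib, smul_add]
  | tmul a b =>
    simp only [TensorProduct.map_tmul, Algebra.TensorProduct.map_tmul, hr, LinearMap.id_apply,
      AlgHom.id_apply, ← TensorProduct.tmul_sum, TensorProduct.tmul_smul]

/-- An invariant equals its average, and the retraction `r` presents averages as elements of the
image, also after extension of scalars. -/
lemma mem_range_of_invariant {G : Type} [Group G] [Fintype G] (ρ : G → B →ₐ[ℚ] B) (i : C →ₐ[ℚ] B)
    (r : B →ₗ[ℚ] C) (hr : ∀ b, i (r b) = (Fintype.card G : ℚ)⁻¹ • ∑ h, ρ h b) {x : E ⊗[ℚ] B}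
    (hx : ∀ h, Algebra.TensorProduct.map (AlgHom.id E E) (ρ h) x = x) :
    ∃ y, Algebra.TensorProduct.map (AlgHom.id E E) i y = x := by
  have hn : (Fintype.card G : ℚ) ≠ 0 := by exact_mod_cast Fintype.card_ne_zero
  refine ⟨_, (map_retraction ρ i r hr x).trans ?_⟩
  simp only [hx, Finset.sum_const, Finset.card_univ]
  rw [← Nat.cast_smul_eq_nsmul ℚ, smul_smul, inv_mul_cancel₀ hn, one_smul]

lemma map_invariant {G : Type} (ρ : G → B →ₐ[ℚ] B) (i : C →ₐ[ℚ] B)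
    (h : ∀ g c, ρ g (i c) = i c) (g : G) (y : E ⊗[ℚ] C) :
    Algebra.TensorProduct.map (AlgHom.id E E) (ρ g)
      (Algebra.TensorProduct.map (AlgHom.id E E) i y) =
      Algebra.TensorProduct.map (AlgHom.id E E) i y := by
  induction y with
  | zero => simp
  | add x y hx hy => simp only [map_add, hx, hy]
  | tmul a b => simp [h]

end Descent

end QuotientToric

namespace QuotientToric

/-! ### The split form of the torus `𝒢` and the translations by `G`. -/

section Model

set_option linter.unusedSectionVars false

open Classical in
/-- A presentation of the bialgebra `B` as the coordinate ring of `𝒢`, with the translations by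
`G`, together with the coefficients along the idempotents over a field `E` containing the values
of the characters. -/
structure UnitsModel {G : Type} [CommGroup G] [Fintype G] {E : Type} [Field E]
    (e : charField G →+* E) (B : Type) [CommRing B] [Bialgebra ℚ B] where
  hom : UnitsRing G →+* B
  surjective : Function.Surjective hom
  toChars : B →+* AddMonoidAlgebra E (unitsChars G)
  toChars_hom : ∀ x, toChars (hom x) = unitsToCharsMap e x
  counit_hom : ∀ g, Coalgebra.counit (R := ℚ) (hom (unitsX g)) = if g = 1 then 1 else 0
  comul_hom : ∀ g, Coalgebra.comul (R := ℚ) (hom (unitsX g)) =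
    ∑ h, hom (unitsX h) ⊗ₜ hom (unitsX (h⁻¹ * g))
  act : G → B →ₐ[ℚ] B
  act_hom : ∀ h g, act h (hom (unitsX g)) = hom (unitsX (h⁻¹ * g))

variable {G : Type} [CommGroup G] [Fintype G]

lemma map_unitsCharsLift_single {E R R' : Type} [Field E] [CommRing R] [Algebra E R]
    [CommRing R'] [Algebra E R'] (f : R →ₐ[E] R') (z : (G →* ℂˣ) → Rˣ) (u : unitsChars G) :
    f (unitsCharsLift (E := E) z (.single u 1)) =
      ((∏ χ, Units.map (f : R →* R') (z χ) ^ coord u χ : R'ˣ) : R') := by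
  rw [unitsCharsLift_single]
  have h1 := map_prod (Units.map (f : R →* R')) (fun χ => z χ ^ coord u χ) Finset.univ
  simp only [map_zpow] at h1
  rw [← h1]
  rfl

lemma isGroupLikeElem_finsetProd {E R ι : Type} [Field E] [CommRing R] [Bialgebra E R]
    (s : Finset ι) (f : ι → R) (h : ∀ i ∈ s, IsGroupLikeElem E (f i)) :
    IsGroupLikeElem E (∏ i ∈ s, f i) := by
  classical
  induction s using Finset.induction_on with
  | empty => rw [Finset.prod_empty]; exact .one
  | insert a s ha ih =>
    rw [Finset.prod_insert ha]
    exact (h a (Finset.mem_insert_self a s)).mul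
      (ih fun i hi => h i (Finset.mem_insert_of_mem hi))

lemma isGroupLikeElem_zpow {E R : Type} [Field E] [CommRing R] [Bialgebra E R] (z : Rˣ)
    (h : IsGroupLikeElem E (z : R)) (m : ℤ) : IsGroupLikeElem E ((z ^ m : Rˣ) : R) := by
  obtain ⟨n, rfl | rfl⟩ := m.eq_nat_or_neg
  · rw [zpow_natCast, Units.val_pow_eq_pow_val]
    exact h.pow
  · rw [zpow_neg, isGroupLikeElem_unitsInv, zpow_natCast, Units.val_pow_eq_pow_val]
    exact h.pow

lemma isGroupLikeElem_unitsCharsLift {E R : Type} [Field E] [CommRing R] [Bialgebra E R]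
    (z : (G →* ℂˣ) → Rˣ) (h : ∀ χ, IsGroupLikeElem E (z χ : R)) (u : unitsChars G) :
    IsGroupLikeElem E (unitsCharsLift (E := E) z (.single u 1)) := by
  rw [unitsCharsLift_single, Units.coe_prod]
  exact isGroupLikeElem_finsetProd _ _ fun χ _ => isGroupLikeElem_zpow _ (h χ) _

lemma charVal_charWeight_units (a : (G →* ℂˣ) → ℤ) (h : G) : charVal (charWeight a) h =
    ((∏ χ : G →* ℂˣ, (charVal χ).toHomUnits h ^ a χ : (charField G)ˣ) : charField G) := by
  apply Subtype.ext
  change ((charWeight a h : ℂˣ) : ℂ) = algebraMap (charField G) ℂ _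
  rw [charWeight_apply, Units.coe_prod, Units.coe_prod, map_prod]
  refine Finset.prod_congr rfl fun χ _ => ?_
  rw [Units.val_zpow_eq_zpow_val, Units.val_zpow_eq_zpow_val, map_zpow₀]
  rfl

namespace UnitsModel

variable {E : Type} [Field E] [Algebra ℚ E] {e : charField G →+* E} {B : Type} [CommRing B]
  [Bialgebra ℚ B] (m : UnitsModel e B)

/-- The inclusion `ℚ[𝒢] → E[𝒢]`. -/
def incl : UnitsRing G →+* E ⊗[ℚ] B :=
  (Algebra.TensorProduct.includeRight : B →ₐ[ℚ] E ⊗[ℚ] B).toRingHom.comp m.hom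

lemma incl_apply (x : UnitsRing G) : m.incl x = (1 : E) ⊗ₜ[ℚ] m.hom x := rfl

lemma charsHom_toChars (b : B) : charsHom e m.incl (m.toChars b) = (1 : E) ⊗ₜ[ℚ] b := by
  obtain ⟨x, rfl⟩ := m.surjective b
  rw [m.toChars_hom]
  exact charsHom_unitsToCharsMap e m.incl x

lemma tensorLift_incl (x : UnitsRing G) :
    tensorLift (E := E) m.toChars (m.incl x) = unitsToCharsMap e x := by
  rw [incl_apply, tensorLift_tmul, one_smul, m.toChars_hom]

lemma charSum_eq (χ : G →* ℂˣ) :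
    charSum e m.incl χ = ∑ g, e (charVal χ g) ⊗ₜ[ℚ] m.hom (unitsX g) := by
  refine Finset.sum_congr rfl fun g _ => ?_
  refine (Algebra.TensorProduct.tmul_mul_tmul _ _ _ _).trans ?_
  rw [mul_one, one_mul]
  rfl

lemma isGroupLikeElem_charSum (χ : G →* ℂˣ) :
    IsGroupLikeElem E (charSum e m.incl χ) := by
  rw [charSum_eq]
  exact isGroupLikeElem_sum_tmul _ m.counit_hom m.comul_hom
    ((e : charField G →* E).comp (charVal χ))

/-- The isomorphism `E[M'] ≅ E[𝒢]` of algebras. -/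
def algEquiv : AddMonoidAlgebra E (unitsChars G) ≃ₐ[E] E ⊗[ℚ] B :=
  AlgEquiv.ofAlgHom (charsHom e m.incl) (tensorLift m.toChars)
    (AlgHom.ext (comp_tensorLift m.toChars _ m.charsHom_toChars))
    (AlgHom.ext (charsHom_leftInverse e m.incl _ m.tensorLift_incl))

/-- The isomorphism `E[M'] ≅ E[𝒢]` of bialgebras. -/
def bialgEquiv :
    AddMonoidAlgebra E (unitsChars G) ≃ₐc[E] E ⊗[ℚ] B :=
  bialgEquivOfGroupLike m.algEquiv
    (isGroupLikeElem_unitsCharsLift _ m.isGroupLikeElem_charSum)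

lemma bialgEquiv_apply (x : AddMonoidAlgebra E (unitsChars G)) :
    m.bialgEquiv x = charsHom e m.incl x := rfl

lemma bialgEquiv_toChars (b : B) : m.bialgEquiv (m.toChars b) = (1 : E) ⊗ₜ[ℚ] b := m.charsHom_toChars b

lemma bialgEquiv_dualVec (χ : G →* ℂˣ) :
    m.bialgEquiv (.single (dualVec χ) 1) = charSum e m.incl χ := charsHom_dualVec e m.incl χ

lemma tmul_eq_sum (g : G) : (1 : E) ⊗ₜ[ℚ] m.hom (unitsX g) =
    ∑ χ : G →* ℂˣ, m.bialgEquiv (.single (dualVec χ) 1) *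
      algebraMap E (E ⊗[ℚ] B) (e ((Fintype.card G : charField G)⁻¹ * charVal χ g⁻¹)) := by
  simp only [bialgEquiv_dualVec]
  exact (sum_charSum e m.incl g).symm

/-- The translation on `E[𝒢]`. -/
def actTensor (h : G) : E ⊗[ℚ] B →ₐ[E] E ⊗[ℚ] B :=
  Algebra.TensorProduct.map (AlgHom.id _ _) (m.act h)

/-- Reindexing the sum by `g ↦ h g` pulls out the factor `χ(h)`. -/
lemma actTensor_charSum (h : G) (χ : G →* ℂˣ) :
    m.actTensor h (charSum e m.incl χ) = e (charVal χ h) • charSum e m.incl χ := by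
  rw [charSum_eq, map_sum, Finset.smul_sum, ← Equiv.sum_comp (Equiv.mulLeft h)]
  refine Finset.sum_congr rfl fun g _ => ?_
  rw [actTensor, Algebra.TensorProduct.map_tmul, m.act_hom, TensorProduct.smul_tmul',
    Equiv.coe_mulLeft, inv_mul_cancel_left, map_mul, map_mul, AlgHom.id_apply, smul_eq_mul]

/-- The translation is a ring homomorphism scaling the basis characters by `χ(h)`, so it scales
`e^u` by the product of their powers, the weight of `u` at `h`. -/
lemma actTensor_bialgEquiv_single (h : G) (u : unitsChars G) (a : E) :
    m.actTensor h (m.bialgEquiv (.single u a)) =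
      m.bialgEquiv (.single u (e (charVal (charWeight (coord u)) h) * a)) := by
  have h0 : ∀ b : E, (AddMonoidAlgebra.single u b :
      AddMonoidAlgebra E (unitsChars G)) = b • .single u 1 := fun b => by
    rw [AddMonoidAlgebra.smul_single, smul_eq_mul, mul_one]
  have h1 : m.actTensor h (m.bialgEquiv (.single u 1)) =
      e (charVal (charWeight (coord u)) h) • m.bialgEquiv (.single u 1) := by
    rw [bialgEquiv_apply]
    have hw : algebraMap E (E ⊗[ℚ] B) (e (charVal (charWeight (coord u)) h)) =
        ((∏ χ : G →* ℂˣ, Units.map (((algebraMap E (E ⊗[ℚ] B)).comp e :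
          charField G →+* E ⊗[ℚ] B) : charField G →* E ⊗[ℚ] B)
          ((charVal χ).toHomUnits h) ^ coord u χ : (E ⊗[ℚ] B)ˣ) : E ⊗[ℚ] B) := by
      rw [charVal_charWeight_units]
      have h3 := map_prod (Units.map (((algebraMap E (E ⊗[ℚ] B)).comp e :
          charField G →+* E ⊗[ℚ] B) : charField G →* E ⊗[ℚ] B)) (fun χ : G →* ℂˣ =>
            (charVal χ).toHomUnits h ^ coord u χ) Finset.univ
      simp only [map_zpow] at h3
      rw [← h3]
      rfl
    refine (map_unitsCharsLift_single (m.actTensor h) _ u).trans ?_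
    rw [Algebra.smul_def, hw, charsHom, unitsCharsLift_single, ← Units.val_mul,
      ← Finset.prod_mul_distrib]
    refine congrArg Units.val (Finset.prod_congr rfl fun χ _ => ?_)
    rw [← mul_zpow]
    refine congrArg (· ^ coord u χ) (Units.ext ?_)
    refine (m.actTensor_charSum h χ).trans ?_
    exact Algebra.smul_def _ _
  rw [h0 a, h0 (_ * a), map_smul, map_smul, map_smul, h1, smul_smul, mul_comm]

end UnitsModel

end Model

end QuotientToric

namespace QuotientToric

/-! ### `N_E` as the dual lattice of `M`. -/

section Duality

set_option linter.unusedSectionVars false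

variable {G : Type} [CommGroup G] [Fintype G] {K : ℕ} {c : Fin K → G}

lemma charWeight_add (a b : (G →* ℂˣ) → ℤ) : charWeight (a + b) = charWeight a * charWeight b := by
  refine MonoidHom.ext fun g => ?_
  change _ = charWeight a g * charWeight b g
  simp only [charWeight_apply, Pi.add_apply, zpow_add, Finset.prod_mul_distrib]

open Classical in
lemma charWeight_single (χ : G →* ℂˣ) (m : ℤ) (g : G) :
    charWeight (Pi.single χ m) g = χ g ^ m := by
  rw [charWeight_apply, Finset.prod_eq_single χ
    (fun ψ _ hψ => by rw [Pi.single_eq_of_ne hψ, zpow_zero])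
    (fun h => absurd (Finset.mem_univ χ) h), Pi.single_eq_same]

variable (hc : Function.Bijective fun x : ∀ j, Subgroup.zpowers (c j) => ∏ j, (x j : G))

/-- The character of `T_E` with given coordinates. -/
def torusCharOf (a : (G →* ℂˣ) → ℤ) (ha : charWeight a = 1) : torusChars c :=
  ⟨ofCoord a, (ofCoord_torusLattice hc a).2 ha, fun v hv => by
    rw [(Submodule.mem_bot _).1 hv, map_zero]⟩

include hc in
lemma charWeight_coord_charsIncl (u : torusChars c) : charWeight (coord (charsIncl c u)) = 1 := by
  rw [← ofCoord_torusLattice hc, ofCoord_coord]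
  exact u.2.1

include hc in
lemma exists_charsIncl_eq {u : unitsChars G} (hu : charWeight (coord u) = 1) :
    ∃ w : torusChars c, charsIncl c w = u :=
  ⟨torusCharOf hc (coord u) hu, Subtype.ext (ofCoord_coord u)⟩

lemma charsIncl_injective : Function.Injective (charsIncl c) :=
  AddSubmonoid.inclusion_injective _

variable (G) in
/-- The coordinates of the characters of `T_E`. -/
def weightKer : AddSubgroup ((G →* ℂˣ) → ℤ) where
  carrier := {a | charWeight a = 1}
  zero_mem' := by
    refine MonoidHom.ext fun g => ?_
    rw [charWeight_apply]
    exact Finset.prod_eq_one fun χ _ => zpow_zero _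
  add_mem' := fun {a b} ha hb => by
    change charWeight (a + b) = 1
    refine MonoidHom.ext fun g => ?_
    have ha' := DFunLike.congr_fun ha g
    have hb' := DFunLike.congr_fun hb g
    simp only [charWeight_apply] at ha' hb' ⊢
    simp only [Pi.add_apply, zpow_add, Finset.prod_mul_distrib, ha', hb']
    exact one_mul _
  neg_mem' := fun {a} ha => by
    change charWeight (-a) = 1
    refine MonoidHom.ext fun g => ?_
    have ha' := DFunLike.congr_fun ha g
    simp only [charWeight_apply] at ha' ⊢
    simp only [Pi.neg_apply, zpow_neg, Finset.prod_inv_distrib, ha']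
    exact inv_one

/-- A homomorphism `M → ℤ` in coordinates. -/
def pairCoord (f : torusChars c →+ ℤ) : weightKer G →+ ℤ :=
  f.comp
    { toFun := fun a => torusCharOf hc a.1 a.2
      map_zero' := Subtype.ext (LinearMap.ext fun v => by
        change ofCoord 0 v = 0
        rw [ofCoord_apply]
        exact Finset.sum_eq_zero fun χ _ => by rw [Pi.zero_apply, Int.cast_zero, zero_mul])
      map_add' := fun a b => Subtype.ext (ofCoord_add a.1 b.1) }

open Classical in
lemma card_nsmul_single_mem (χ : G →* ℂˣ) :
    (Pi.single χ (Fintype.card G : ℤ) : (G →* ℂˣ) → ℤ) ∈ weightKer G := by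
  change charWeight _ = 1
  refine MonoidHom.ext fun g => ?_
  rw [charWeight_single, zpow_natCast, ← map_pow, pow_card_eq_one, map_one]
  rfl

open Classical in
/-- The vector defined by a homomorphism `M → ℤ`. -/
def pairVec (f : torusChars c →+ ℤ) : cocharSpace G := fun χ =>
  (pairCoord hc f ⟨_, card_nsmul_single_mem χ⟩ : ℝ) / Fintype.card G

/-- The elements `n v_χ^∨` lie in `M`, and `n` times any element of `M` is an integral combination
of them, so their values under `f` determine `f`. -/
lemma ofCoord_pairVec (f : torusChars c →+ ℤ) (a : weightKer G) :
    ofCoord a.1 (pairVec hc f) = pairCoord hc f a := by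
  classical
  have hn : (Fintype.card G : ℝ) ≠ 0 := by exact_mod_cast Fintype.card_ne_zero
  have h1 : (Fintype.card G : ℤ) • a = ∑ χ, a.1 χ • ⟨_, card_nsmul_single_mem χ⟩ := by
    apply Subtype.ext
    rw [AddSubgroup.val_finsetSum]
    funext ψ
    rw [Finset.sum_apply, Finset.sum_eq_single ψ]
    · change (Fintype.card G : ℤ) * a.1 ψ = a.1 ψ * (Pi.single ψ _ : (G →* ℂˣ) → ℤ) ψ
      rw [Pi.single_eq_same, mul_comm]
    · intro χ _ hχ
      change a.1 χ * (Pi.single χ _ : (G →* ℂˣ) → ℤ) ψ = 0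
      rw [Pi.single_eq_of_ne hχ.symm, mul_zero]
    · exact fun h => absurd (Finset.mem_univ ψ) h
  have h2 := congrArg (fun x => ((pairCoord hc f x : ℤ) : ℝ)) h1
  simp only [map_sum, map_zsmul, smul_eq_mul] at h2
  push_cast at h2
  rw [ofCoord_apply]
  simp only [pairVec]
  rw [← mul_right_inj' hn, h2, Finset.mul_sum]
  refine Finset.sum_congr rfl fun χ _ => ?_
  field_simp

lemma apply_pairVec (f : torusChars c →+ ℤ) (u : torusChars c) : u.1 (pairVec hc f) = f u := by
  have h1 := ofCoord_pairVec hc f ⟨coord (charsIncl c u), charWeight_coord_charsIncl hc u⟩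
  rw [ofCoord_coord] at h1
  refine h1.trans ?_
  refine congrArg (fun w => ((f w : ℤ) : ℝ)) (Subtype.ext ?_)
  exact ofCoord_coord (charsIncl c u)

/-- A vector in the double dual of `N_E` defines a character of the group of characters. -/
def dualChar (v : cocharSpace G) (hv : ∀ a ∈ weightKer G, ∃ m : ℤ, ofCoord a v = m) :
    (G →* ℂˣ) →* ℂˣ where
  toFun χ := Units.mk0 (Complex.exp (2 * Real.pi * Complex.I * (v χ : ℝ))) (Complex.exp_ne_zero _)
  map_one' := by
    classical
    refine Units.ext ((exp_eq_one_iff_int _).2 ?_)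
    -- The basis vector of the trivial character has trivial weight, so the coordinate of `v` there
    -- is an integer.
    obtain ⟨m, hm⟩ := hv (Pi.single 1 1) (by
      change charWeight _ = 1
      refine MonoidHom.ext fun g => ?_
      rw [charWeight_single, zpow_one])
    refine ⟨m, ?_⟩
    rw [← hm, ofCoord_apply, Finset.sum_eq_single 1
      (fun ψ _ hψ => by rw [Pi.single_eq_of_ne hψ, Int.cast_zero, zero_mul])
      (fun h => absurd (Finset.mem_univ _) h), Pi.single_eq_same, Int.cast_one, one_mul]
  map_mul' χ ψ := by
    classical
    refine Units.ext ?_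
    change Complex.exp _ = Complex.exp _ * Complex.exp _
    rw [← Complex.exp_add]
    -- The element `e_{χψ} - e_χ - e_ψ` has trivial weight; integrality of `v` on it makes `χ ↦
    -- exp(2πi v_χ)` multiplicative.
    have h1 : charWeight (Pi.single (χ * ψ) 1 - Pi.single χ 1 - Pi.single ψ 1) = 1 := by
      refine MonoidHom.ext fun g => ?_
      have h2 : ((Pi.single (χ * ψ) 1 : (G →* ℂˣ) → ℤ) - Pi.single χ 1 - Pi.single ψ 1) =
        Pi.single (χ * ψ) 1 + Pi.single χ (-1) + Pi.single ψ (-1) := by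
          rw [Pi.single_neg, Pi.single_neg]; abel
      have h3 : ∀ a b : (G →* ℂˣ) → ℤ, charWeight (a + b) g = charWeight a g * charWeight b g :=
        fun a b => DFunLike.congr_fun (charWeight_add a b) g
      rw [h2, h3, h3, charWeight_single, charWeight_single, charWeight_single, zpow_one, zpow_neg,
        zpow_neg, zpow_one, zpow_one]
      change χ g * ψ g * (χ g)⁻¹ * (ψ g)⁻¹ = 1
      rw [mul_right_comm (χ g), mul_inv_cancel, one_mul, mul_inv_cancel]
    obtain ⟨m, hm⟩ := hv _ h1
    have h4 : ∀ φ : G →* ℂˣ, ofCoord (Pi.single φ 1) v = v φ := fun φ => by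
      rw [ofCoord_apply, Finset.sum_eq_single φ
        (fun ψ _ hψ => by rw [Pi.single_eq_of_ne hψ, Int.cast_zero, zero_mul])
        (fun h => absurd (Finset.mem_univ _) h), Pi.single_eq_same, Int.cast_one, one_mul]
    have h5 : ∀ a b : (G →* ℂˣ) → ℤ, ofCoord (a - b) v = ofCoord a v - ofCoord b v := fun a b => by
      rw [eq_sub_iff_add_eq, ← LinearMap.add_apply, ← ofCoord_add, sub_add_cancel]
    rw [h5, h5, h4, h4, h4] at hm
    have h6 : v (χ * ψ) = v χ + v ψ + m := by linarith
    have h7 := (exp_eq_one_iff_int (m : ℝ)).2 ⟨m, rfl⟩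
    rw [h6]
    push_cast at h7 ⊢
    rw [mul_add, Complex.exp_add, h7, mul_one, mul_add]

include hc in
-- A vector integral on `M` defines by exponentiation a character of `G^∨`. By Pontryagin duality
-- this is evaluation at some `g`, and writing `g` as a product of powers of the `c j` shows that
-- `v` is a combination of the `ω_j` modulo `N_E'`.
lemma mem_torusLattice_of_dual {v : cocharSpace G}
    (hv : ∀ a ∈ weightKer G, ∃ m : ℤ, ofCoord a v = m) : v ∈ torusLattice c := by
  classical
  let g := CommGroup.monoidHomMonoidHomEquiv G ℂ (dualChar v hv)
  have hg : ∀ χ : G →* ℂˣ, ((χ g : ℂˣ) : ℂ) =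
      Complex.exp (2 * Real.pi * Complex.I * (v χ : ℝ)) := fun χ =>
    congrArg Units.val (CommGroup.apply_monoidHomMonoidHomEquiv ℂ χ (dualChar v hv))
  obtain ⟨x, hx⟩ := hc.2 g
  have hk : ∀ j, ∃ m : ℤ, c j ^ m = (x j : G) := fun j => Subgroup.mem_zpowers_iff.1 (x j).2
  choose k hk using hk
  have hω : ∀ (h : G) (χ : G →* ℂˣ), (omegaVec h : cocharSpace G) χ = angle (χ h⁻¹ : ℂˣ) :=
    fun h χ => by simp [omegaVec, charVec, Pi.single_apply]
  -- The sign is plus because `ω_j` is built from `χ(c_j⁻¹)`: the exponentials of the coordinates of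
  -- the sum over `j` are the `χ(g)⁻¹`, cancelling those of `v`.
  have h1 : v + ∑ j, k j • omegaVec (c j) ∈ unitsLattice G := by
    rw [mem_unitsLattice]
    intro χ
    rw [← exp_eq_one_iff_int]
    have h2 : (v + ∑ j, k j • omegaVec (c j)) χ =
        v χ + ∑ j, (k j : ℝ) * angle (χ (c j)⁻¹ : ℂˣ) := by
      rw [Pi.add_apply, Finset.sum_apply]
      simp only [Pi.smul_apply, hω, zsmul_eq_mul]
    have h3 : ∀ j, Complex.exp (2 * Real.pi * Complex.I *
        ((k j : ℝ) * angle (χ (c j)⁻¹ : ℂˣ) : ℝ)) = ((χ (x j : G) : ℂˣ) : ℂ)⁻¹ := fun j => by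
      have h4 := exp_angle (norm_char χ (c j)⁻¹)
      rw [← hk, map_zpow, Units.val_zpow_eq_zpow_val, ← inv_zpow, ← Units.val_inv_eq_inv_val,
        ← map_inv, ← h4, ← Complex.exp_int_mul]
      congr 1
      rw [h4]
      push_cast
      ring
    rw [h2]
    push_cast
    rw [mul_add, Complex.exp_add, Finset.mul_sum, Complex.exp_sum, ← hg, ← hx]
    push_cast at h3
    simp only [h3]
    rw [map_prod, Units.coe_prod, Finset.prod_inv_distrib]
    refine mul_inv_cancel₀ (Finset.prod_ne_zero_iff.2 fun j _ => Units.ne_zero _)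
  have h5 : ∑ j, k j • omegaVec (c j) ∈ torusLattice c :=
    AddSubgroup.sum_mem _ fun j _ => AddSubgroup.zsmul_mem _
      (AddSubgroup.mem_sup_right (AddSubgroup.subset_closure (Set.mem_range_self j))) _
  rw [← add_sub_cancel_right v (∑ j, k j • omegaVec (c j))]
  exact AddSubgroup.sub_mem _ (AddSubgroup.mem_sup_left h1) h5

lemma pairVec_mem (f : torusChars c →+ ℤ) : pairVec hc f ∈ torusLattice c :=
  mem_torusLattice_of_dual hc fun a ha => ⟨_, ofCoord_pairVec hc f ⟨a, ha⟩⟩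

include hc in
-- `M` contains `n v_χ^∨` for every `χ`, so it separates real vectors.
lemma cochar_ext {v w : cocharSpace G} (h : ∀ u : torusChars c, u.1 v = u.1 w) : v = w := by
  classical
  have hn : (Fintype.card G : ℝ) ≠ 0 := by exact_mod_cast Fintype.card_ne_zero
  funext χ
  have h1 := h (torusCharOf hc _ (card_nsmul_single_mem χ))
  have h2 : ∀ y : cocharSpace G, ofCoord (Pi.single χ (Fintype.card G : ℤ)) y =
      Fintype.card G * y χ := fun y => by
    rw [ofCoord_apply, Finset.sum_eq_single χ
      (fun ψ _ hψ => by rw [Pi.single_eq_of_ne hψ, Int.cast_zero, zero_mul])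
      (fun h => absurd (Finset.mem_univ _) h), Pi.single_eq_same, Int.cast_natCast]
  exact mul_left_cancel₀ hn ((h2 v).symm.trans (h1.trans (h2 w)))

/-- The homomorphism `M → ℤ` defined by an element of `N_E`. -/
def pairing (v : (quotientDatum c).lattice) : torusChars c →+ ℤ where
  toFun u := (u.2.1 v.1 v.2).choose
  map_zero' := by
    have h := ((0 : torusChars c).2.1 v.1 v.2).choose_spec
    exact_mod_cast (h.symm.trans rfl : _ = (0 : ℝ))
  map_add' u w := by
    have h := ((u + w).2.1 v.1 v.2).choose_spec
    have h2 : ((u + w : torusChars c) : Module.Dual ℝ (cocharSpace G)) v.1 = u.1 v.1 + w.1 v.1 :=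
      rfl
    have h3 := h.symm.trans (h2.trans (congrArg₂ (· + ·) (u.2.1 v.1 v.2).choose_spec
      (w.2.1 v.1 v.2).choose_spec))
    exact_mod_cast h3

lemma pairing_apply (v : (quotientDatum c).lattice) (u : torusChars c) :
    (pairing v u : ℝ) = u.1 v := (u.2.1 v.1 v.2).choose_spec.symm

lemma pairing_eq {v : (quotientDatum c).lattice} {u : torusChars c} {m : ℤ} (h : u.1 v = m) :
    pairing v u = m := by
  rw [← pairing_apply] at h
  exact_mod_cast h

include hc in
lemma pairing_bijective : Function.Bijective (pairing (c := c)) := by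
  constructor
  · intro v w h
    refine Subtype.ext (cochar_ext hc fun u => ?_)
    rw [← pairing_apply, ← pairing_apply, h]
  · intro f
    refine ⟨⟨pairVec hc f, pairVec_mem hc f⟩, AddMonoidHom.ext fun u => ?_⟩
    exact pairing_eq (apply_pairVec hc f u)

end Duality

end QuotientToric

namespace QuotientToric

/-! ### The split form of `T` and its cocharacters. -/

section TorusModel

set_option linter.unusedSectionVars false

variable {G : Type} [CommGroup G] [Fintype G] {E : Type} [Field E] [Algebra ℚ E]
  {e : charField G →+* E} {B : Type} [CommRing B] [Bialgebra ℚ B]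

/-- A presentation of the bialgebra `C` as the invariants of `G` in the coordinate ring of `𝒢`. -/
structure TorusModel (m : UnitsModel e B) (C : Type) [CommRing C] [Bialgebra ℚ C] where
  val : C →ₐ[ℚ] B
  injective : Function.Injective val
  counit_val : ∀ x, Coalgebra.counit (R := ℚ) (val x) = Coalgebra.counit (R := ℚ) x
  comul_val : ∀ x, Coalgebra.comul (R := ℚ) (val x) =
    Algebra.TensorProduct.map val val (Coalgebra.comul (R := ℚ) x)
  retr : B →ₗ[ℚ] C
  val_retr : ∀ b, val (retr b) = (Fintype.card G : ℚ)⁻¹ • ∑ h, m.act h b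
  act_val : ∀ h x, m.act h (val x) = val x

namespace UnitsModel

variable (m : UnitsModel e B)

lemma coeff_actTensor (h : G) (p : AddMonoidAlgebra E (unitsChars G)) (u : unitsChars G) :
    AddMonoidAlgebra.coeff (m.bialgEquiv.symm (m.actTensor h (m.bialgEquiv p))) u =
      e (charVal (charWeight (coord u)) h) * AddMonoidAlgebra.coeff p u := by
  classical
  induction p using AddMonoidAlgebra.induction_linear with
  | zero => simp only [map_zero, AddMonoidAlgebra.coeff_zero, Finsupp.zero_apply, mul_zero]
  | add x y hx hy =>
    simp only [map_add, AddMonoidAlgebra.coeff_add, Finsupp.add_apply, mul_add, hx, hy]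
  | single w a =>
    rw [actTensor_bialgEquiv_single]
    refine (congrArg (fun q => AddMonoidAlgebra.coeff q u) (m.bialgEquiv.symm_apply_apply _)).trans ?_
    simp only [AddMonoidAlgebra.coeff_single, Finsupp.single_apply]
    split_ifs with hw
    · rw [hw]
    · rw [mul_zero]

/-- The action of an automorphism of `E` on `E[𝒢]`. -/
def galTensor (γ : E ≃ₐ[ℚ] E) (B : Type) [CommRing B] [Algebra ℚ B] : E ⊗[ℚ] B →ₐ[ℚ] E ⊗[ℚ] B :=
  Algebra.TensorProduct.map (γ : E →ₐ[ℚ] E) (AlgHom.id ℚ B)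

/-- Acting on coefficients turns `∑ χ(g) X_g` into `∑ (γχ)(g) X_g`, and `e^u` is a product of powers
of these. -/
lemma galTensor_bialgEquiv (γ : charField G ≃ₐ[ℚ] charField G) (γ' : E ≃ₐ[ℚ] E)
    (hγ : ∀ x, γ' (e x) = e (γ x)) (u : unitsChars G) (a : E) :
    galTensor γ' B (m.bialgEquiv (.single u a)) = m.bialgEquiv (.single (galUnits γ u) (γ' a)) := by
  let s : AddMonoidAlgebra E (unitsChars G) →+* AddMonoidAlgebra E (unitsChars G) :=
    (AddMonoidAlgebra.mapDomainRingHom E (galUnits γ)).comp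
      (AddMonoidAlgebra.mapRingHom _ (γ' : E →+* E))
  have hs : ∀ u a, s (.single u a) = .single (galUnits γ u) (γ' a) := fun u a => by
    change AddMonoidAlgebra.mapDomainRingHom E (galUnits γ)
      (AddMonoidAlgebra.mapRingHom _ (γ' : E →+* E) (.single u a)) = _
    rw [AddMonoidAlgebra.mapRingHom_single]
    exact AddMonoidAlgebra.mapDomain_single
  have h1 : (galTensor γ' B).toRingHom.comp (charsHom e m.incl).toRingHom =
      (charsHom e m.incl).toRingHom.comp s := by
    refine unitsChars_ringHom_ext (fun b => ?_) fun χ => ?_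
    · change galTensor γ' B (charsHom e m.incl (.single 0 b)) = charsHom e m.incl (s (.single 0 b))
      rw [hs, map_zero]
      refine (congrArg (galTensor γ' B) ((charsHom e m.incl).commutes b)).trans ?_
      refine Eq.trans ?_ ((charsHom e m.incl).commutes (γ' b)).symm
      refine (Algebra.TensorProduct.map_tmul _ _ _ _).trans ?_
      rw [map_one]
      rfl
    · change galTensor γ' B (charsHom e m.incl (.single (dualVec χ) 1)) =
        charsHom e m.incl (s (.single (dualVec χ) 1))
      rw [hs, galUnits_dualVec]
      refine (congrArg (galTensor γ' B) ((charsHom_dualVec e m.incl χ).trans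
        (m.charSum_eq χ))).trans ?_
      have h2 : γ' 1 = 1 := map_one γ'
      rw [h2]
      refine Eq.trans ?_ ((charsHom_dualVec e m.incl (galChar γ χ)).trans
        (m.charSum_eq (galChar γ χ))).symm
      refine (map_sum (galTensor γ' B) _ _).trans ?_
      refine Finset.sum_congr rfl fun g _ => ?_
      refine (Algebra.TensorProduct.map_tmul _ _ _ _).trans ?_
      exact congrArg (· ⊗ₜ[ℚ] m.hom (unitsX g)) (hγ (charVal χ g))
  have h2 := DFunLike.congr_fun h1 (.single u a)
  rw [RingHom.comp_apply, RingHom.comp_apply, hs] at h2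
  exact h2

end UnitsModel

namespace TorusModel

variable {m : UnitsModel e B} {C : Type} [CommRing C] [Bialgebra ℚ C] (t : TorusModel m C)

/-- The inclusion `E[T] ⊆ E[𝒢]`. -/
def toUnits : E ⊗[ℚ] C →ₐ[E] E ⊗[ℚ] B := Algebra.TensorProduct.map (AlgHom.id E E) t.val

/-- The inclusion of bialgebras `ℚ[T] ⊆ ℚ[𝒢]`. -/
def valBialg : C →ₐc[ℚ] B :=
  BialgHom.ofAlgHom t.val (AlgHom.ext t.counit_val) (AlgHom.ext fun x => (t.comul_val x).symm)

/-- The inclusion of bialgebras `E[T] ⊆ E[𝒢]`. -/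
def toUnitsBialg : E ⊗[ℚ] C →ₐc[E] E ⊗[ℚ] B :=
  Bialgebra.TensorProduct.map (BialgHom.id E E) t.valBialg

lemma toUnits_injective : Function.Injective t.toUnits :=
  lTensor_algHom_injective t.val t.injective

variable {K : ℕ} (c : Fin K → G)

/-- The homomorphism `E[M] ⊆ E[M'] ≅ E[𝒢]`. -/
def charsToUnits (_ : TorusModel m C) : AddMonoidAlgebra E (torusChars c) →ₐ[E] E ⊗[ℚ] B :=
  (m.algEquiv : AddMonoidAlgebra E (unitsChars G) →ₐ[E] E ⊗[ℚ] B).comp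
    (AddMonoidAlgebra.mapDomainAlgHom E E (charsIncl c))

lemma charsToUnits_apply (x : AddMonoidAlgebra E (torusChars c)) :
    t.charsToUnits c x = m.bialgEquiv (AddMonoidAlgebra.mapDomain (charsIncl c) x) := rfl

lemma charsToUnits_single (u : torusChars c) (a : E) :
    t.charsToUnits c (.single u a) = m.bialgEquiv (.single (charsIncl c u) a) := by
  rw [charsToUnits_apply, AddMonoidAlgebra.mapDomain_single]

lemma charsToUnits_injective : Function.Injective (t.charsToUnits c) :=
  m.algEquiv.injective.comp (AddMonoidAlgebra.mapDomain_injective charsIncl_injective)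

variable {c} (hc : Function.Bijective fun x : ∀ j, Subgroup.zpowers (c j) => ∏ j, (x j : G))

include hc in
-- The image of `E ⊗ ℚ[T]` is the ring of invariants of the translations. These act on `e^u` by its
-- weight, so the invariants are spanned by the `e^u` of trivial weight, that is with `u ∈ M`.
lemma range_charsToUnits : (t.charsToUnits c).toRingHom.range = t.toUnits.toRingHom.range := by
  classical
  refine le_antisymm ?_ ?_
  · rintro _ ⟨p, rfl⟩
    refine mem_range_of_invariant m.act t.val t.retr t.val_retr fun h => ?_
    change m.actTensor h (t.charsToUnits c p) = t.charsToUnits c p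
    induction p using AddMonoidAlgebra.induction_linear with
    | zero => rw [map_zero, map_zero]
    | add x y hx hy => rw [map_add, map_add, hx, hy]
    | single u a =>
      rw [charsToUnits_single, m.actTensor_bialgEquiv_single, charWeight_coord_charsIncl hc]
      have : charVal (1 : G →* ℂˣ) h = 1 := rfl
      rw [this, map_one, one_mul]
  · rintro _ ⟨y, rfl⟩
    have hy : ∀ h, m.actTensor h (t.toUnits y) = t.toUnits y := fun h =>
      map_invariant m.act t.val t.act_val h y
    obtain ⟨p, hp⟩ := m.algEquiv.surjective (t.toUnits y)
    replace hp : m.bialgEquiv p = t.toUnits y := hp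
    have h1 : ∀ u, AddMonoidAlgebra.coeff p u ≠ 0 → charWeight (coord u) = 1 := fun u hu => by
      refine MonoidHom.ext fun h => ?_
      have h2 := m.coeff_actTensor h p u
      rw [hp, hy h, ← hp] at h2
      have h3 : m.bialgEquiv.symm (m.bialgEquiv p) = p := m.bialgEquiv.symm_apply_apply p
      rw [h3] at h2
      -- Invariance under `h` says that the nonzero coefficient at `u` equals the weight at `h`
      -- times itself.
      have h4 := mul_right_cancel₀ hu ((one_mul _).trans h2)
      rw [← map_one e] at h4
      have h5 := congrArg Subtype.val (e.injective h4)
      exact Units.ext h5.symm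
    change t.toUnits y ∈ (t.charsToUnits c).toRingHom.range
    rw [← hp, ← AddMonoidAlgebra.sum_coeff_single p]
    refine (congrArg (· ∈ (t.charsToUnits c).toRingHom.range)
      (map_sum m.algEquiv (fun u => AddMonoidAlgebra.single u (AddMonoidAlgebra.coeff p u)) _)).mpr ?_
    refine Subring.sum_mem _ fun u hu => ?_
    obtain ⟨w, hw⟩ := exists_charsIncl_eq hc (h1 u (Finsupp.mem_support_iff.1 hu))
    exact ⟨.single w (AddMonoidAlgebra.coeff p u), (t.charsToUnits_single c w _).trans (by rw [hw]; rfl)⟩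

/-- The isomorphism `E[M] ≅ E[T]` of algebras. -/
def algEquiv : AddMonoidAlgebra E (torusChars c) ≃ₐ[E] E ⊗[ℚ] C :=
  algEquivOfRangeEq (t.charsToUnits c) t.toUnits (t.charsToUnits_injective c) t.toUnits_injective
    (t.range_charsToUnits hc)

lemma toUnits_algEquiv (x : AddMonoidAlgebra E (torusChars c)) :
    t.toUnits (t.algEquiv hc x) = t.charsToUnits c x :=
  algEquivOfRangeEq_apply _ _ _ _ _ x

/-- The isomorphism `E[M] ≅ E[T]` of bialgebras. -/
def bialgEquiv : AddMonoidAlgebra E (torusChars c) ≃ₐc[E] E ⊗[ℚ] C :=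
  bialgEquivOfGroupLike (t.algEquiv hc) fun u => by
    refine isGroupLikeElem_of_map t.toUnitsBialg t.toUnits_injective ?_
    have h1 : t.toUnitsBialg (t.algEquiv hc (.single u 1)) =
        m.bialgEquiv (.single (charsIncl c u) 1) :=
      (t.toUnits_algEquiv hc _).trans (t.charsToUnits_single c u 1)
    rw [h1]
    exact (AddMonoidAlgebra.isGroupLikeElem_single_one (charsIncl c u)).map m.bialgEquiv

lemma toUnits_bialgEquiv (x : AddMonoidAlgebra E (torusChars c)) :
    t.toUnits (t.bialgEquiv hc x) = m.bialgEquiv (AddMonoidAlgebra.mapDomain (charsIncl c) x) :=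
  t.toUnits_algEquiv hc x

lemma toUnits_bialgEquiv_single (u : torusChars c) (a : E) :
    t.toUnits (t.bialgEquiv hc (.single u a)) = m.bialgEquiv (.single (charsIncl c u) a) :=
  (t.toUnits_algEquiv hc _).trans (t.charsToUnits_single c u a)

/-- The cocharacter of `T_E` given by a homomorphism `M → ℤ`. -/
def cochar (f : torusChars c →+ ℤ) : E ⊗[ℚ] C →ₐc[E] LaurentPolynomial E :=
  (AddMonoidAlgebra.mapDomainBialgHom E f : AddMonoidAlgebra E (torusChars c) →ₐc[E]
    AddMonoidAlgebra E ℤ).comp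
    ((t.bialgEquiv hc).symm : E ⊗[ℚ] C →ₐc[E] AddMonoidAlgebra E (torusChars c))

lemma cochar_bialgEquiv_single (f : torusChars c →+ ℤ) (u : torusChars c) (a : E) :
    t.cochar hc f (t.bialgEquiv hc (.single u a)) = AddMonoidAlgebra.single (f u) a := by
  refine (congrArg (AddMonoidAlgebra.mapDomainBialgHom E f)
    ((t.bialgEquiv hc).symm_apply_apply (.single u a))).trans ?_
  exact AddMonoidAlgebra.mapDomainBialgHom_single f u a

lemma bialgHom_ext_single {F F' : E ⊗[ℚ] C →ₐc[E] LaurentPolynomial E}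
    (h : ∀ u, F (t.bialgEquiv hc (.single u 1)) = F' (t.bialgEquiv hc (.single u 1))) : F = F' := by
  refine BialgHom.ext fun y => ?_
  obtain ⟨x, rfl⟩ := (t.algEquiv hc).surjective y
  have h1 : (F : E ⊗[ℚ] C →ₐ[E] LaurentPolynomial E).comp
      (t.algEquiv hc : AddMonoidAlgebra E (torusChars c) →ₐ[E] E ⊗[ℚ] C) =
      (F' : E ⊗[ℚ] C →ₐ[E] LaurentPolynomial E).comp
      (t.algEquiv hc : AddMonoidAlgebra E (torusChars c) →ₐ[E] E ⊗[ℚ] C) :=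
    addMonoidAlgebra_algHom_ext h
  exact DFunLike.congr_fun h1 x

lemma cochar_injective : Function.Injective (t.cochar hc) := fun f f' h => by
  refine AddMonoidHom.ext fun u => ?_
  have h1 := congrArg (fun F : E ⊗[ℚ] C →ₐc[E] LaurentPolynomial E =>
    F (t.bialgEquiv hc (.single u 1))) h
  simp only [cochar_bialgEquiv_single] at h1
  exact AddMonoidAlgebra.single_left_injective one_ne_zero h1

/-- A bialgebra homomorphism sends the group-like `e^u` to a group-like element of `E[t, t⁻¹]`,
necessarily a power of `t`; the exponent is additive in `u`. -/
lemma cochar_surjective : Function.Surjective (t.cochar hc) := fun F => by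
  have h1 : ∀ u : torusChars c, ∃ n : ℤ,
      (AddMonoidAlgebra.single n 1 : AddMonoidAlgebra E ℤ) =
        F (t.bialgEquiv hc (.single u 1)) := fun u => by
    have h2 : IsGroupLikeElem E (F (t.bialgEquiv hc (.single u 1))) :=
      ((AddMonoidAlgebra.isGroupLikeElem_single_one u).map (t.bialgEquiv hc)).map F
    obtain ⟨n, hn⟩ := AddMonoidAlgebra.isGroupLikeElem_iff_mem_range_single_one.1 h2
    exact ⟨n, hn⟩
  choose f hf using h1
  have hinj : Function.Injective fun n : ℤ => (AddMonoidAlgebra.single n 1 : AddMonoidAlgebra E ℤ) :=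
    AddMonoidAlgebra.single_left_injective one_ne_zero
  let f' : torusChars c →+ ℤ :=
    { toFun := f
      map_zero' := hinj (by
        change AddMonoidAlgebra.single (f 0) 1 = _
        rw [hf]
        have h3 : t.bialgEquiv hc (.single 0 1) = 1 := map_one (t.bialgEquiv hc)
        rw [h3]
        exact map_one F)
      map_add' := fun u w => hinj (by
        change AddMonoidAlgebra.single (f (u + w)) 1 = AddMonoidAlgebra.single (f u + f w) 1
        have h3 : (AddMonoidAlgebra.single (u + w) 1 : AddMonoidAlgebra E (torusChars c)) =
            .single u 1 * .single w 1 := by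
          rw [AddMonoidAlgebra.single_mul_single, mul_one]
        have h4 : (AddMonoidAlgebra.single (f u + f w) 1 : AddMonoidAlgebra E ℤ) =
            .single (f u) 1 * .single (f w) 1 := by
          rw [AddMonoidAlgebra.single_mul_single, mul_one]
        rw [h4, hf, hf, hf, h3]
        have h5 : t.bialgEquiv hc (.single u 1 * .single w 1) =
          t.bialgEquiv hc (.single u 1) * t.bialgEquiv hc (.single w 1) :=
          map_mul (t.bialgEquiv hc) _ _
        rw [h5]
        exact map_mul F _ _) }
  refine ⟨f', t.bialgHom_ext_single hc fun u => ?_⟩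
  rw [cochar_bialgEquiv_single]
  exact hf u

/-- The identification of `N_E` with the cocharacters of `T_E`. -/
def cocharEquiv : (quotientDatum c).lattice ≃ (E ⊗[ℚ] C →ₐc[E] LaurentPolynomial E) :=
  (Equiv.ofBijective _ (pairing_bijective hc)).trans
    (Equiv.ofBijective _ ⟨t.cochar_injective hc, t.cochar_surjective hc⟩)

lemma cocharEquiv_single (v : (quotientDatum c).lattice) (u : torusChars c) (a : E) :
    t.cocharEquiv hc v (t.bialgEquiv hc (.single u a)) = AddMonoidAlgebra.single (pairing v u) a :=
  t.cochar_bialgEquiv_single hc (pairing v) u a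

/-- The action of `Gal(E/ℚ)` on `M`. -/
def galTorus (c : Fin K → G) (γ : charField G ≃ₐ[ℚ] charField G) (u : torusChars c) :
    torusChars c :=
  ⟨u.1 ∘ₗ (galVec γ⁻¹).toLinearMap, fun v hv => u.2.1 _ (galVec_torusLattice c γ⁻¹ v hv),
    fun v hv => by rw [(Submodule.mem_bot _).1 hv, map_zero]⟩

lemma galTensor_bialgEquiv (γ : charField G ≃ₐ[ℚ] charField G) (γ' : E ≃ₐ[ℚ] E)
    (hγ : ∀ x, γ' (e x) = e (γ x)) (u : torusChars c) (a : E) :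
    UnitsModel.galTensor γ' C (t.bialgEquiv hc (.single u a)) =
      t.bialgEquiv hc (.single (galTorus c γ u) (γ' a)) := by
  apply t.toUnits_injective
  have h1 : ∀ y, t.toUnits (UnitsModel.galTensor γ' C y) =
      UnitsModel.galTensor γ' B (t.toUnits y) := fun y => by
    induction y with
    | zero => simp only [map_zero]
    | add x y hx hy => simp only [map_add, hx, hy]
    | tmul a b => rfl
  rw [h1, toUnits_bialgEquiv_single, toUnits_bialgEquiv_single, m.galTensor_bialgEquiv γ γ' hγ]
  rfl

/-- On `e^u` this is the invariance `⟨γu, γv⟩ = ⟨u, v⟩` of the pairing. -/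
lemma cocharEquiv_galTensor (γ : charField G ≃ₐ[ℚ] charField G) (γ' : E ≃ₐ[ℚ] E)
    (hγ : ∀ x, γ' (e x) = e (γ x)) (v w : (quotientDatum c).lattice)
    (hw : (w : cocharSpace G) = (quotientDatum c).gal γ v) (y : E ⊗[ℚ] C) :
    t.cocharEquiv hc w (UnitsModel.galTensor γ' C y) =
      AddMonoidAlgebra.mapRingHom ℤ (γ' : E →+* E) (t.cocharEquiv hc v y) := by
  obtain ⟨x, rfl⟩ := (t.algEquiv hc).surjective y
  change t.cocharEquiv hc w (UnitsModel.galTensor γ' C (t.bialgEquiv hc x)) =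
    AddMonoidAlgebra.mapRingHom ℤ (γ' : E →+* E) (t.cocharEquiv hc v (t.bialgEquiv hc x))
  induction x using AddMonoidAlgebra.induction_linear with
  | zero => simp only [map_zero]
  | add x y hx hy => simp only [map_add, hx, hy]
  | single u a =>
    rw [t.galTensor_bialgEquiv hc γ γ' hγ, cocharEquiv_single, cocharEquiv_single,
      AddMonoidAlgebra.mapRingHom_single]
    have h1 : pairing w (galTorus c γ u) = pairing v u := by
      apply pairing_eq
      rw [pairing_apply, hw]
      change u.1 (galVec γ⁻¹ (galVec γ v)) = _
      rw [← LinearEquiv.mul_apply, ← map_mul, inv_mul_cancel, map_one]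
      rfl
    rw [h1]
    rfl

end TorusModel

end TorusModel

end QuotientToric

namespace QuotientToric

/-! ### The coordinate rings of `𝒢` and `T` as instances of the models. -/

section Concrete

set_option linter.unusedSectionVars false

variable {G : Type} [CommGroup G] [Fintype G]

variable (G) in
/-- The coordinate ring of `𝒢`, with its translations. -/
def unitsModel : UnitsModel (RingHom.id (charField G)) (UnitsRing G) where
  hom := RingHom.id _
  surjective := Function.surjective_id
  toChars := unitsToChars G
  toChars_hom x := by
    change unitsToChars G x = AddMonoidAlgebra.mapRingHom _ (RingHom.id _) (unitsToChars G x)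
    rw [AddMonoidAlgebra.mapRingHom_id]
    rfl
  counit_hom g := by
    classical
    refine (unitsCounit_X g).trans ?_
    congr
  comul_hom g := unitsComul_X g
  act := translate
  act_hom h g := translate_X h g

variable (G) in
/-- The coordinate ring of `T`. -/
def torusModel : TorusModel (unitsModel G) (torusRing G) where
  val := (torusRing G).val
  injective := Subtype.val_injective
  counit_val _ := rfl
  comul_val x := (restrictComul_spec (torusRing G).val (reynolds G) reynolds_val average_comul' x).symm
  retr := reynolds G
  val_retr b := by
    change average G b = _
    rw [average, LinearMap.smul_apply, LinearMap.sum_apply]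
    rfl
  act_val h x := mem_torusRing.1 x.2 h

variable {K : ℕ} {c : Fin K → G}
  (hc : Function.Bijective fun x : ∀ j, Subgroup.zpowers (c j) => ∏ j, (x j : G))

variable (G) in
/-- The isomorphism `𝒢_E ≅ Spec E[M']`. -/
def unitsIso : AddMonoidAlgebra (charField G) (unitsChars G) ≃ₐc[charField G]
    charField G ⊗[ℚ] UnitsRing G := (unitsModel G).bialgEquiv

/-- The isomorphism `T_E ≅ Spec E[M]`. -/
def torusIso : AddMonoidAlgebra (charField G) (torusChars c) ≃ₐc[charField G]
    charField G ⊗[ℚ] torusRing G := (torusModel G).bialgEquiv hc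

/-- The identification of `N_E` with the cocharacters of `T_E`. -/
def cocharIso : (quotientDatum c).lattice ≃
    (charField G ⊗[ℚ] torusRing G →ₐc[charField G] LaurentPolynomial (charField G)) :=
  (torusModel G).cocharEquiv hc

lemma ofFun_eq_sum_idempotent : (ofFun fun g : G => (1 : charField G) ⊗ₜ[ℚ] unitsX g) =
    ∑ χ : G →* ℂˣ, unitsIso G (.single (dualVec χ) 1) • idempotent _ χ := by
  ext g
  rw [coeff_ofFun, coeff_sum_smul_idempotent]
  exact (unitsModel G).tmul_eq_sum g

lemma torusToUnits_torusIso (u : torusChars c) :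
    torusToUnits (torusIso hc (.single u 1)) = unitsIso G (.single (charsIncl c u) 1) :=
  (torusModel G).toUnits_bialgEquiv_single hc u 1

lemma cocharIso_torusIso (v : (quotientDatum c).lattice) (u : torusChars c) (m : ℤ)
    (h : u.1 v = m) : cocharIso hc v (torusIso hc (.single u 1)) = LaurentPolynomial.T m := by
  refine ((torusModel G).cocharEquiv_single hc v u 1).trans ?_
  rw [pairing_eq h]
  rfl

lemma cocharIso_galTensor (γ : charField G ≃ₐ[ℚ] charField G) (v w : (quotientDatum c).lattice)
    (h : (w : cocharSpace G) = (quotientDatum c).gal γ v) (a : charField G ⊗[ℚ] torusRing G) :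
    cocharIso hc w (galTensor _ γ a) = galLaurent γ (cocharIso hc v a) :=
  (torusModel G).cocharEquiv_galTensor hc γ γ (fun _ => rfl) v w h a

lemma unitsIso_unitsToChars (x : UnitsRing G) : unitsIso G (unitsToChars G x) =
    (Algebra.TensorProduct.includeRight : UnitsRing G →ₐ[ℚ] charField G ⊗[ℚ] UnitsRing G) x :=
  (unitsModel G).bialgEquiv_toChars x

end Concrete

end QuotientToric

namespace QuotientToric

/-! ### `T` as the open set `D₊(Y Δ²)` of `ℙ/G`. -/

section OpenTorus

set_option linter.unusedSectionVars false

variable (G : Type) [CommGroup G] [Fintype G]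

open HomogeneousLocalization

/-- The homomorphism `P ↦ P(1, (X_g)_g)` from `ℚ[Y, X_g]` to `ℚ[𝒢]`. -/
def dehomEval : MvPolynomial (Option G) ℚ →+* UnitsRing G :=
  (MvPolynomial.aeval (R := ℚ) (fun o : Option G => o.elim 1 unitsX)).toRingHom

variable {G}

lemma dehomEval_X (g : G) : dehomEval G (MvPolynomial.X (some g)) = unitsX g :=
  MvPolynomial.aeval_X _ _

lemma dehomEval_X_none : dehomEval G (MvPolynomial.X none) = 1 :=
  MvPolynomial.aeval_X _ _

lemma dehomEval_translate (h : G) (p : MvPolynomial (Option G) ℚ) :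
    dehomEval G (translateAction G h p) = translate h (dehomEval G p) := by
  refine DFunLike.congr_fun (f := (dehomEval G).comp
    (projTranslateRing h : MvPolynomial (Option G) ℚ →+* MvPolynomial (Option G) ℚ))
    (g := (translate h : UnitsRing G →+* UnitsRing G).comp (dehomEval G))
    (projPoly_ringHom_ext ?_ fun g => ?_) p
  · change dehomEval G (projTranslateRing h (MvPolynomial.X none)) =
      translate h (dehomEval G (MvPolynomial.X none))
    rw [projTranslateRing_X_none, dehomEval_X_none, map_one]
  · change dehomEval G (projTranslateRing h (MvPolynomial.X (some g))) =
      translate h (dehomEval G (MvPolynomial.X (some g)))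
    rw [projTranslateRing_X, dehomEval_X, dehomEval_X, translate_X]

/-- This links the affine picture of `𝒢` with the toric one: evaluating at the generic unit and then
passing to idempotent coordinates is the same as changing coordinates and then setting `Y = 1`. -/
lemma unitsToChars_dehomEval (p : MvPolynomial (Option G) ℚ) :
    unitsToChars G (dehomEval G p) = toricEval G (extendCoord G p) := by
  refine DFunLike.congr_fun (f := (unitsToChars G).comp (dehomEval G))
    (g := (toricEval G).comp (extendCoord G : MvPolynomial (Option G) ℚ →+* CharPoly G))
    (projPoly_ringHom_ext ?_ fun g => ?_) p
  · change unitsToChars G (dehomEval G (MvPolynomial.X none)) =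
      toricEval G (extendCoord G (MvPolynomial.X none))
    rw [dehomEval_X_none, extendCoord_X_none, toricEval_X_none, map_one]
  · change unitsToChars G (dehomEval G (MvPolynomial.X (some g))) =
      toricEval G (extendCoord G (MvPolynomial.X (some g)))
    rw [dehomEval_X, extendCoord_X, unitsToChars_X, toCharCoord, map_sum]
    refine Finset.sum_congr rfl fun χ _ => ?_
    rw [map_mul, toricEval_C, toricEval_X, AddMonoidAlgebra.single_mul_single, zero_add, mul_one]

lemma dehomEval_injective (d : ℕ) (p : MvPolynomial (Option G) ℚ) (hp : p ∈ projGrading G d)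
    (h : dehomEval G p = 0) : p = 0 := by
  apply extendCoord_injective
  rw [map_zero]
  refine toricEval_injective (gradedMap_mem (extendCoord G) hp) ?_
  rw [← unitsToChars_dehomEval, h, map_zero]

variable (G) in
/-- The group determinant as an element of `ℚ[Y, X_g]`. -/
def projDet : MvPolynomial (Option G) ℚ := MvPolynomial.rename some (groupDet G)

open Classical in
lemma projDet_eq : projDet G =
    (groupMatrix fun g : G => (MvPolynomial.X (some g) : MvPolynomial (Option G) ℚ)).det := by
  rw [projDet, groupDet, AlgHom.map_det]
  congr 1
  refine Matrix.ext fun g h => ?_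
  exact MvPolynomial.rename_X _ _

lemma projDet_mem : projDet G ∈ projGrading G (Fintype.card G) := by
  classical
  rw [projDet_eq, Matrix.det_apply]
  refine Submodule.sum_mem _ fun σ _ => ?_
  rw [← Finset.card_univ, Finset.card_eq_sum_ones]
  exact Submodule.smul_of_tower_mem _ _
    (MvPolynomial.IsHomogeneous.prod _ _ _ fun g _ => MvPolynomial.isHomogeneous_X _ _)

lemma dehomEval_projDet : dehomEval G (projDet G) = algebraMap _ _ (groupDet G) := by
  refine (MvPolynomial.aeval_rename _ _ _).trans ?_
  have h2 : MvPolynomial.aeval ((fun o : Option G => o.elim 1 unitsX) ∘ some) =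
      IsScalarTower.toAlgHom ℚ (MvPolynomial G ℚ) (UnitsRing G) := by
    refine MvPolynomial.algHom_ext fun g => ?_
    rw [MvPolynomial.aeval_X]
    rfl
  exact DFunLike.congr_fun h2 (groupDet G)

lemma isUnit_dehomEval_projDet : IsUnit (dehomEval G (projDet G)) := by
  rw [dehomEval_projDet]
  exact IsLocalization.Away.algebraMap_isUnit (groupDet G)

/-- Translation permutes the rows of the matrix, so a sign can appear; this forces the square in
`torusForm`. -/
lemma translate_projDet (h : G) :
    translateAction G h (projDet G) = projDet G ∨ translateAction G h (projDet G) = -projDet G := by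
  classical
  have h1 : translateAction G h (projDet G) =
      ((groupMatrix fun g : G => (MvPolynomial.X (some g) :
        MvPolynomial (Option G) ℚ)).submatrix (Equiv.mulLeft h⁻¹) id).det := by
    change MvPolynomial.rename (Option.map fun g : G => h⁻¹ * g) (projDet G) = _
    rw [projDet_eq, AlgHom.map_det]
    congr 1
    refine Matrix.ext fun g k => ?_
    refine (MvPolynomial.rename_X _ _).trans ?_
    change MvPolynomial.X (some (h⁻¹ * (g * k))) = MvPolynomial.X (some (h⁻¹ * g * k))
    rw [mul_assoc]
  rw [h1, Matrix.det_permute, ← projDet_eq]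
  rcases Int.units_eq_one_or (Equiv.Perm.sign (Equiv.mulLeft h⁻¹)) with h2 | h2
  · left
    rw [h2]
    simp
  · right
    rw [h2]
    simp

variable (G) in
/-- The invariant `Y Δ²`. -/
def torusForm : invSubring (translateAction G) :=
  ⟨MvPolynomial.X none * projDet G ^ 2, fun h => by
    have h1 : translateAction G h (MvPolynomial.X none) = MvPolynomial.X none :=
      projTranslateRing_X_none h
    rw [map_mul, map_pow, h1]
    rcases translate_projDet h with h2 | h2
    · rw [h2]
    · rw [h2, neg_sq]⟩

lemma torusForm_mem : torusForm G ∈ quotGrading G (1 + 2 • Fintype.card G) := by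
  have h1 : MvPolynomial.X none * projDet G ^ 2 ∈ projGrading G (1 + 2 • Fintype.card G) :=
    SetLike.mul_mem_graded (MvPolynomial.isHomogeneous_X ℚ none)
      (SetLike.pow_mem_graded 2 projDet_mem)
  exact (mem_invGrading _).2 h1

lemma torusForm_pos : 0 < 1 + 2 • Fintype.card G := by omega

lemma coe_torusForm :
    (torusForm G : MvPolynomial (Option G) ℚ) = MvPolynomial.X none * projDet G ^ 2 := by
  rw [torusForm]

lemma dehomEval_torusForm :
    dehomEval G (invIncl (translateAction G) (torusForm G)) = dehomEval G (projDet G) ^ 2 := by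
  rw [invIncl_apply, coe_torusForm, map_mul, map_pow, dehomEval_X_none, one_mul]

lemma isUnit_dehomEval_torusForm :
    IsUnit (dehomEval G (invIncl (translateAction G) (torusForm G))) := by
  rw [dehomEval_torusForm]
  exact isUnit_dehomEval_projDet.pow 2

variable (G) in
/-- The values of homogeneous fractions with denominator `Y Δ²` on `𝒢`. -/
def unitsEval : Away (projGrading G) (invIncl (translateAction G) (torusForm G)) →+* UnitsRing G :=
  evalAway (projGrading G) (dehomEval G) isUnit_dehomEval_torusForm

lemma unitsEval_injective : Function.Injective (unitsEval G) :=
  evalAway_injective _ _ (invIncl_mem (translateAction G) torusForm_mem) dehomEval_injective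

lemma mem_range_unitsEval {k : ℕ} {p : MvPolynomial (Option G) ℚ} {b : UnitsRing G}
    (hp : p ∈ projGrading G (k • (1 + 2 • Fintype.card G)))
    (h : dehomEval G p = b * dehomEval G (projDet G) ^ (2 * k)) : b ∈ (unitsEval G).range := by
  refine ⟨Away.mk (projGrading G) (invIncl_mem (translateAction G) torusForm_mem) k p hp, ?_⟩
  have h1 := evalAway_mk (dehomEval G) isUnit_dehomEval_torusForm
    (invIncl_mem (translateAction G) torusForm_mem) k p hp
  rw [h, dehomEval_torusForm, ← pow_mul] at h1
  exact (isUnit_dehomEval_projDet.pow (2 * k)).mul_left_injective h1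

/-- Powers of `Y` evaluate to `1`, so they can be used freely to reach the degree needed for a
homogeneous fraction. In this way the `X_g` and `1/Δ` are attained, and they generate `ℚ[𝒢]`. -/
lemma unitsEval_surjective : Function.Surjective (unitsEval G) := by
  have hX : ∀ g : G, unitsX g ∈ (unitsEval G).range := fun g => by
    refine mem_range_unitsEval (k := 1) (p := MvPolynomial.X (some g) * projDet G ^ 2) ?_ ?_
    · rw [one_smul]
      exact SetLike.mul_mem_graded (A := projGrading G) (MvPolynomial.isHomogeneous_X ℚ (some g))
        (SetLike.pow_mem_graded 2 projDet_mem)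
    · rw [map_mul, map_pow, dehomEval_X, mul_one]
  have hC : ∀ a : ℚ, algebraMap (MvPolynomial G ℚ) (UnitsRing G) (MvPolynomial.C a) ∈
      (unitsEval G).range := fun a => by
    refine mem_range_unitsEval (k := 0) (p := MvPolynomial.C a) ?_ ?_
    · rw [zero_smul]
      exact MvPolynomial.isHomogeneous_C _ _
    · rw [mul_zero, pow_zero, mul_one]
      refine (MvPolynomial.algHom_C _ a).trans ?_
      exact IsScalarTower.algebraMap_apply ℚ (MvPolynomial G ℚ) (UnitsRing G) a
  have hp : ∀ p : MvPolynomial G ℚ, algebraMap (MvPolynomial G ℚ) (UnitsRing G) p ∈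
      (unitsEval G).range := fun p => by
    induction p using MvPolynomial.induction_on with
    | C a => exact hC a
    | add p q hp hq => rw [map_add]; exact Subring.add_mem _ hp hq
    | mul_X p g hp => rw [map_mul]; exact Subring.mul_mem _ hp (hX g)
  intro z
  obtain ⟨⟨p, ⟨_, k, rfl⟩⟩, hz⟩ := IsLocalization.surj (Submonoid.powers (groupDet G)) z
  have hu := IsLocalization.Away.algebraMap_isUnit (S := UnitsRing G) (groupDet G)
  -- The witness is `1/Δ = Y^{1+n} Δ / (Y Δ²)`, whose numerator has the degree `1 + 2n` of the
  -- denominator.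
  have hinv : ((hu.unit⁻¹ : (UnitsRing G)ˣ) : UnitsRing G) ∈ (unitsEval G).range := by
    refine mem_range_unitsEval (k := 1)
      (p := MvPolynomial.X none ^ (1 + Fintype.card G) * projDet G) ?_ ?_
    · have h1 : 1 • (1 + 2 • Fintype.card G) = (1 + Fintype.card G) • 1 + Fintype.card G := by
        simp only [smul_eq_mul]; ring
      rw [h1]
      exact SetLike.mul_mem_graded (A := projGrading G)
        (SetLike.pow_mem_graded _ (MvPolynomial.isHomogeneous_X ℚ none)) projDet_mem
    · rw [map_mul, map_pow, dehomEval_X_none, one_pow, one_mul, dehomEval_projDet, mul_one, pow_two,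
        ← mul_assoc, IsUnit.val_inv_mul, one_mul]
  have hz' : z = algebraMap (MvPolynomial G ℚ) (UnitsRing G) p *
      ((hu.unit⁻¹ : (UnitsRing G)ˣ) : UnitsRing G) ^ k := by
    rw [← hz, mul_assoc]
    dsimp only
    rw [map_pow, ← mul_pow, IsUnit.mul_val_inv, one_pow, mul_one]
  rw [hz']
  exact Subring.mul_mem _ (hp p) (Subring.pow_mem _ hinv k)

lemma unitsEval_awayAct (h : G)
    (x : Away (projGrading G) (invIncl (translateAction G) (torusForm G))) :
    unitsEval G (awayAct (apply_invIncl (translateAction G) (torusForm G)) h x) =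
      translate h (unitsEval G x) := by
  have hd := invIncl_mem (translateAction G) (torusForm_mem (G := G))
  obtain ⟨k, a, ha, rfl⟩ := Away.mk_surjective _ hd x
  rw [awayAct_mk]
  apply (isUnit_dehomEval_torusForm.pow k).mul_left_injective
  refine (evalAway_mk (dehomEval G) isUnit_dehomEval_torusForm hd k _ _).trans ?_
  rw [dehomEval_translate, ← evalAway_mk (dehomEval G) isUnit_dehomEval_torusForm hd k a ha,
    map_mul, map_pow, ← dehomEval_translate, apply_invIncl]
  rfl

variable (G) in
/-- The homomorphism `ℚ[Y, X_g]^G → ℚ[T]`. -/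
def torusDehom : invSubring (translateAction G) →+* torusRing G where
  toFun a := ⟨dehomEval G (invIncl (translateAction G) a), mem_torusRing.2 fun h => by
    rw [← dehomEval_translate, apply_invIncl]⟩
  map_one' := Subtype.ext (map_one ((dehomEval G).comp (invIncl (translateAction G)).toRingHom))
  map_mul' a b :=
    Subtype.ext (map_mul ((dehomEval G).comp (invIncl (translateAction G)).toRingHom) a b)
  map_zero' := Subtype.ext (map_zero ((dehomEval G).comp (invIncl (translateAction G)).toRingHom))
  map_add' a b :=
    Subtype.ext (map_add ((dehomEval G).comp (invIncl (translateAction G)).toRingHom) a b)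

/-- The inverse in `ℚ[𝒢]` of an invariant unit is again invariant. -/
lemma isUnit_torusDehom : IsUnit (torusDehom G (torusForm G)) := by
  obtain ⟨u, hu⟩ := isUnit_dehomEval_torusForm (G := G)
  have h1 : ((u⁻¹ : (UnitsRing G)ˣ) : UnitsRing G) ∈ torusRing G := by
    rw [mem_torusRing]
    intro h
    apply u.isUnit.mul_left_injective
    have h2 : translate h (u : UnitsRing G) = u := by
      rw [hu, ← dehomEval_translate, apply_invIncl]
    change translate h _ * (u : UnitsRing G) = _ * (u : UnitsRing G)
    rw [Units.inv_mul]
    refine (congrArg (translate h _ * ·) h2.symm).trans ?_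
    rw [← map_mul, Units.inv_mul, map_one]
  refine IsUnit.of_mul_eq_one ⟨_, h1⟩ (Subtype.ext ?_)
  change dehomEval G (invIncl (translateAction G) (torusForm G)) * _ = 1
  rw [← hu, Units.mul_inv]

variable (G) in
/-- The values of invariant homogeneous fractions with denominator `Y Δ²` on `T`. -/
def torusEval : Away (quotGrading G) (torusForm G) →+* torusRing G :=
  evalAway (quotGrading G) (torusDehom G) isUnit_torusDehom

lemma val_torusEval (y : Away (quotGrading G) (torusForm G)) :
    (torusEval G y : UnitsRing G) =
      unitsEval G (Away.map (invIncl (translateAction G)) (torusForm G) y) := by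
  have h1 := evalAway_comp (𝒜 := quotGrading G) (torusDehom G) (torusRing G).val.toRingHom
    isUnit_torusDehom torusForm_mem
  have h2 := evalAway_map (invIncl (translateAction G)) (dehomEval G)
    (f := torusForm G) isUnit_dehomEval_torusForm torusForm_mem
  exact (DFunLike.congr_fun h1 y).trans (DFunLike.congr_fun h2 y).symm

/-- The isomorphism from the fractions over `Y Δ²` to `ℚ[𝒢]` is equivariant, so it restricts to
invariants, and the invariant fractions are those of the ring of invariants. -/
lemma torusEval_bijective : Function.Bijective (torusEval G) := by
  constructor
  · intro x y hxy
    have h1 := congrArg Subtype.val hxy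
    rw [val_torusEval, val_torusEval] at h1
    exact awayMap_invIncl_injective (ρ := translateAction G) (torusForm G) torusForm_mem
      (unitsEval_injective h1)
  · intro b
    obtain ⟨x, hx⟩ := unitsEval_surjective (b : UnitsRing G)
    obtain ⟨y, rfl⟩ := awayAct_invariant (ρ := translateAction G) (torusForm G) torusForm_mem x
      fun h => unitsEval_injective (by rw [unitsEval_awayAct, hx, mem_torusRing.1 b.2 h])
    exact ⟨y, Subtype.ext ((val_torusEval y).trans hx)⟩

variable (G) in
/-- The inclusion of the open torus `T ⊂ ℙ/G`. -/
def torusι : Spec (.of (torusRing G)) ⟶ quotSpace G :=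
  projOfUnit (quotGrading G) (torusDehom G) torusForm_mem torusForm_pos isUnit_torusDehom

lemma torusι_isOpenImmersion : IsOpenImmersion (torusι G) := by
  have := isIso_specMap_ringEquiv (RingEquiv.ofBijective (torusEval G) torusEval_bijective)
  let q : Spec (.of (Away (quotGrading G) (torusForm G))) ⟶ Proj (quotGrading G) :=
    Proj.awayι (quotGrading G) (torusForm G) torusForm_mem torusForm_pos
  have h2 : IsOpenImmersion q := by
    dsimp only [q]
    infer_instance
  exact IsOpenImmersion.comp (Spec.map (CommRingCat.ofHom
      (RingEquiv.ofBijective (torusEval G) torusEval_bijective).toRingHom)) q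

/-- The inclusion of `𝒢` is written with the denominator `Y`; here it is replaced by the invariant
denominator `Y Δ²`, which is what the quotient map sees. -/
lemma unitsToProj_eq : unitsToProj G = projOfUnit (projGrading G) (dehomEval G)
    (invIncl_mem (translateAction G) torusForm_mem) torusForm_pos isUnit_dehomEval_torusForm := by
  have h1 : IsUnit (dehomEval G (MvPolynomial.X none)) := by
    rw [dehomEval_X_none]
    exact isUnit_one
  refine Eq.trans ?_ (projOfUnit_eq (𝒜 := projGrading G) (dehomEval G)
    (MvPolynomial.isHomogeneous_X ℚ none) one_pos h1 _ _ _)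
  rfl

theorem unitsToProj_quotMap : unitsToProj G ≫ quotMap G =
    Spec.map (CommRingCat.ofHom (torusRing G).val.toRingHom) ≫ torusι G := by
  refine (congrArg (· ≫ quotMap G) unitsToProj_eq).trans ?_
  refine (projOfUnit_comp_of_awayι (invIncl (translateAction G)) (quotMap G) (dehomEval G)
    torusForm_mem torusForm_pos (awayι_projMap _ torusForm_pos torusForm_mem)
    isUnit_dehomEval_torusForm).trans ?_
  exact (spec_map_projOfUnit (torusDehom G) (torusRing G).val.toRingHom torusForm_mem torusForm_pos
    isUnit_torusDehom).symm

end OpenTorus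

end QuotientToric

namespace QuotientToric

/-! ### `T_E` as the chart of the zero cone. -/

section TorusChart

set_option linter.unusedSectionVars false

variable {G : Type} [CommGroup G] [Fintype G] {K : ℕ} {c : Fin K → G}

open HomogeneousLocalization

section

variable {E B C : Type} [Field E] [Algebra ℚ E] {e : charField G →+* E} [CommRing B] [Bialgebra ℚ B]
  [CommRing C] [Bialgebra ℚ C] {m : UnitsModel e B} (t : TorusModel m C)

lemma TorusModel.toUnits_includeRight (x : C) :
    t.toUnits ((Algebra.TensorProduct.includeRight : C →ₐ[ℚ] E ⊗[ℚ] C) x) =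
      (Algebra.TensorProduct.includeRight : B →ₐ[ℚ] E ⊗[ℚ] B) (t.val x) := by
  refine (Algebra.TensorProduct.map_tmul (AlgHom.id E E) t.val 1 x).trans ?_
  rfl

end

/-- An injective homomorphism as an isomorphism onto its image. -/
def rangeEquiv {R S : Type} [CommRing R] [CommRing S] (f : R →+* S) (hf : Function.Injective f) :
    R ≃+* f.range :=
  RingEquiv.ofBijective f.rangeRestrict
    ⟨fun _ _ h => hf (congrArg Subtype.val h), f.rangeRestrict_surjective⟩

lemma coe_rangeEquiv {R S : Type} [CommRing R] [CommRing S] (f : R →+* S)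
    (hf : Function.Injective f) (x : R) : (rangeEquiv f hf x : S) = f x := rfl

variable (hc : Function.Bijective fun x : ∀ j, Subgroup.zpowers (c j) => ∏ j, (x j : G))

include hc in
-- Only monomials of trivial weight occur in an invariant, and their exponents lie in `M`.
lemma invEval_mem_range (a : invSubring (charAction G)) :
    invEval G a ∈ (chartIncl c ⊥).range := by
  rw [← AddMonoidAlgebra.sum_coeff_single (invEval G a)]
  refine Subring.sum_mem _ fun u hu => ?_
  obtain ⟨m, hm, rfl⟩ := exists_of_coeff_toricEval_ne_zero (Finsupp.mem_support_iff.1 hu)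
  have h1 : charWeight (coord (expVec G m)) = 1 := by
    rw [show coord (expVec G m) = fun χ => (m (some χ) : ℤ) from funext (coord_expVec m)]
    exact monoWeight_eq_one a.2 hm
  obtain ⟨w, hw⟩ := exists_charsIncl_eq hc h1
  exact ⟨.single w _, (chartIncl_single (c := c) ⊥ w _).trans (congrArg (fun u =>
    AddMonoidAlgebra.single u ((invEval G a).coeff (expVec G m))) hw)⟩

/-- The homomorphism `E[Y, Z_χ]^G → E[M]`. -/
def torusCharEval : invSubring (charAction G) →+* AddMonoidAlgebra (charField G) (torusChars c) :=
  (rangeEquiv (chartIncl c ⊥) (chartIncl_injective ⊥)).symm.toRingHom.comp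
    ((invEval G).codRestrict (chartIncl c ⊥).range (invEval_mem_range hc))

lemma chartIncl_torusCharEval (a : invSubring (charAction G)) :
    chartIncl c ⊥ (torusCharEval hc a) = invEval G a := by
  refine (coe_rangeEquiv (chartIncl c ⊥) (chartIncl_injective ⊥) _).symm.trans ?_
  exact congrArg Subtype.val ((rangeEquiv (chartIncl c ⊥) (chartIncl_injective ⊥)).apply_symm_apply
    ⟨invEval G a, invEval_mem_range hc a⟩)

include hc in
lemma exists_add_eq_zero (u : torusChars c) : ∃ w : torusChars c, u + w = 0 := by
  have h1 : -coord (charsIncl c u) ∈ weightKer G :=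
    (weightKer G).neg_mem (charWeight_coord_charsIncl hc u)
  refine ⟨torusCharOf hc _ h1, charsIncl_injective ((coordEquiv G).injective ?_)⟩
  have h2 : coord (charsIncl c (torusCharOf hc _ h1)) = -coord (charsIncl c u) :=
    coord_unitsCharOf _
  rw [map_add, map_add, map_zero, map_zero, coordEquiv_apply, coordEquiv_apply, h2,
    add_neg_cancel]

lemma isUnit_torusCharEval_faceMono (J : Set (Option (G →* ℂˣ))) :
    IsUnit (torusCharEval hc (faceMono J)) := by
  have h1 : charWeight (coord (expVec G (faceExp J))) = 1 := by
    rw [show coord (expVec G (faceExp J)) = fun χ => (faceExp J (some χ) : ℤ) from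
      funext (coord_expVec _)]
    exact monoWeight_faceExp J
  obtain ⟨w, hw⟩ := exists_charsIncl_eq hc h1
  obtain ⟨w', hw'⟩ := exists_add_eq_zero hc w
  have h2 : torusCharEval hc (faceMono J) = .single w 1 := by
    refine chartIncl_injective (c := c) ⊥ ((chartIncl_torusCharEval hc _).trans ?_)
    refine Eq.trans ?_ (chartIncl_single (c := c) ⊥ w 1).symm
    rw [invEval_faceMono, ← hw]
    rfl
  refine IsUnit.of_mul_eq_one (.single w' 1) ?_
  rw [h2, AddMonoidAlgebra.single_mul_single, mul_one, hw']
  rfl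

lemma coneChart_bot (h : ⊥ ∈ fanCones G) : coneChart hc h =
    projOfUnit (charInvGrading G) (torusCharEval hc) (faceMono_mem _)
      (faceExp_degree_pos (coneRays_ne_univ h)) (isUnit_torusCharEval_faceMono hc _) := by
  have h1 : (chartEquiv hc h).toRingHom =
      evalAway (charInvGrading G) (torusCharEval hc) (isUnit_torusCharEval_faceMono hc _) := by
    refine RingHom.ext fun x => chartIncl_injective (c := c) ⊥ ?_
    refine (chartIncl_chartEquiv hc h x).trans ?_
    have h2 : (chartIncl c ⊥).comp (torusCharEval hc) = invEval G :=
      RingHom.ext (chartIncl_torusCharEval hc)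
    have h3 := evalAway_comp (𝒜 := charInvGrading G) (torusCharEval hc) (chartIncl c ⊥)
      (isUnit_torusCharEval_faceMono hc (coneRays ⊥)) (faceMono_mem _)
    simp only [h2] at h3
    exact (DFunLike.congr_fun h3 x).symm
  rw [coneChart, h1]
  rfl

/-- After the injection into `E ⊗ ℚ[𝒢]`, both sides are the value of the polynomial at the generic
unit, by `unitsToChars_dehomEval`. -/
lemma torusIso_torusCharEval (a : invSubring (translateAction G)) :
    torusIso hc (torusCharEval hc (extendInv G a)) =
      (Algebra.TensorProduct.includeRight : torusRing G →ₐ[ℚ] charField G ⊗[ℚ] torusRing G)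
        (torusDehom G a) := by
  apply (torusModel G).toUnits_injective
  refine ((torusModel G).toUnits_bialgEquiv hc _).trans ?_
  refine Eq.trans ?_ ((torusModel G).toUnits_includeRight (torusDehom G a)).symm
  refine Eq.trans ?_ (unitsIso_unitsToChars (dehomEval G (invIncl (translateAction G) a)))
  refine congrArg (unitsIso G) ?_
  rw [unitsToChars_dehomEval]
  exact chartIncl_torusCharEval hc (extendInv G a)

section

variable {R : Type} [CommRing R]
  (f : AddMonoidAlgebra (charField G) (torusChars c) →+* R) (i : torusRing G →+* R)

lemma spec_map_coneChart_bot (h : ⊥ ∈ fanCones G)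
    (hfi : ∀ a, f (torusCharEval hc (extendInv G a)) = i (torusDehom G a)) :
    Spec.map (CommRingCat.ofHom f) ≫ coneChart hc h ≫ charSpaceProj G =
      Spec.map (CommRingCat.ofHom i) ≫ torusι G := by
  have h1 : (f.comp (torusCharEval hc)).comp
      (extendInv G : invSubring (translateAction G) →+* invSubring (charAction G)) =
      i.comp (torusDehom G) := RingHom.ext hfi
  have hu : IsUnit (i.comp (torusDehom G) (torusForm G)) := isUnit_torusDehom.map i
  have hu' : IsUnit (f.comp (torusCharEval hc) (extendInv G (torusForm G))) := by
    have h2 := DFunLike.congr_fun h1 (torusForm G)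
    rw [← h2] at hu
    exact hu
  have h3 : Spec.map (CommRingCat.ofHom f) ≫ coneChart hc h =
      projOfUnit (charInvGrading G) (f.comp (torusCharEval hc))
        (gradedMap_mem (extendInv G) torusForm_mem) torusForm_pos hu' := by
    rw [coneChart_bot]
    refine (spec_map_projOfUnit _ _ _ _ _).trans ?_
    -- The chart of the zero cone uses the product of all `n`-th powers of the variables as
    -- denominator; it is exchanged for `Y Δ²`, which is also invertible and comes from `ℚ`.
    exact projOfUnit_eq _ _ _ _ _ _ _
  refine (Category.assoc _ _ _).symm.trans ?_
  refine congr($h3 ≫ charSpaceProj G).trans ?_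
  refine (projOfUnit_comp_of_awayι (extendInv G) (charSpaceProj G) (f.comp (torusCharEval hc))
    torusForm_mem torusForm_pos (awayι_projMap _ torusForm_pos torusForm_mem) hu').trans ?_
  refine Eq.trans ?_ (spec_map_projOfUnit (torusDehom G) i torusForm_mem torusForm_pos
    isUnit_torusDehom).symm
  simp only [h1]

end

theorem torusIso_chart_bot :
    Spec.map (CommRingCat.ofHom (torusIso hc : AddMonoidAlgebra (charField G) (torusChars c) →+*
        charField G ⊗[ℚ] torusRing G)) ≫ (toricStructure hc).chart ⟨⊥, bot_mem_fanCones c⟩ ≫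
        Limits.pullback.fst _ _ =
      Spec.map (CommRingCat.ofHom (Algebra.TensorProduct.includeRight :
        torusRing G →ₐ[ℚ] charField G ⊗[ℚ] torusRing G).toRingHom) ≫ torusι G := by
  have h1 : (toricStructure hc).chart ⟨⊥, bot_mem_fanCones c⟩ ≫ Limits.pullback.fst _ _ =
      coneChart hc (bot_mem_fanCones c) ≫ charSpaceProj G :=
    (Category.assoc _ _ _).trans congr(_ ≫ $(charSpaceIso_fst G))
  refine (congrArg (Spec.map _ ≫ ·) h1).trans ?_
  exact spec_map_coneChart_bot hc _ _ _ (torusIso_torusCharEval hc)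

end TorusChart

end QuotientToric

end

theorem mainTheorem6 (G : Type) [CommGroup G] [Fintype G] (K : ℕ) (c : Fin K → G)
    (hc : Function.Bijective fun x : ∀ j, Subgroup.zpowers (c j) => ∏ j, (x j : G)) :
    -- the cones spanned by the proper subsets of `{v_0} ∪ {v_χ}` form a fan for the lattice `N_E`
    (quotientDatum c).IsFan ∧
    ∃ (Y : Scheme.{0}) (str : Y ⟶ Spec (.of ℚ)) (π : projSpace G ⟶ Y)
      -- `Y` is the toric variety over `ℚ` of the fan, the lattice and the Galois action
      (S : (quotientDatum c).ToricStructure str)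
      -- the open torus `T = 𝒢/G` of `Y`
      (j : Spec (.of (torusRing G)) ⟶ Y)
      -- isomorphisms of group schemes `𝒢_E ≅ Spec E[M']` and `T_E ≅ Spec E[M]`
      (φ : AddMonoidAlgebra (charField G) (unitsChars G) ≃ₐc[charField G]
        charField G ⊗[ℚ] UnitsRing G)
      (ψ : AddMonoidAlgebra (charField G) (torusChars c) ≃ₐc[charField G]
        charField G ⊗[ℚ] torusRing G)
      -- the identification of `N_E` with the homomorphisms of group schemes `𝔾_m → T_E`
      (κ : (quotientDatum c).lattice ≃
        (charField G ⊗[ℚ] torusRing G →ₐc[charField G] LaurentPolynomial (charField G))),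
      -- `Y = ℙ/G`, as a variety over `ℚ`
      IsQuotient projTranslate π ∧
      π ≫ str = projSpaceStr G ∧
      -- `T` is open in `ℙ/G`, compatibly with `𝒢 ⊂ ℙ`
      IsOpenImmersion j ∧
      unitsToProj G ≫ π = Spec.map (CommRingCat.ofHom (torusRing G).val.toRingHom) ≫ j ∧
      -- the coordinates of `𝒢_E` are the coefficients along the idempotents `v_χ`
      (ofFun fun g : G => (1 : charField G) ⊗ₜ[ℚ] unitsX g) =
        ∑ χ : G →* ℂˣ, φ (.single (dualVec χ) 1) • idempotent _ χ ∧
      -- the quotient map `𝒢_E → T_E` corresponds to `M ⊆ M'`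
      (∀ u : torusChars c, torusToUnits (ψ (.single u 1)) = φ (.single (charsIncl c u) 1)) ∧
      -- `T_E` is the open torus of the toric variety, that is, the chart of the cone `0`
      Spec.map (CommRingCat.ofHom (ψ : AddMonoidAlgebra (charField G) (torusChars c) →+*
          charField G ⊗[ℚ] torusRing G)) ≫ S.chart ⟨⊥, bot_mem_fanCones c⟩ ≫
          Limits.pullback.fst _ _ =
        Spec.map (CommRingCat.ofHom (Algebra.TensorProduct.includeRight :
          torusRing G →ₐ[ℚ] charField G ⊗[ℚ] torusRing G).toRingHom) ≫ j ∧
      -- `N_E` is the cocharacter lattice of `T_E`, with its natural Galois action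
      (∀ (v : (quotientDatum c).lattice) (u : torusChars c) (m : ℤ),
        u.1 v = m → κ v (ψ (.single u 1)) = LaurentPolynomial.T m) ∧
      (∀ (γ : charField G ≃ₐ[ℚ] charField G) (v w : (quotientDatum c).lattice),
        (w : cocharSpace G) = (quotientDatum c).gal γ v →
          ∀ a, κ w (galTensor _ γ a) = galLaurent γ (κ v a)) := by
  exact ⟨quotientDatum_isFan c, quotSpace G, quotStr G, quotMap G, toricStructure hc, torusι G,
    unitsIso G, torusIso hc, cocharIso hc, quotMap_isQuotient G, quotMap_quotStr G,
    torusι_isOpenImmersion, unitsToProj_quotMap, ofFun_eq_sum_idempotent, torusToUnits_torusIso hc,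
    torusIso_chart_bot hc, cocharIso_torusIso hc, cocharIso_galTensor hc⟩
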